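/- Let $p$ be a prime and $G$ a profinite group. An action of $G$ on a set or a sheaf is called naive if some open subgroup of $G$ acts trivially. Let $\mathbb{Z}_p(1)$ be the $\mathbb{Z}_p$-module $\mathbb{Z}_p$ endowed with the action of $G$ given by a continuous character $\chi : G \to \mathbb{Z}_p^\times$. Assume that $(G,\mathbb{Z}_p(1))$ is $(1,\infty)$-cyclotomic, i.e. for every open subgroup $H \subseteq G$ the map $H^1(H,\mathbb{Z}_p(1)) \to H^1(H,\mathbb{F}_p(1))$ on continuous cohomology, induced by reduction modulo $p$, is surjective. Let $S$ be a perfect quasi-compact scheme of characteristic $p$, equipped with a naive action of $G$ and covered by $G$-invariant affine open subschemes, and let $L$ be a $G$-linearized line bundle over $S$ (with naive semilinear action). For $s \geq 1$, let $\mathbf{W}_s(L)$ be the $s$-th Teichmüller lift of $L$, i.e. the $G$-linearized line bundle over $\mathbf{W}_s(\mathcal{O}_S)$ obtained from the $\mathbb{G}_m$-torsor of $L$ via the Teichmüller section $\mathbb{G}_m \to \mathbf{W}_s(\mathcal{O}_S)^\times$, and put $\mathbf{W}_s(L)(1) := \mathbf{W}_s(L) \otimes_{\mathbb{Z}_p}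 \mathbb{Z}_p(1)$. Torsors are taken for the Zariski topology. A $(G,\mathbf{W}_s(L)(1))$-torsor is a $\mathbf{W}_s(L)(1)$-torsor over $S$ with a naive action of $G$ that is semilinear, i.e. compatible with the actions of $G$ on $S$ and on $\mathbf{W}_s(L)(1)$, and which has sections over the members of some cover of $S$ by $G$-invariant open subsets. A $\mathbf{W}(L)(1)$-torsor is a compatible system $(P_s)_{s \geq 1}$ of $\mathbf{W}_s(L)(1)$-torsors, with isomorphisms between the reduction of $P_{s+1}$ and $P_s$; a $(G,\mathbf{W}(L)(1))$-torsor is likewise a compatible system of $(G,\mathbf{W}_s(L)(1))$-torsors. Isomorphism classes of $\mathbf{W}(L)(1)$-torsors form the group $H^1(S,\mathbf{W}(L)(1))$, on which $G$ acts. Let $r \geq 1$ be an integer, let $P_r$ be a $(G,\mathbf{W}_r(L)(1))$-torsor over $S$, and let $\overline{P}_r$ be the underlying $\mathbf{W}_r(L)(1)$-torsor, obtained by forgetting the action of $G$. Assume that $\overline{P}_r$ lifts to a $\mathbf{W}(L)(1)$-torsor $\overline{P}$, i.e. that an isomorphism $\iota$ from the $r$-th component of $\overline{P}$ to $\overline{P}_r$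 is given, and that the class of $\overline{P}$ in $H^1(S,\mathbf{W}(L)(1))$ is $G$-invariant, i.e. for every $g \in G$ the translate $g\cdot\overline{P}$ is isomorphic to $\overline{P}$ as a $\mathbf{W}(L)(1)$-torsor. Then $\overline{P}$ can be equipped with the structure of a $(G,\mathbf{W}(L)(1))$-torsor lifting $P_r$, i.e. such that $\iota$ is $G$-equivariant. -/

import Mathlib

open CategoryTheory AlgebraicGeometry Opposite TopologicalSpace

universe u v

noncomputable section

namespace SmoothProfinite

/-! ## Continuous first cohomology and cyclotomic pairs -/

section Cohomology

variable {H : Type v} [Group H] [TopologicalSpace H]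
variable {R : Type*} [CommRing R] [TopologicalSpace R] [IsTopologicalRing R]
variable {R' : Type*} [CommRing R'] [TopologicalSpace R'] [IsTopologicalRing R']

/-- Continuous `1`-cocycles of `H` with values in `R(ψ)`, that is, the topological group `R` on
which `H` acts through the character `ψ`. -/
def contCocycles (ψ : H →* Rˣ) : AddSubgroup (H → R) where
  carrier := {c | Continuous c ∧ ∀ g h, c (g * h) = c g + ψ g * c h}
  zero_mem' := ⟨continuous_const, fun g h => by simp⟩
  add_mem' := by
    rintro c d ⟨hc, hc'⟩ ⟨hd, hd'⟩
    exact ⟨hc.add hd, fun g h => by simp only [Pi.add_apply, hc', hd']; ring⟩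
  neg_mem' := by
    rintro c ⟨hc, hc'⟩
    exact ⟨hc.neg, fun g h => by simp only [Pi.neg_apply, hc']; ring⟩

/-- `1`-coboundaries of `H` with values in `R(ψ)`: the functions `g ↦ g • a - a`. -/
def coboundaries (ψ : H →* Rˣ) : AddSubgroup (H → R) where
  carrier := {c | ∃ a : R, ∀ g, c g = ψ g * a - a}
  zero_mem' := ⟨0, fun g => by simp⟩
  add_mem' := by
    rintro c d ⟨a, ha⟩ ⟨b, hb⟩
    exact ⟨a + b, fun g => by simp only [Pi.add_apply, ha, hb]; ring⟩
  neg_mem' := by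
    rintro c ⟨a, ha⟩
    exact ⟨-a, fun g => by simp only [Pi.neg_apply, ha]; ring⟩

/-- The continuous cohomology group `H¹(H, R(ψ))`. -/
abbrev ContH1 (ψ : H →* Rˣ) : Type _ :=
  contCocycles ψ ⧸ (coboundaries ψ).addSubgroupOf (contCocycles ψ)

/-- A continuous ring homomorphism `f : R → R'` sends cocycles to cocycles. -/
def contCocyclesMap (ψ : H →* Rˣ) (f : R →+* R') (hf : Continuous f) :
    contCocycles ψ →+ contCocycles ((Units.map (f : R →* R')).comp ψ) where
  toFun c := ⟨fun g => f (c.1 g), hf.comp c.2.1, fun g h => by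
    change f (c.1 (g * h)) = _
    rw [c.2.2 g h, map_add, map_mul]; rfl⟩
  map_zero' := Subtype.ext (funext fun g => map_zero f)
  map_add' c d := Subtype.ext (funext fun g => map_add f _ _)

/-- The map `H¹(H, R(ψ)) → H¹(H, R'(f ∘ ψ))` induced by a continuous ring homomorphism `f`. -/
def ContH1.map (ψ : H →* Rˣ) (f : R →+* R') (hf : Continuous f) :
    ContH1 ψ →+ ContH1 ((Units.map (f : R →* R')).comp ψ) :=
  QuotientAddGroup.map _ _ (contCocyclesMap ψ f hf) (by
    rintro c ⟨a, ha⟩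
    refine ⟨f a, fun g => ?_⟩
    have h : c.1 g = ψ g * a - a := ha g
    change f (c.1 g) = _
    rw [h, map_sub, map_mul]; rfl)

end Cohomology

variable (p : ℕ) [Fact p.Prime]

theorem continuous_toZModPow (n : ℕ) :
    Continuous (PadicInt.toZModPow n : ℤ_[p] →+* ZMod (p ^ n)) := by
  refine continuous_of_continuousAt_zero (PadicInt.toZModPow n : ℤ_[p] →+* ZMod (p ^ n)) ?_
  rw [ContinuousAt, map_zero, nhds_discrete (ZMod (p ^ n)), Filter.tendsto_pure]
  have hpos : (0 : ℝ) < (p : ℝ) ^ (-n + 1 : ℤ) :=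
    zpow_pos (by exact_mod_cast (Fact.out : p.Prime).pos) _
  filter_upwards [Metric.ball_mem_nhds (0 : ℤ_[p]) hpos] with x hx
  rw [← RingHom.mem_ker, PadicInt.ker_toZModPow, ← PadicInt.norm_le_pow_iff_mem_span_pow,
    PadicInt.norm_le_pow_iff_norm_lt_pow_add_one]
  simpa using hx

theorem continuous_toZMod : Continuous (PadicInt.toZMod : ℤ_[p] →+* ZMod p) := by
  refine continuous_of_continuousAt_zero (PadicInt.toZMod : ℤ_[p] →+* ZMod p) ?_
  rw [ContinuousAt, map_zero, nhds_discrete (ZMod p), Filter.tendsto_pure]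
  filter_upwards [Metric.ball_mem_nhds (0 : ℤ_[p]) one_pos] with x hx
  rw [← RingHom.mem_ker, PadicInt.ker_toZMod, IsLocalRing.mem_maximalIdeal, mem_nonunits_iff,
    PadicInt.isUnit_iff]
  have : ‖x‖ < 1 := by simpa using hx
  exact this.ne

/-- Let `ℤ_p(1)` be the module `ℤ_p` on which `G` acts through the character `χ` (every free
`ℤ_p`-module of rank one with a continuous `G`-action is of this form). The pair `(G, ℤ_p(1))` is
`(1,∞)`-cyclotomic if the action is continuous and, for every open subgroup `H` of `G`, the map
`H¹(H, ℤ_p(1)) → H¹(H, 𝔽_p(1))` given by reduction modulo `p` is surjective. -/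
def IsOneInftyCyclotomic {G : Type v} [Group G] [TopologicalSpace G] (χ : G →* ℤ_[p]ˣ) : Prop :=
  Continuous χ ∧ ∀ H : Subgroup G, IsOpen (H : Set G) →
    Function.Surjective
      (ContH1.map (χ.comp H.subtype) (PadicInt.toZMod : ℤ_[p] →+* ZMod p) (continuous_toZMod p))

/-! ## `G`-schemes -/

/-- A (naive) action of `G` on the scheme `S`, such that `S` is covered by `G`-invariant affine open
subschemes. Multiplication in `Aut S` is `(f * g).hom = g.hom ≫ f.hom`, so this is a left action. -/
structure GSchemeAction (G : Type v) [Group G] [TopologicalSpace G] (S : Scheme.{u}) where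
  toAut : G →* Aut S
  isOpen_ker : IsOpen (toAut.ker : Set G)
  exists_affine : ∀ x : S, ∃ U : S.Opens,
    x ∈ U ∧ IsAffineOpen U ∧ ∀ g : G, (toAut g).hom ⁻¹ᵁ U = U

/-- `S` is a perfect scheme of characteristic `p`: one has `p = 0` in `𝒪_S`, and the absolute
Frobenius of `S` (which is the identity on the underlying topological space) is an isomorphism. -/
structure IsPerfectOfChar (S : Scheme.{u}) : Prop where
  char_eq : (p : Γ(S, ⊤)) = 0
  bijective_frob : ∀ U : S.Opens, Function.Bijective fun a : Γ(S, U) => a ^ p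

namespace GSchemeAction

variable {G : Type v} [Group G] [TopologicalSpace G] {S : Scheme.{u}} (A : GSchemeAction G S)

/-- The automorphism `g⁻¹ : S → S` by which the inverse of `g` acts. -/
def invHom (g : G) : S ⟶ S := (A.toAut g).inv

theorem invHom_of_mem_ker {g : G} (hg : g ∈ A.toAut.ker) : A.invHom g = 𝟙 S := by
  unfold invHom
  rw [MonoidHom.mem_ker.1 hg]
  rfl

theorem invHom_one : A.invHom 1 = 𝟙 S := A.invHom_of_mem_ker (one_mem _)

theorem invHom_mul (g h : G) : A.invHom (g * h) = A.invHom g ≫ A.invHom h := by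
  unfold invHom
  rw [map_mul]
  rfl

/-- The translate `gU` of an open subset `U` of `S`, as the preimage of `U` under `g⁻¹`. -/
abbrev image (g : G) (U : S.Opens) : S.Opens := A.invHom g ⁻¹ᵁ U

theorem image_eq_of_mem_ker {g : G} (hg : g ∈ A.toAut.ker) (U : S.Opens) : A.image g U = U := by
  change A.invHom g ⁻¹ᵁ U = _
  rw [A.invHom_of_mem_ker hg]
  rfl

theorem image_one (U : S.Opens) : A.image 1 U = U := A.image_eq_of_mem_ker (one_mem _) U

theorem image_mul (g h : G) (U : S.Opens) : A.image (g * h) U = A.image g (A.image h U) := by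
  change A.invHom (g * h) ⁻¹ᵁ U = _
  rw [invHom_mul]
  rfl

theorem image_mono (g : G) {U V : S.Opens} (h : U ≤ V) : A.image g U ≤ A.image g V :=
  fun _ hx => h hx

theorem image_inv_le_iff (g : G) {U V : S.Opens} : A.image g⁻¹ V ≤ U ↔ V ≤ A.image g U := by
  constructor
  · intro h
    have := A.image_mono g h
    rwa [← image_mul, mul_inv_cancel, image_one] at this
  · intro h
    have := A.image_mono g⁻¹ h
    rwa [← image_mul, inv_mul_cancel, image_one] at this

theorem le_image_image_inv (g : G) (V : S.Opens) : V ≤ A.image g (A.image g⁻¹ V) :=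
  (A.image_inv_le_iff g).1 le_rfl

theorem le_image_of_inv_le {g : G} {U V : S.Opens} (h : V ≤ A.image g U) (W : S.Opens)
    (hW : W ≤ V) : A.image g⁻¹ W ≤ U :=
  (A.image_inv_le_iff g).2 (hW.trans h)

/-- The (left) action of `G` on functions: `a ∈ 𝒪(U)` is sent to the restriction to `V` of
`g • a = (g⁻¹)^* a ∈ 𝒪(gU)`, for `V ⊆ gU`. -/
def ringAct (g : G) {U V : S.Opens} (h : V ≤ A.image g U) : Γ(S, U) →+* Γ(S, V) :=
  ((A.invHom g).appLE U V h).hom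

theorem ringAct_of_mem_ker {g : G} (hg : g ∈ A.toAut.ker) {U V : S.Opens} (h : V ≤ A.image g U)
    (h' : V ≤ U) (a : Γ(S, U)) : A.ringAct g h a = S.presheaf.map (homOfLE h').op a := by
  have key : ∀ (f : S ⟶ S) (hf : f = 𝟙 S) (e : V ≤ f ⁻¹ᵁ U),
      f.appLE U V e = S.presheaf.map (homOfLE h').op := by
    rintro f rfl e
    rw [Scheme.Hom.appLE, Scheme.Hom.id_app]
    exact Category.id_comp _
  unfold ringAct
  rw [key _ (A.invHom_of_mem_ker hg)]

theorem ringAct_one {U V : S.Opens} (h : V ≤ A.image 1 U) (h' : V ≤ U) (a : Γ(S, U)) :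
    A.ringAct 1 h a = S.presheaf.map (homOfLE h').op a :=
  A.ringAct_of_mem_ker (one_mem _) h h' a

theorem ringAct_mul (g g' : G) {U V W : S.Opens} (h : W ≤ A.image g V) (h' : V ≤ A.image g' U)
    (h'' : W ≤ A.image (g * g') U) (a : Γ(S, U)) :
    A.ringAct g h (A.ringAct g' h' a) = A.ringAct (g * g') h'' a := by
  have key : ∀ (f : S ⟶ S) (hf : f = A.invHom g ≫ A.invHom g') (e : W ≤ f ⁻¹ᵁ U),
      f.appLE U W e = (A.invHom g').appLE U V h' ≫ (A.invHom g).appLE V W h := by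
    rintro f rfl e
    rw [Scheme.Hom.appLE_comp_appLE]
  unfold ringAct
  rw [key _ (A.invHom_mul _ _)]
  rfl

/-- A (naive) action of `G` on a presheaf `M` of abelian groups on the `G`-scheme `S`: compatible
additive maps `g : M(U) → M(gU)`, which are given here followed by the restriction to an open subset
`V ⊆ gU`; an open subgroup of `G` acts trivially. -/
structure GStructure (M : TopCat.Presheaf Ab.{u} S) where
  act : ∀ (g : G) {U V : S.Opens}, V ≤ A.image g U → (M.obj (op U) →+ M.obj (op V))
  act_one : ∀ {U V : S.Opens} (h : V ≤ A.image 1 U) (h' : V ≤ U) (x : M.obj (op U)),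
    act 1 h x = M.map (homOfLE h').op x
  act_mul : ∀ (g g' : G) {U V W : S.Opens} (h : W ≤ A.image g V) (h' : V ≤ A.image g' U)
    (h'' : W ≤ A.image (g * g') U) (x : M.obj (op U)), act g h (act g' h' x) = act (g * g') h'' x
  exists_open : ∃ N : Subgroup G, IsOpen (N : Set G) ∧ N ≤ A.toAut.ker ∧
    ∀ g ∈ N, ∀ {U V : S.Opens} (h : V ≤ A.image g U) (h' : V ≤ U) (x : M.obj (op U)),
      act g h x = M.map (homOfLE h').op x

/-- A `G`-linearization of an `𝒪_S`-module `L`: a (naive) semilinear action of `G` on `L`. -/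
structure Linearization (L : S.Modules) extends A.GStructure L.presheaf where
  act_smul : ∀ (g : G) {U V : S.Opens} (h : V ≤ A.image g U) (a : Γ(S, U)) (x : Γ(L, U)),
    act g h (a • x) = A.ringAct g h a • act g h x

end GSchemeAction

/-! ## Truncated Witt vectors -/

section Witt

variable {R : Type*} [CommRing R] {R' : Type*} [CommRing R'] {R'' : Type*} [CommRing R'']

/-- Functoriality of truncated Witt vectors: apply `f` to each coefficient. -/
def wittMap (r : ℕ) (f : R →+* R') : TruncatedWittVector p r R →+* TruncatedWittVector p r R' :=
  have key : ∀ x : WittVector p R,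
      (TruncatedWittVector.mk p fun i => f ((WittVector.truncate r x).coeff i)) =
        WittVector.truncate r (WittVector.map f x) := fun x => by
    ext i
    simp [WittVector.coeff_truncate, WittVector.map_coeff]
  { toFun := fun x => TruncatedWittVector.mk p fun i => f (x.coeff i)
    map_one' := by rw [← map_one (WittVector.truncate (p := p) r), key, map_one, map_one]
    map_zero' := by rw [← map_zero (WittVector.truncate (p := p) r), key, map_zero, map_zero]
    map_mul' := fun x y => by
      obtain ⟨x, rfl⟩ := WittVector.truncate_surjective p r R x
      obtain ⟨y, rfl⟩ := WittVector.truncate_surjective p r R y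
      rw [← map_mul, key, key, key, map_mul, map_mul]
    map_add' := fun x y => by
      obtain ⟨x, rfl⟩ := WittVector.truncate_surjective p r R x
      obtain ⟨y, rfl⟩ := WittVector.truncate_surjective p r R y
      rw [← map_add, key, key, key, map_add, map_add] }

@[simp]
theorem coeff_wittMap (r : ℕ) (f : R →+* R') (x : TruncatedWittVector p r R) (i : Fin r) :
    (wittMap p r f x).coeff i = f (x.coeff i) :=
  TruncatedWittVector.coeff_mk _ _

theorem wittMap_wittMap (r : ℕ) (f : R →+* R') (f' : R' →+* R'') (x : TruncatedWittVector p r R) :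
    wittMap p r f' (wittMap p r f x) = wittMap p r (f'.comp f) x := by
  ext i
  simp

/-- The Teichmüller representative `[a] = (a, 0, 0, …)` of `a` in `W_r(R)`. -/
def wittTeich (r : ℕ) (a : R) : TruncatedWittVector p r R :=
  WittVector.truncate r (WittVector.teichmuller p a)

theorem wittMap_wittTeich (r : ℕ) (f : R →+* R') (a : R) :
    wittMap p r f (wittTeich p r a) = wittTeich p r (f a) := by
  ext i
  rw [coeff_wittMap, wittTeich, wittTeich, WittVector.coeff_truncate, WittVector.coeff_truncate,
    ← WittVector.map_teichmuller, WittVector.map_coeff]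

theorem truncate_wittMap {r s : ℕ} (h : r ≤ s) (f : R →+* R') (x : TruncatedWittVector p s R) :
    TruncatedWittVector.truncate h (wittMap p s f x) =
      wittMap p r f (TruncatedWittVector.truncate h x) := by
  ext i
  simp [TruncatedWittVector.coeff_truncate]

theorem truncate_wittTeich {r s : ℕ} (h : r ≤ s) (a : R) :
    TruncatedWittVector.truncate h (wittTeich p s a) = wittTeich p r a :=
  TruncatedWittVector.truncate_wittVector_truncate h _

theorem pow_p_nsmul_eq_zero (hp : (p : R) = 0) (r : ℕ) (x : TruncatedWittVector p r R) :
    p ^ r • x = 0 := by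
  cases subsingleton_or_nontrivial R with
  | inl h =>
    ext i
    exact Subsingleton.elim _ _
  | inr h =>
    have : CharP R p :=
      (CharP.charP_iff_prime_eq_zero (Fact.out : p.Prime)).2 hp
    obtain ⟨x, rfl⟩ := WittVector.truncate_surjective p r R x
    rw [← map_nsmul]
    ext i
    rw [WittVector.coeff_truncate, nsmul_eq_mul, mul_comm, Nat.cast_pow,
      WittVector.mul_pow_charP_coeff_zero _ i.2, TruncatedWittVector.coeff_zero]

end Witt

/-! ## Line bundles and their Teichmüller lifts -/

section LineBundle

variable {S : Scheme.{u}}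

/-- A section `e` of `L` over `V` is a generator if `a ↦ a e` is an isomorphism `𝒪_V → L|_V`. -/
def IsGenerator (L : S.Modules) {V : S.Opens} (e : Γ(L, V)) : Prop :=
  ∀ (W : S.Opens) (h : W ≤ V),
    Function.Bijective fun a : Γ(S, W) => a • L.presheaf.map (homOfLE h).op e

/-- The generators of `L` over `V`, that is, the sections over `V` of the `𝔾_m`-torsor attached to
`L`. -/
def Gen (L : S.Modules) (V : S.Opens) : Type u := {e : Γ(L, V) // IsGenerator L e}

/-- `L` is a line bundle: locally on `S`, it is isomorphic to `𝒪_S`. -/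
def IsLineBundle (L : S.Modules) : Prop :=
  ∀ x : S, ∃ U : S.Opens, x ∈ U ∧ Nonempty (Gen L U)

theorem map_map_apply (M : TopCat.Presheaf Ab.{u} S) {U V W : S.Opens} (h : V ≤ U) (h' : W ≤ V)
    (x : M.obj (op U)) :
    M.map (homOfLE h').op (M.map (homOfLE h).op x) = M.map (homOfLE (h'.trans h)).op x := by
  rw [← ConcreteCategory.comp_apply, ← M.map_comp]
  rfl

/-- Restriction of generators. -/
def Gen.res {L : S.Modules} {V W : S.Opens} (h : W ≤ V) (e : Gen L V) : Gen L W :=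
  ⟨L.presheaf.map (homOfLE h).op e.1, fun W' h' => by
    rw [map_map_apply]
    exact e.2 W' (h'.trans h)⟩

/-- The sections over `U` of the Teichmüller lift `W_r(L)` of the line bundle `L`: the line bundle
over `W_r(𝒪_S)` obtained from the `𝔾_m`-torsor of generators of `L` by the Teichmüller section
`𝔾_m → W_r(𝒪_S)ˣ`. A section `s` is given by its coordinates `f e ∈ W_r(𝒪(V))`, for all `V ⊆ U` and
all generators `e` of `L` over `V` (heuristically `s = f e • [e]` over `V`); these are compatible with
restrictions, and `f e = [a] * f e'` whenever `e' = a • e`. -/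
def wittSections (L : S.Modules) (r : ℕ) (U : S.Opens) :
    AddSubgroup (∀ V : {V : S.Opens // V ≤ U}, Gen L V.1 → TruncatedWittVector p r Γ(S, V.1)) where
  carrier := {f |
    (∀ (V V' : {V : S.Opens // V ≤ U}) (h : V'.1 ≤ V.1) (e : Gen L V.1),
      f V' (e.res h) = wittMap p r (S.presheaf.map (homOfLE h).op).hom (f V e)) ∧
    (∀ (V : {V : S.Opens // V ≤ U}) (e e' : Gen L V.1) (a : Γ(S, V.1)), e'.1 = a • e.1 →
      f V e = wittTeich p r a * f V e')}
  zero_mem' := ⟨fun V V' h e => by simp only [Pi.zero_apply, map_zero],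
    fun V e e' a h => by simp only [Pi.zero_apply, mul_zero]⟩
  add_mem' := by
    rintro f f' ⟨hf, hf₁⟩ ⟨hg, hg₁⟩
    refine ⟨fun V V' h e => ?_, fun V e e' a h => ?_⟩
    · simp only [Pi.add_apply, map_add, hf V V' h e, hg V V' h e]
    · simp only [Pi.add_apply, mul_add, hf₁ V e e' a h, hg₁ V e e' a h]
  neg_mem' := by
    rintro f ⟨hf, hf₁⟩
    refine ⟨fun V V' h e => ?_, fun V e e' a h => ?_⟩
    · simp only [Pi.neg_apply, map_neg, hf V V' h e]
    · simp only [Pi.neg_apply, mul_neg, hf₁ V e e' a h]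

/-- The Teichmüller lift `W_r(L)`, as a presheaf (in fact, a sheaf) of abelian groups. -/
def wittLine (L : S.Modules) (r : ℕ) : TopCat.Presheaf Ab.{u} S where
  obj U := AddCommGrpCat.of (wittSections p L r U.unop)
  map i := AddCommGrpCat.ofHom
    { toFun := fun f => ⟨fun V e => f.1 ⟨V.1, V.2.trans i.unop.le⟩ e,
        fun V V' h e => f.2.1 ⟨V.1, V.2.trans i.unop.le⟩ ⟨V'.1, V'.2.trans i.unop.le⟩ h e,
        fun V e e' a h => f.2.2 ⟨V.1, V.2.trans i.unop.le⟩ e e' a h⟩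
      map_zero' := rfl
      map_add' := fun _ _ => rfl }
  map_id _ := rfl
  map_comp _ _ := rfl

/-- The reduction `W_{r+1}(L) → W_r(L)`. -/
def wittLineReduction (L : S.Modules) (r : ℕ) : wittLine p L (r + 1) ⟶ wittLine p L r where
  app U := AddCommGrpCat.ofHom
    { toFun := fun f => ⟨fun V e => TruncatedWittVector.truncate (Nat.le_succ r) (f.1 V e),
        fun V V' h e => by
          dsimp only
          rw [f.2.1 V V' h e, truncate_wittMap],
        fun V e e' a h => by
          dsimp only
          rw [f.2.2 V e e' a h, map_mul, truncate_wittTeich]⟩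
      map_zero' := Subtype.ext (funext fun V => funext fun e => map_zero _)
      map_add' := fun f f' => Subtype.ext (funext fun V => funext fun e => map_add _ _ _) }
  naturality _ _ _ := rfl

theorem pow_p_nsmul_wittLine (hp : (p : Γ(S, ⊤)) = 0) (L : S.Modules) (r : ℕ) (U : S.Opens)
    (x : (wittLine p L r).obj (op U)) : p ^ r • x = 0 := by
  refine Subtype.ext (funext fun V => funext fun e => ?_)
  have hV : (p : Γ(S, V.1)) = 0 := by
    rw [← map_natCast (S.presheaf.map (homOfLE (le_top : V.1 ≤ ⊤)).op).hom, hp, map_zero]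
  change (p ^ r • (x.1 V e) : TruncatedWittVector p r Γ(S, V.1)) = 0
  exact pow_p_nsmul_eq_zero p hV r _

end LineBundle

namespace GSchemeAction

variable {G : Type v} [Group G] [TopologicalSpace G] {S : Scheme.{u}} {A : GSchemeAction G S}

theorem ringAct_res (g : G) {U U' V : S.Opens} (h : V ≤ A.image g U') (h' : U' ≤ U)
    (h'' : V ≤ A.image g U) (a : Γ(S, U)) :
    A.ringAct g h (S.presheaf.map (homOfLE h').op a) = A.ringAct g h'' a := by
  have e := A.ringAct_mul g 1 h (h'.trans (A.image_one U).ge) (by rwa [mul_one]) a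
  rw [A.ringAct_one _ h'] at e
  rw [e]
  congr 1
  simp only [mul_one]

theorem res_ringAct (g : G) {U V V' : S.Opens} (h : V ≤ A.image g U) (h' : V' ≤ V)
    (a : Γ(S, U)) :
    S.presheaf.map (homOfLE h').op (A.ringAct g h a) = A.ringAct g (h'.trans h) a := by
  have e := A.ringAct_mul 1 g (h'.trans (A.image_one V).ge) h (by rw [one_mul]; exact h'.trans h) a
  rw [A.ringAct_one _ h'] at e
  rw [e]
  congr 1
  simp only [one_mul]

theorem ringAct_bijective (g : G) {U V : S.Opens} (h : V ≤ A.image g U) (h' : U ≤ A.image g⁻¹ V) :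
    Function.Bijective (A.ringAct g h) := by
  refine Function.bijective_iff_has_inverse.2 ⟨A.ringAct g⁻¹ h', fun a => ?_, fun a => ?_⟩
  · rw [A.ringAct_mul _ _ h' h (by rw [inv_mul_cancel, image_one]),
      A.ringAct_of_mem_ker (by rw [inv_mul_cancel]; exact one_mem _) _ le_rfl]
    exact congrArg (fun k : Γ(S, U) ⟶ Γ(S, U) => k a) (S.presheaf.map_id _)
  · rw [A.ringAct_mul _ _ h h' (by rw [mul_inv_cancel, image_one]),
      A.ringAct_of_mem_ker (by rw [mul_inv_cancel]; exact one_mem _) _ le_rfl]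
    exact congrArg (fun k : Γ(S, V) ⟶ Γ(S, V) => k a) (S.presheaf.map_id _)

namespace GStructure

variable {M : TopCat.Presheaf Ab.{u} S} (σ : A.GStructure M)

theorem act_congr {g g' : G} (hg : g = g') {U V : S.Opens} (h : V ≤ A.image g U)
    (h' : V ≤ A.image g' U) (x : M.obj (op U)) : σ.act g h x = σ.act g' h' x := by
  subst hg
  rfl

theorem act_res (g : G) {U U' V : S.Opens} (h : V ≤ A.image g U') (h' : U' ≤ U)
    (h'' : V ≤ A.image g U) (x : M.obj (op U)) :
    σ.act g h (M.map (homOfLE h').op x) = σ.act g h'' x := by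
  rw [← σ.act_one (h'.trans (A.image_one U).ge) h',
    σ.act_mul g 1 h (h'.trans (A.image_one U).ge) (by rwa [mul_one])]
  exact σ.act_congr (mul_one g) _ _ x

theorem res_act (g : G) {U V V' : S.Opens} (h : V ≤ A.image g U) (h' : V' ≤ V)
    (x : M.obj (op U)) :
    M.map (homOfLE h').op (σ.act g h x) = σ.act g (h'.trans h) x := by
  rw [← σ.act_one (h'.trans (A.image_one V).ge) h',
    σ.act_mul 1 g (h'.trans (A.image_one V).ge) h (by rw [one_mul]; exact h'.trans h)]
  exact σ.act_congr (one_mul g) _ _ x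

theorem act_bijective (g : G) {U V : S.Opens} (h : V ≤ A.image g U) (h' : U ≤ A.image g⁻¹ V) :
    Function.Bijective (σ.act g h) := by
  refine Function.bijective_iff_has_inverse.2 ⟨σ.act g⁻¹ h', fun x => ?_, fun x => ?_⟩
  · rw [σ.act_mul _ _ h' h (by rw [inv_mul_cancel, image_one]),
      σ.act_congr (inv_mul_cancel g) _ (A.image_one U).ge, σ.act_one _ le_rfl]
    exact congrArg (fun k : M.obj (op U) ⟶ M.obj (op U) => k x) (M.map_id _)
  · rw [σ.act_mul _ _ h h' (by rw [mul_inv_cancel, image_one]),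
      σ.act_congr (mul_inv_cancel g) _ (A.image_one V).ge, σ.act_one _ le_rfl]
    exact congrArg (fun k : M.obj (op V) ⟶ M.obj (op V) => k x) (M.map_id _)

theorem nsmul_eq_of_cast_eq {B : Type*} [AddCommGroup B] {n : ℕ} {x : B} (hx : n • x = 0)
    {k l : ℕ} (h : (k : ZMod n) = (l : ZMod n)) : k • x = l • x := by
  have key : ∀ k : ℕ, k • x = (k % n) • x := fun k => by
    conv_lhs => rw [← Nat.mod_add_div k n, add_nsmul, mul_comm, mul_nsmul', hx, nsmul_zero, add_zero]
  rw [key k, key l, (ZMod.natCast_eq_natCast_iff' k l n).1 h]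

/-- Let `M` be killed by `n`. The twist `M(ψ) = M ⊗ (ℤ/n)(ψ)` of the action of `G` on `M` by a
character `ψ : G → (ℤ/n)ˣ` with open kernel: the action of `g` on `M(ψ)` is the action of `g` on `M`
multiplied by `ψ g`, where the class of `k` in `ℤ/n` acts on `M` as the multiplication by `k`. -/
def twist (n : ℕ) [NeZero n] (hn : ∀ (U : S.Opens) (x : M.obj (op U)), n • x = 0)
    (ψ : G →* (ZMod n)ˣ) (hψ : IsOpen (ψ.ker : Set G)) : A.GStructure M where
  act g {_ _} h := (ψ g : ZMod n).val • σ.act g h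
  act_one {U V} h h' x := by
    change (ψ 1 : ZMod n).val • σ.act 1 h x = _
    rw [σ.act_one h h', nsmul_eq_of_cast_eq (hn _ _) (l := 1), one_nsmul]
    rw [ZMod.natCast_zmod_val, map_one, Units.val_one, Nat.cast_one]
  act_mul g g' {U V W} h h' h'' x := by
    change (ψ g : ZMod n).val • σ.act g h ((ψ g' : ZMod n).val • σ.act g' h' x) =
      (ψ (g * g') : ZMod n).val • σ.act (g * g') h'' x
    rw [map_nsmul, σ.act_mul g g' h h' h'', ← mul_nsmul']
    refine nsmul_eq_of_cast_eq (hn _ _) ?_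
    rw [Nat.cast_mul, ZMod.natCast_zmod_val, ZMod.natCast_zmod_val, ZMod.natCast_zmod_val, map_mul,
      Units.val_mul]
  exists_open := by
    obtain ⟨N, hN, hN', hact⟩ := σ.exists_open
    refine ⟨N ⊓ ψ.ker, hN.inter hψ, inf_le_left.trans hN', fun g hg U V h h' x => ?_⟩
    change (ψ g : ZMod n).val • σ.act g h x = _
    rw [hact g hg.1 h h', nsmul_eq_of_cast_eq (hn _ _) (l := 1), one_nsmul]
    rw [ZMod.natCast_zmod_val, MonoidHom.mem_ker.1 hg.2, Units.val_one, Nat.cast_one]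

end GStructure

namespace Linearization

variable {L : S.Modules} (σ : A.Linearization L)

/-- The action of `G` on generators of `L`. -/
def genAct (g : G) {U V : S.Opens} (h : V ≤ A.image g U) (e : Gen L U) : Gen L V :=
  ⟨σ.act g h e.1, fun W hW => by
    have hb := e.2 (A.image g⁻¹ W) (A.le_image_of_inv_le h W hW)
    have h₁ : W ≤ A.image g (A.image g⁻¹ W) := A.le_image_image_inv g W
    have hL := σ.act_bijective g h₁ le_rfl
    have hR := ringAct_bijective (A := A) g h₁ le_rfl
    have key : ∀ a : Γ(S, A.image g⁻¹ W),
        A.ringAct g h₁ a • L.presheaf.map (homOfLE hW).op (σ.act g h e.1) =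
          σ.act g h₁
            (a • L.presheaf.map (homOfLE (A.le_image_of_inv_le h W hW)).op e.1) := fun a => by
      rw [σ.act_smul, σ.act_res g h₁ (A.le_image_of_inv_le h W hW) (hW.trans h), σ.res_act]
    have hc : (fun a : Γ(S, W) => a • L.presheaf.map (homOfLE hW).op (σ.act g h e.1)) ∘
        A.ringAct g h₁ = σ.act g h₁ ∘ fun a : Γ(S, A.image g⁻¹ W) =>
          a • L.presheaf.map (homOfLE (A.le_image_of_inv_le h W hW)).op e.1 :=
      funext key
    exact (Function.Bijective.of_comp_iff _ hR).1 (hc ▸ hL.comp hb)⟩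

theorem genAct_res (g : G) {U U' V : S.Opens} (h : V ≤ A.image g U') (h' : U' ≤ U)
    (h'' : V ≤ A.image g U) (e : Gen L U) : σ.genAct g h (e.res h') = σ.genAct g h'' e :=
  Subtype.ext (σ.act_res g h h' h'' e.1)

theorem res_genAct (g : G) {U V V' : S.Opens} (h : V ≤ A.image g U) (h' : V' ≤ V)
    (e : Gen L U) : (σ.genAct g h e).res h' = σ.genAct g (h'.trans h) e :=
  Subtype.ext (σ.res_act g h h' e.1)

theorem genAct_genAct (g g' : G) {U V W : S.Opens} (h : W ≤ A.image g V) (h' : V ≤ A.image g' U)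
    (h'' : W ≤ A.image (g * g') U) (e : Gen L U) :
    σ.genAct g h (σ.genAct g' h' e) = σ.genAct (g * g') h'' e :=
  Subtype.ext (σ.act_mul g g' h h' h'' e.1)

theorem genAct_congr {g g' : G} (hg : g = g') {U V : S.Opens} (h : V ≤ A.image g U)
    (h' : V ≤ A.image g' U) (e : Gen L U) : σ.genAct g h e = σ.genAct g' h' e := by
  subst hg
  rfl

/-- The action of `G` on the sections of `W_r(L)`: the coordinate of `g • f` with respect to a
generator `e` is the image under `g` of the coordinate of `f` with respect to `g⁻¹ e`. -/
def wittAct (r : ℕ) (g : G) {U V : S.Opens} (h : V ≤ A.image g U) :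
    wittSections p L r U →+ wittSections p L r V where
  toFun f := ⟨fun W e => wittMap p r (A.ringAct g (A.le_image_image_inv g W.1))
      (f.1 ⟨A.image g⁻¹ W.1, A.le_image_of_inv_le h W.1 W.2⟩ (σ.genAct g⁻¹ le_rfl e)),
    fun W W' h' e => by
      dsimp only
      rw [σ.genAct_res g⁻¹ le_rfl h' (A.image_mono g⁻¹ h'),
        ← σ.res_genAct g⁻¹ le_rfl (A.image_mono g⁻¹ h'),
        f.2.1 ⟨A.image g⁻¹ W.1, A.le_image_of_inv_le h W.1 W.2⟩
          ⟨A.image g⁻¹ W'.1, A.le_image_of_inv_le h W'.1 W'.2⟩ (A.image_mono g⁻¹ h'),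
        wittMap_wittMap, wittMap_wittMap]
      congr 1
      congr 1
      ext a
      exact (ringAct_res g _ _ (h'.trans (A.le_image_image_inv g W.1)) a).trans
        (res_ringAct g _ h' a).symm,
    fun W e e' a he => by
      dsimp only
      rw [f.2.2 ⟨A.image g⁻¹ W.1, A.le_image_of_inv_le h W.1 W.2⟩ _ (σ.genAct g⁻¹ le_rfl e')
        (A.ringAct g⁻¹ le_rfl a) (by
          change σ.act g⁻¹ _ e'.1 = _ • σ.act g⁻¹ _ e.1
          rw [he, σ.act_smul]), map_mul, wittMap_wittTeich]
      congr 2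
      rw [A.ringAct_mul g g⁻¹ _ _ (by rw [mul_inv_cancel, image_one]),
        A.ringAct_of_mem_ker (by rw [mul_inv_cancel]; exact one_mem _) _ le_rfl]
      exact congrArg (fun k : Γ(S, W.1) ⟶ Γ(S, W.1) => k a) (S.presheaf.map_id _)⟩
  map_zero' := Subtype.ext (funext fun W => funext fun e => map_zero _)
  map_add' _ _ := Subtype.ext (funext fun W => funext fun e => map_add _ _ _)

theorem wittAct_of_trivial (r : ℕ) {g : G} (hg : g ∈ A.toAut.ker)
    (hact : ∀ {U V : S.Opens} (h : V ≤ A.image g⁻¹ U) (h' : V ≤ U) (x : Γ(L, U)),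
      σ.act g⁻¹ h x = L.presheaf.map (homOfLE h').op x)
    {U V : S.Opens} (h : V ≤ A.image g U) (h' : V ≤ U) (f : wittSections p L r U) :
    σ.wittAct p r g h f = (wittLine p L r).map (homOfLE h').op f := by
  refine Subtype.ext (funext fun W => funext fun e => ?_)
  have hW : A.image g⁻¹ W.1 ≤ W.1 := (A.image_eq_of_mem_ker (inv_mem hg) W.1).le
  have he : σ.genAct g⁻¹ le_rfl e = e.res hW := Subtype.ext (hact le_rfl hW e.1)
  change wittMap p r (A.ringAct g (A.le_image_image_inv g W.1))
      (f.1 ⟨A.image g⁻¹ W.1, A.le_image_of_inv_le h W.1 W.2⟩ (σ.genAct g⁻¹ le_rfl e)) =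
    f.1 ⟨W.1, W.2.trans h'⟩ e
  rw [he, f.2.1 ⟨W.1, W.2.trans h'⟩ ⟨A.image g⁻¹ W.1, A.le_image_of_inv_le h W.1 W.2⟩ hW e,
    wittMap_wittMap]
  ext i
  rw [coeff_wittMap]
  have := (ringAct_res (A := A) g (A.le_image_image_inv g W.1) hW
    (A.image_eq_of_mem_ker hg W.1).ge ((f.1 ⟨W.1, W.2.trans h'⟩ e).coeff i)).trans
      (A.ringAct_of_mem_ker hg _ le_rfl _)
  exact this.trans (congrArg (fun k : Γ(S, W.1) ⟶ Γ(S, W.1) =>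
    k ((f.1 ⟨W.1, W.2.trans h'⟩ e).coeff i)) (S.presheaf.map_id _))

/-- The `G`-linearization of the Teichmüller lift `W_r(L)`. -/
def wittGStructure (r : ℕ) : A.GStructure (wittLine p L r) where
  act g {_ _} h := σ.wittAct p r g h
  act_one {U V} h h' f := by
    refine σ.wittAct_of_trivial p r (one_mem _) (fun {U V} h h' x => ?_) h h' f
    rw [σ.act_congr inv_one h (h'.trans (A.image_one U).ge), σ.act_one _ h']
  act_mul g g' {U V W} h h' h'' f := by
    refine Subtype.ext (funext fun X => funext fun e => ?_)
    have h₁ : A.image g'⁻¹ (A.image g⁻¹ X.1) ≤ A.image (g * g')⁻¹ X.1 := by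
      rw [← image_mul, mul_inv_rev]
    have he : σ.genAct g'⁻¹ le_rfl (σ.genAct g⁻¹ le_rfl e) =
        (σ.genAct (g * g')⁻¹ le_rfl e).res h₁ := by
      rw [σ.res_genAct, σ.genAct_genAct g'⁻¹ g⁻¹ _ _ (by rw [image_mul])]
      exact σ.genAct_congr (mul_inv_rev g g').symm _ _ e
    have hX : A.image (g * g')⁻¹ X.1 ≤ U := A.le_image_of_inv_le h'' X.1 X.2
    change wittMap p r _ (wittMap p r _ (f.1 ⟨A.image g'⁻¹ (A.image g⁻¹ X.1), _⟩
      (σ.genAct g'⁻¹ le_rfl (σ.genAct g⁻¹ le_rfl e)))) =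
      wittMap p r _ (f.1 ⟨A.image (g * g')⁻¹ X.1, hX⟩ (σ.genAct (g * g')⁻¹ le_rfl e))
    rw [he, f.2.1 ⟨A.image (g * g')⁻¹ X.1, hX⟩ ⟨A.image g'⁻¹ (A.image g⁻¹ X.1), h₁.trans hX⟩ h₁,
      wittMap_wittMap, wittMap_wittMap]
    congr 1
    congr 1
    ext a
    have e₁ := ringAct_res (A := A) g' (A.le_image_image_inv g' (A.image g⁻¹ X.1)) h₁
      ((A.le_image_image_inv g' _).trans (A.image_mono g' h₁)) a
    refine (congrArg (A.ringAct g (A.le_image_image_inv g X.1)) e₁).trans ?_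
    exact A.ringAct_mul g g' _ _ _ a
  exists_open := by
    obtain ⟨N, hN, hN', hact⟩ := σ.exists_open
    refine ⟨N, hN, hN', fun g hg U V h h' f => ?_⟩
    exact σ.wittAct_of_trivial p r (hN' hg) (fun h h' x => hact g⁻¹ (inv_mem hg) h h' x) h h' f

/-- The action of `G` on `ℤ / p ^ r (1)`, as a character with values in `(ℤ / p ^ r)ˣ`. -/
def modChar (χ : G →* ℤ_[p]ˣ) (r : ℕ) : G →* (ZMod (p ^ r))ˣ :=
  (Units.map (PadicInt.toZModPow (p := p) r).toMonoidHom).comp χ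

theorem isOpen_ker_modChar {χ : G →* ℤ_[p]ˣ} (hχ : Continuous χ) (r : ℕ) :
    IsOpen ((modChar p χ r).ker : Set G) := by
  have hc : Continuous fun g : G => PadicInt.toZModPow r (χ g : ℤ_[p]) :=
    (continuous_toZModPow p r).comp (Units.continuous_val.comp hχ)
  convert (isOpen_discrete ({1} : Set (ZMod (p ^ r)))).preimage hc using 1
  ext g
  simp [modChar, MonoidHom.mem_ker, Units.ext_iff]

/-- The cyclotomic twist `W_r(L)(1) = W_r(L) ⊗_{ℤ_p} ℤ_p(1)`, where `ℤ_p(1)` is `ℤ_p` on which `G`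
acts through `χ`: this is the sheaf `W_r(L)`, on which the action of `g ∈ G` is multiplied
by `χ g ∈ ℤ_pˣ`, acting through its class in `ℤ / p ^ r`. -/
def wittTwist (hp : (p : Γ(S, ⊤)) = 0) {χ : G →* ℤ_[p]ˣ} (hχ : Continuous χ) (r : ℕ) :
    A.GStructure (wittLine p L r) :=
  (σ.wittGStructure p r).twist (p ^ r) (pow_p_nsmul_wittLine p hp L r) (modChar p χ r)
    (isOpen_ker_modChar p hχ r)

end Linearization

end GSchemeAction

/-! ## Torsors -/

section Torsors

variable {S : Scheme.{u}}

/-- A torsor on `S`, for the Zariski topology, under a sheaf `M` of abelian groups: a sheaf of sets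
with a simply transitive action of `M`, which has sections locally on `S`. -/
structure Torsor (M : TopCat.Presheaf Ab.{u} S) where
  sheaf : TopCat.Sheaf (Type u) S
  vadd : ∀ {U : S.Opens}, M.obj (op U) → sheaf.1.obj (op U) → sheaf.1.obj (op U)
  zero_vadd : ∀ {U : S.Opens} (x : sheaf.1.obj (op U)), vadd 0 x = x
  add_vadd : ∀ {U : S.Opens} (m m' : M.obj (op U)) (x : sheaf.1.obj (op U)),
    vadd (m + m') x = vadd m (vadd m' x)
  map_vadd : ∀ {U V : S.Opens} (h : V ≤ U) (m : M.obj (op U)) (x : sheaf.1.obj (op U)),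
    sheaf.1.map (homOfLE h).op (vadd m x) =
      vadd (M.map (homOfLE h).op m) (sheaf.1.map (homOfLE h).op x)
  existsUnique_vadd : ∀ {U : S.Opens} (x y : sheaf.1.obj (op U)), ∃! m : M.obj (op U), vadd m x = y
  exists_local : ∀ s : S, ∃ U : S.Opens, s ∈ U ∧ Nonempty (sheaf.1.obj (op U))

/-- A morphism `P → P'` from an `M`-torsor to an `M'`-torsor over a homomorphism `φ : M → M'`. If
`φ` is the identity of `M`, this is the same as an isomorphism of `M`-torsors; in general, it is the
same as an isomorphism of `M'`-torsors from the change of structure group of `P` along `φ` to `P'`. -/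
structure TorsorHom {M M' : TopCat.Presheaf Ab.{u} S} (φ : M ⟶ M') (P : Torsor M)
    (P' : Torsor M') where
  hom : P.sheaf.1 ⟶ P'.sheaf.1
  map_vadd : ∀ {U : S.Opens} (m : M.obj (op U)) (x : P.sheaf.1.obj (op U)),
    hom.app (op U) (P.vadd m x) = P'.vadd (φ.app (op U) m) (hom.app (op U) x)

variable {G : Type v} [Group G] [TopologicalSpace G] {A : GSchemeAction G S}

/-- The translate `g · P` of an `M`-torsor `P`, where `G` acts on `M`: its sections over `U` are
those of `P` over `g⁻¹U`, on which `m ∈ M(U)` acts as `g⁻¹ m ∈ M(g⁻¹U)`. -/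
def Torsor.translate {M : TopCat.Presheaf Ab.{u} S} (σ : A.GStructure M) (g : G) (P : Torsor M) :
    Torsor M where
  sheaf := (TopCat.Sheaf.pushforward (Type u) (A.invHom g⁻¹).base).obj P.sheaf
  vadd {U} m x := P.vadd (σ.act g⁻¹ (le_refl (A.image g⁻¹ U)) m) x
  zero_vadd {U} x := by
    rw [map_zero]
    exact P.zero_vadd _
  add_vadd {U} m m' x := by
    rw [map_add]
    exact P.add_vadd _ _ _
  map_vadd {U V} h m x := by
    have := P.map_vadd (A.image_mono g⁻¹ h) (σ.act g⁻¹ (le_refl (A.image g⁻¹ U)) m) x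
    rw [σ.res_act] at this
    rw [σ.act_res g⁻¹ _ h (A.image_mono g⁻¹ h)]
    exact this
  existsUnique_vadd {U} x y := by
    have hb := σ.act_bijective g⁻¹ (le_refl (A.image g⁻¹ U))
      (by rw [inv_inv]; exact A.le_image_image_inv g U)
    obtain ⟨m, hm, hm'⟩ := P.existsUnique_vadd (U := A.image g⁻¹ U) x y
    obtain ⟨n, rfl⟩ := hb.2 m
    exact ⟨n, hm, fun n' hn' => hb.1 (hm' _ hn')⟩
  exists_local s := by
    obtain ⟨U, hU, hP⟩ := P.exists_local (A.invHom g s)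
    refine ⟨A.image g U, hU, ?_⟩
    obtain ⟨x⟩ := hP
    have h : A.image g⁻¹ (A.image g U) ≤ U := by
      rw [← A.image_mul, inv_mul_cancel, A.image_one]
    exact ⟨P.sheaf.1.map (homOfLE h).op x⟩

/-- A `G`-structure on an `M`-torsor `P`, where `G` acts on `M`, that is, the structure of
a `(G, M)`-torsor on `P`: a (naive) semilinear action of `G` on `P`. It is given by compatible maps
`g : P(U) → P(gU)`, written here followed by the restriction to an open subset `V ⊆ gU`. -/
structure Torsor.GStructure {M : TopCat.Presheaf Ab.{u} S} (σ : A.GStructure M)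
    (P : Torsor M) where
  act : ∀ (g : G) {U V : S.Opens}, V ≤ A.image g U → P.sheaf.1.obj (op U) → P.sheaf.1.obj (op V)
  act_one : ∀ {U V : S.Opens} (h : V ≤ A.image 1 U) (h' : V ≤ U) (x : P.sheaf.1.obj (op U)),
    act 1 h x = P.sheaf.1.map (homOfLE h').op x
  act_mul : ∀ (g g' : G) {U V W : S.Opens} (h : W ≤ A.image g V) (h' : V ≤ A.image g' U)
    (h'' : W ≤ A.image (g * g') U) (x : P.sheaf.1.obj (op U)),
    act g h (act g' h' x) = act (g * g') h'' x
  act_vadd : ∀ (g : G) {U V : S.Opens} (h : V ≤ A.image g U) (m : M.obj (op U))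
    (x : P.sheaf.1.obj (op U)), act g h (P.vadd m x) = P.vadd (σ.act g h m) (act g h x)
  exists_open : ∃ N : Subgroup G, IsOpen (N : Set G) ∧ N ≤ A.toAut.ker ∧
    ∀ g ∈ N, ∀ {U V : S.Opens} (h : V ≤ A.image g U) (h' : V ≤ U) (x : P.sheaf.1.obj (op U)),
      act g h x = P.sheaf.1.map (homOfLE h').op x
  exists_local_invariant : ∀ s : S, ∃ U : S.Opens, s ∈ U ∧ (∀ g, A.image g U = U) ∧
    Nonempty (P.sheaf.1.obj (op U))

/-- A `W(L)(1)`-torsor (without action of `G`, so that the twist does not matter): a compatible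
system of `W_r(L)`-torsors `P_r` and of isomorphisms from the reduction of `P_{r+1}` to `P_r`, for
`r ≥ 1`. For convenience the system is indexed by all `r : ℕ`; as `W_0(L) = 0`, the component of index
`0` is the trivial torsor and carries no information. -/
structure WittTorsor (L : S.Modules) where
  level : ∀ r : ℕ, Torsor (wittLine p L r)
  trans : ∀ r : ℕ, TorsorHom (wittLineReduction p L r) (level (r + 1)) (level r)

namespace WittTorsor

variable {p} {L : S.Modules} (P : WittTorsor p L)

/-- Given actions of `G` on the sheaves `W_r(L)`, the class of the `W(L)`-torsor `P` is `G`-invariant: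
for every `g`, there is an isomorphism `g · P → P` of `W(L)`-torsors, that is, a compatible system of
isomorphisms `g · P_r → P_r`. -/
def IsGInvariant (σ : ∀ r, A.GStructure (wittLine p L r)) : Prop :=
  ∀ g : G, ∃ f : ∀ r, TorsorHom (𝟙 (wittLine p L r)) ((P.level r).translate (σ r) g) (P.level r),
    ∀ (r : ℕ) (U : S.Opens) (x : (P.level (r + 1)).sheaf.1.obj (op (A.image g⁻¹ U))),
      (f r).hom.app (op U) ((P.trans r).hom.app (op (A.image g⁻¹ U)) x) =
        (P.trans r).hom.app (op U) ((f (r + 1)).hom.app (op U) x)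

/-- The structure of a `(G, W(L))`-torsor on a `W(L)`-torsor `P`, with respect to given actions of `G`
on the sheaves `W_r(L)`: compatible `G`-structures on all `P_r`. -/
structure GStructure (σ : ∀ r, A.GStructure (wittLine p L r)) where
  level : ∀ r, (P.level r).GStructure (σ r)
  trans_act : ∀ (r : ℕ) (g : G) {U V : S.Opens} (h : V ≤ A.image g U)
    (x : (P.level (r + 1)).sheaf.1.obj (op U)),
    (P.trans r).hom.app (op V) ((level (r + 1)).act g h x) =
      (level r).act g h ((P.trans r).hom.app (op U) x)

end WittTorsor

end Torsors

end SmoothProfinite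

end

open SmoothProfinite

/-! Write `M` for the group of global sections of `W(L)(1)`. Since the class of the torsor is
invariant, every `g ∈ G` lifts to a `g`-semilinear automorphism of the whole system, and two lifts
of the same `g` differ by a translation by an element of `M`. These automorphisms form an extension
of `G` by `M`; an action of `G` on the torsor is a splitting of it, naive at each level. The problem
is to find such a splitting that induces the given action at level `r`.

The main input is `exists_lim_lift`: every naive `1`-cocycle with values in the global sections of
`W_k(L)(1)` lifts to a cocycle with values in `M`, naive at each level. As `S` is perfect, `M` has
no `p`-torsion and the kernel of `M → W_k(L)` is `p ^ k M`, which reduces the claim to `k = 1`. Let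
`V` be the group of global sections of `L`. A cocycle in `V(1)` is lifted successively to the
permutation modules `𝔽_p[V](1)` and `ℤ_p[V](1)`, then pushed to `M` by Teichmüller representatives.
The lift from `𝔽_p` to `ℤ_p` is Shapiro's lemma together with the cyclotomic hypothesis for
stabilizers (`exists_perm_lift`).

For the lift to `𝔽_p[V]`, corestriction from a Sylow subgroup reduces to a finite `p`-group `Γ`.
Then `V` is embedded as the part of degree one in a ring `A` of sections of powers of `L`. For any
`𝔽_p`-algebra `A` with an action of `Γ`, each cocycle `x` becomes liftable to `𝔽_p[A]` after a power
of Frobenius (`FrobLiftable.of_isPGroup`), and perfectness lets one take roots afterwards. The proof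
is by induction on the order of `Γ`: by the projection formula, a trace from a proper subgroup times
a cocycle is a corestriction up to a coboundary; modulo all these traces, `|Γ|`-th powers are
invariant, and a cocycle with invariant values is a homomorphism into a vector space, which lifts
linearly.

The extension is split in two cases (`LimHom.exists_isSplitting`). If some `n` acts trivially on `S`
and `L` but `χ n ≠ 1`, then `n` acts on `M` by a scalar different from `1`, and each `g` has exactly
one lift commuting with a well chosen lift of `n`; uniqueness makes these lifts multiplicative.
Otherwise `χ` is trivial on an open subgroup, the factor set lives on a finite quotient and is
killed by its order; the lifting of cocycles shows that it is a coboundary (`exists_defect_eq`).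

A splitting and the given action at level `r` differ by a cocycle in `W_r(L)(1)`; it is lifted to
`M` and added to the splitting. Finally, torsors under `W_s(L)` are trivial over affine opens, since
the successive kernels are powers of `L`; this gives sections over the invariant affine opens of the
cover. -/

namespace SmoothProfinite

noncomputable section

/-! ## Cocycles for abstract groups -/

section Cocycle

variable {Γ : Type*} [Group Γ] {M : Type*} [AddCommGroup M]

/-- `1`-cocycles of the group `Γ` acting on `M` through `ρ`. -/
def IsCocycle (ρ : Γ →* AddMonoid.End M) (z : Γ → M) : Prop :=
  ∀ g h, z (g * h) = z g + ρ g (z h)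

namespace IsCocycle

variable {ρ : Γ →* AddMonoid.End M} {z z' : Γ → M}

theorem add (hz : IsCocycle ρ z) (hz' : IsCocycle ρ z') : IsCocycle ρ (z + z') := fun g h => by
  simp only [Pi.add_apply, hz g h, hz' g h, map_add]
  abel

theorem neg (hz : IsCocycle ρ z) : IsCocycle ρ (-z) := fun g h => by
  simp only [Pi.neg_apply, hz g h, map_neg]
  abel

theorem sub (hz : IsCocycle ρ z) (hz' : IsCocycle ρ z') : IsCocycle ρ (z - z') := by
  rw [sub_eq_add_neg]
  exact hz.add hz'.neg

theorem nsmul (hz : IsCocycle ρ z) (n : ℕ) : IsCocycle ρ (n • z) := fun g h => by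
  simp only [Pi.smul_apply, hz g h, map_nsmul, nsmul_add]

theorem coboundary (ρ : Γ →* AddMonoid.End M) (w : M) : IsCocycle ρ fun g => ρ g w - w :=
  fun g h => by
    simp only [map_mul, AddMonoid.End.coe_mul, Function.comp_apply, map_sub]
    abel

theorem comp {M' : Type*} [AddCommGroup M'] {ρ' : Γ →* AddMonoid.End M'} (hz : IsCocycle ρ z)
    (f : M →+ M') (hf : ∀ g m, f (ρ g m) = ρ' g (f m)) : IsCocycle ρ' fun g => f (z g) :=
  fun g h => by simp only [hz g h, map_add, hf]

theorem comp_hom {Δ : Type*} [Group Δ] (hz : IsCocycle ρ z) (i : Δ →* Γ) :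
    IsCocycle (ρ.comp i) fun g => z (i g) :=
  fun g h => (congrArg z (map_mul i g h)).trans (hz _ _)

end IsCocycle

/-- The element `h` of `H` such that `g t = t' h`, where `t`, `t'` are the chosen representatives
of the cosets `g⁻¹ y`, `y`. -/
def cosetCocycle (H : Subgroup Γ) (g : Γ) (y : Γ ⧸ H) : H :=
  ⟨y.out⁻¹ * (g * (g⁻¹ • y).out), by
    rw [← QuotientGroup.eq, QuotientGroup.out_eq']
    have : ((g * (g⁻¹ • y).out : Γ) : Γ ⧸ H) = g • (((g⁻¹ • y).out : Γ) : Γ ⧸ H) := rfl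
    rw [this, QuotientGroup.out_eq', smul_inv_smul]⟩

theorem out_mul_cosetCocycle (H : Subgroup Γ) (g : Γ) (y : Γ ⧸ H) :
    y.out * (cosetCocycle H g y : Γ) = g * (g⁻¹ • y).out := by
  simp [cosetCocycle]

/-- This is the rule that makes the summands of a corestriction obey a cocycle identity twisted by
the permutation of the cosets. -/
theorem cosetCocycle_mul (H : Subgroup Γ) (g g' : Γ) (y : Γ ⧸ H) :
    cosetCocycle H (g * g') y = cosetCocycle H g y * cosetCocycle H g' (g⁻¹ • y) := by
  refine Subtype.ext ?_
  simp only [cosetCocycle, Subgroup.coe_mul, mul_inv_rev, mul_smul]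
  group

/-- Corestriction of cocycles from a subgroup of finite index. -/
def cores (ρ : Γ →* AddMonoid.End M) (H : Subgroup Γ) [Fintype (Γ ⧸ H)] (z : H → M)
    (g : Γ) : M :=
  ∑ y : Γ ⧸ H, ρ y.out (z (cosetCocycle H g y))

/-- By `cosetCocycle_mul` the summand at `y` splits as for a cocycle, with the second part taken at
`g⁻¹ • y`; reindexing the sum over the cosets absorbs the shift. -/
theorem IsCocycle.cores {ρ : Γ →* AddMonoid.End M} {H : Subgroup Γ} [Fintype (Γ ⧸ H)]
    {z : H → M}   (hz : IsCocycle (ρ.comp H.subtype) z) : IsCocycle ρ (cores ρ H z) := fun g h => by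
  simp only [SmoothProfinite.cores]
  rw [map_sum, ← Equiv.sum_comp (MulAction.toPerm g⁻¹ : Equiv.Perm (Γ ⧸ H))
    (fun y => ρ g (ρ y.out (z (cosetCocycle H h y)))), ← Finset.sum_add_distrib]
  refine Finset.sum_congr rfl fun y _ => ?_
  rw [cosetCocycle_mul, hz, map_add]
  congr 1
  simp only [MonoidHom.comp_apply, Subgroup.coe_subtype, MulAction.toPerm_apply]
  rw [← Function.comp_apply (f := ρ y.out), ← AddMonoid.End.coe_mul, ← map_mul,
    out_mul_cosetCocycle, map_mul]
  rfl

/-- Let `a y`, for `y ∈ Γ / H`, be endomorphisms of `M` permuted by `Γ`. Then multiplication by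
their sum is, up to coboundaries, the corestriction of the multiplication by `a 1` on `H`. -/
theorem exists_sum_eq_cores_add {ρ : Γ →* AddMonoid.End M} {H : Subgroup Γ} [Fintype (Γ ⧸ H)]
    {x : Γ → M} (hx : IsCocycle ρ x) (a : Γ ⧸ H → AddMonoid.End M)
    (ha : ∀ g y m, ρ g (a y m) = a (g • y) (ρ g m)) :
    ∃ w, ∀ g, ∑ y, a y (x g) =
      cores ρ H (fun h => a ((1 : Γ) : Γ ⧸ H) (x h)) g + (ρ g w - w) := by
  -- With `t`, `t'` the representatives of `y`, `g⁻¹ • y` and `t h = g t'`, expanding `x` on both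
  -- sides gives `t (x h) = x g + g (x t') - x t`. The terms in `x t` and `x t'` add up to the
  -- coboundary of this witness.
  refine ⟨-∑ y, a y (x y.out), fun g => ?_⟩
  simp only [cores]
  have e : ∀ y : Γ ⧸ H, ρ y.out (a ((1 : Γ) : Γ ⧸ H) (x (cosetCocycle H g y))) =
      a y (x g) + a y (ρ g (x (g⁻¹ • y).out)) - a y (x y.out) := fun y => by
    rw [ha]
    have : y.out • ((1 : Γ) : Γ ⧸ H) = y := by
      change ((y.out * 1 : Γ) : Γ ⧸ H) = y
      rw [mul_one, QuotientGroup.out_eq']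
    rw [this, ← map_add, ← map_sub, ← hx, ← out_mul_cosetCocycle, hx]
    simp
  have e' : ∑ y : Γ ⧸ H, a y (ρ g (x (g⁻¹ • y).out)) = ρ g (∑ y, a y (x y.out)) := by
    rw [map_sum, ← Equiv.sum_comp (MulAction.toPerm g⁻¹ : Equiv.Perm (Γ ⧸ H))
      (fun y => ρ g (a y (x y.out)))]
    refine Finset.sum_congr rfl fun y _ => ?_
    simp only [MulAction.toPerm_apply, ha, smul_inv_smul]
  rw [Finset.sum_congr rfl fun y _ => e y, Finset.sum_sub_distrib, Finset.sum_add_distrib,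
    map_neg, e']
  abel

end Cocycle

end

end SmoothProfinite

namespace SmoothProfinite

noncomputable section

/-! ## Lifting cocycles to permutation modules, up to Frobenius -/

section PermRep

variable {Γ : Type*} [Group Γ] {M : Type*} [AddCommGroup M]

/-- The permutation module on the underlying set of the `Γ`-module `M`. -/
def permRep (R : Type*) [Ring R] (ρ : Γ →* AddMonoid.End M) : Γ →* AddMonoid.End (M →₀ R) where
  toFun g := Finsupp.mapDomain.addMonoidHom (ρ g)
  map_one' := by
    refine AddMonoidHom.ext fun (c : M →₀ R) => ?_
    rw [map_one]
    exact Finsupp.mapDomain_id (v := c)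
  map_mul' g h := by
    refine AddMonoidHom.ext fun (c : M →₀ R) => ?_
    rw [map_mul]
    exact Finsupp.mapDomain_comp (f := ρ h) (g := ρ g) (v := c)

theorem permRep_apply (R : Type*) [Ring R] (ρ : Γ →* AddMonoid.End M) (g : Γ) (c : M →₀ R) :
    permRep R ρ g c = Finsupp.mapDomain (ρ g) c := rfl

variable (p : ℕ) [Module (ZMod p) M]

/-- The canonical map `𝔽_p[M] → M`. -/
def permSum : (M →₀ ZMod p) →+ M := (Finsupp.linearCombination (ZMod p) id).toAddMonoidHom

theorem permSum_single (m : M) (a : ZMod p) : permSum p (Finsupp.single m a) = a • m :=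
  Finsupp.linearCombination_single _ _ _

theorem permSum_mapDomain {M' : Type*} [AddCommGroup M'] [Module (ZMod p) M'] (f : M →+ M')
    (c : M →₀ ZMod p) : permSum p (Finsupp.mapDomain f c) = f (permSum p c) := by
  induction c using Finsupp.induction_linear with
  | zero => simp
  | add c d hc hd => rw [Finsupp.mapDomain_add, map_add, map_add, map_add, hc, hd]
  | single m a => rw [Finsupp.mapDomain_single, permSum_single, permSum_single, ZMod.map_smul]

theorem permSum_permRep (ρ : Γ →* AddMonoid.End M) (g : Γ) (c : M →₀ ZMod p) :
    permSum p (permRep (ZMod p) ρ g c) = ρ g (permSum p c) :=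
  permSum_mapDomain p (ρ g : M →+ M) c

theorem isCocycle_permSum {ρ : Γ →* AddMonoid.End M} {c : Γ → M →₀ ZMod p}
    (hc : IsCocycle (permRep (ZMod p) ρ) c) : IsCocycle ρ fun g => permSum p (c g) :=
  hc.comp (permSum p) (permSum_permRep p ρ)

end PermRep

section Frobenius

variable (p : ℕ) [Fact p.Prime] {A : Type*} [CommRing A] [Algebra (ZMod p) A]

/-- The `k`-th power of the Frobenius of an `𝔽_p`-algebra. -/
def frobPow (A : Type*) [CommRing A] [Algebra (ZMod p) A] (k : ℕ) : A →+* A where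
  toFun a := a ^ p ^ k
  map_one' := one_pow _
  map_mul' a b := mul_pow a b _
  map_zero' := zero_pow (pow_ne_zero _ (Fact.out : p.Prime).ne_zero)
  map_add' a b := by
    cases subsingleton_or_nontrivial A with
    | inl h => exact Subsingleton.elim _ _
    | inr h =>
      have : CharP A p := charP_of_injective_algebraMap (algebraMap (ZMod p) A).injective p
      exact add_pow_char_pow a b p k

theorem frobPow_apply (k : ℕ) (a : A) : frobPow p A k a = a ^ p ^ k := rfl

end Frobenius

section FrobLift

variable {Γ : Type*} [Group Γ]

/-- The additive action underlying an action on a ring. -/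
def ringEnd {A : Type*} [CommRing A] (ρ : Γ →* (A →+* A)) : Γ →* AddMonoid.End A where
  toFun g := (ρ g).toAddMonoidHom
  map_one' := by rw [map_one]; rfl
  map_mul' g h := by rw [map_mul]; rfl

@[simp]
theorem ringEnd_apply {A : Type*} [CommRing A] (ρ : Γ →* (A →+* A)) (g : Γ) (a : A) :
    ringEnd ρ g a = ρ g a := rfl

variable (p : ℕ) [Fact p.Prime] {A : Type*} [CommRing A] [Algebra (ZMod p) A]
  {A' : Type*} [CommRing A'] [Algebra (ZMod p) A']

/-- Up to Frobenius, the function `x : Γ → A` lifts to a cocycle with values in `𝔽_p[A]`. -/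
def FrobLiftable (ρ : Γ →* (A →+* A)) (x : Γ → A) : Prop :=
  ∃ (k : ℕ) (c : Γ → A →₀ ZMod p), IsCocycle (permRep (ZMod p) (ringEnd ρ)) c ∧
    ∀ g, permSum p (c g) = x g ^ p ^ k

set_option linter.unusedSectionVars false

variable {p} {ρ : Γ →* (A →+* A)} {x y : Γ → A}

theorem IsCocycle.frobPow (hx : IsCocycle (ringEnd ρ) x) (k : ℕ) :
    IsCocycle (ringEnd ρ) fun g => x g ^ p ^ k :=
  hx.comp (SmoothProfinite.frobPow p A k).toAddMonoidHom fun g a => (map_pow (ρ g) a (p ^ k)).symm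

theorem permRep_mapDomain_comm {ρ : Γ →* AddMonoid.End A} {ρ' : Γ →* AddMonoid.End A'} (f : A → A')
    (hf : ∀ g a, f (ρ g a) = ρ' g (f a)) (g : Γ) (c : A →₀ ZMod p) :
    Finsupp.mapDomain f (permRep (ZMod p) ρ g c) =
      permRep (ZMod p) ρ' g (Finsupp.mapDomain f c) := by
  rw [permRep_apply, permRep_apply, ← Finsupp.mapDomain_comp, ← Finsupp.mapDomain_comp]
  congr 1
  exact funext (hf g)

/-- Only a map of sets is needed: a permutation module is functorial for arbitrary equivariant maps.
This is the advantage of `𝔽_p[A]` over `A`, and it is used for power maps and for multiplicative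
sections of quotients. -/
theorem IsCocycle.mapDomain {ρ : Γ →* AddMonoid.End A} {ρ' : Γ →* AddMonoid.End A'} (f : A → A')
    (hf : ∀ g a, f (ρ g a) = ρ' g (f a)) {c : Γ → A →₀ ZMod p}
    (hc : IsCocycle (permRep (ZMod p) ρ) c) :
    IsCocycle (permRep (ZMod p) ρ') fun g => Finsupp.mapDomain f (c g) :=
  hc.comp (Finsupp.mapDomain.addMonoidHom f) (permRep_mapDomain_comm f hf)

theorem permSum_mapDomain_pow (k : ℕ) (c : A →₀ ZMod p) :
    permSum p (Finsupp.mapDomain (fun a : A => a ^ p ^ k) c) = permSum p c ^ p ^ k :=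
  permSum_mapDomain p (frobPow p A k).toAddMonoidHom c

namespace FrobLiftable

/-- The Frobenius is equivariant, so a lift for one exponent gives one for every larger exponent;
two functions can thus be treated with a common exponent. -/
theorem exists_le (hx : FrobLiftable p ρ x) : ∃ k, ∀ l, k ≤ l → ∃ c : Γ → A →₀ ZMod p,
    IsCocycle (permRep (ZMod p) (ringEnd ρ)) c ∧ ∀ g, permSum p (c g) = x g ^ p ^ l := by
  obtain ⟨k, c, hc, hcx⟩ := hx
  refine ⟨k, fun l hl => ⟨_, hc.mapDomain (fun a : A => a ^ p ^ (l - k))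
    fun g a => (map_pow (ρ g) a _).symm, fun g => ?_⟩⟩
  rw [permSum_mapDomain_pow, hcx, ← pow_mul, ← pow_add, Nat.add_sub_cancel' hl]

theorem add (hx : FrobLiftable p ρ x) (hy : FrobLiftable p ρ y) :
    FrobLiftable p ρ fun g => x g + y g := by
  obtain ⟨k, hk⟩ := hx.exists_le
  obtain ⟨l, hl⟩ := hy.exists_le
  obtain ⟨c, hc, hc'⟩ := hk (max k l) (le_max_left _ _)
  obtain ⟨d, hd, hd'⟩ := hl (max k l) (le_max_right _ _)
  refine ⟨max k l, c + d, hc.add hd, fun g => ?_⟩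
  rw [Pi.add_apply, map_add, hc', hd']
  exact (map_add (frobPow p A (max k l)) (x g) (y g)).symm

theorem of_pow (k : ℕ) (hx : FrobLiftable p ρ fun g => x g ^ p ^ k) : FrobLiftable p ρ x := by
  obtain ⟨l, c, hc, hcx⟩ := hx
  exact ⟨k + l, c, hc, fun g => by rw [hcx, ← pow_mul, ← pow_add]⟩

theorem permSum {c : Γ → A →₀ ZMod p} (hc : IsCocycle (permRep (ZMod p) (ringEnd ρ)) c) :
    FrobLiftable p ρ fun g => permSum p (c g) :=
  ⟨0, c, hc, fun g => by rw [pow_zero, pow_one]⟩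

theorem zero : FrobLiftable p ρ fun _ => 0 :=
  ⟨0, 0, fun _ _ => by simp, fun _ => by simp⟩

/-- The trace of an `H`-invariant element. -/
def traceElt (ρ : Γ →* (A →+* A)) (H : Subgroup Γ) [Fintype (Γ ⧸ H)] (a : A) : A :=
  ∑ y : Γ ⧸ H, ρ y.out a

theorem out_apply_eq {H : Subgroup Γ} {a : A} (ha : ∀ h ∈ H, ρ h a = a) (g : Γ) :
    ρ (g : Γ ⧸ H).out a = ρ g a := by
  obtain ⟨h, hh⟩ := QuotientGroup.mk_out_eq_mul H g
  rw [hh, map_mul]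
  exact congrArg (ρ g) (ha _ h.2)

theorem out_smul_apply_eq {H : Subgroup Γ} {a : A} (ha : ∀ h ∈ H, ρ h a = a) (g : Γ)
    (y : Γ ⧸ H) : ρ g (ρ y.out a) = ρ (g • y).out a := by
  have : g • y = ((g * y.out : Γ) : Γ ⧸ H) := by
    conv_lhs => rw [← QuotientGroup.out_eq' y]
    rfl
  rw [this, out_apply_eq ha, map_mul]
  rfl

theorem apply_traceElt {H : Subgroup Γ} [Fintype (Γ ⧸ H)] {a : A} (ha : ∀ h ∈ H, ρ h a = a)
    (g : Γ) : ρ g (traceElt ρ H a) = traceElt ρ H a := by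
  rw [traceElt, map_sum]
  exact (Finset.sum_congr rfl fun y _ => out_smul_apply_eq ha g y).trans
    (Equiv.sum_comp (MulAction.toPerm g : Equiv.Perm (Γ ⧸ H)) fun y => ρ y.out a)

theorem coboundary (w : A) : FrobLiftable p ρ fun g => ρ g w - w := by
  refine ⟨0, _, IsCocycle.coboundary (permRep (ZMod p) (ringEnd ρ)) (Finsupp.single w 1),
    fun g => ?_⟩
  rw [map_sub, permRep_apply, Finsupp.mapDomain_single, permSum_single, permSum_single]
  simp

/-- Projection formula: `tr(a) x` is, up to a coboundary, the corestriction of `a` times the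
restriction of `x` to `H`. Multiplication by `a` commutes with `H`, hence acts on the basis of the
permutation module, and corestriction is available there too. -/
theorem traceElt_mul (hx : IsCocycle (ringEnd ρ) x) (H : Subgroup Γ) [Fintype (Γ ⧸ H)]
    {a : A} (ha : ∀ h ∈ H, ρ h a = a)
    (hH : FrobLiftable p (ρ.comp H.subtype) fun h : H => x h) :
    FrobLiftable p ρ fun g => traceElt ρ H a * x g := by
  obtain ⟨k, c, hc, hcx⟩ := hH
  refine of_pow k ?_
  -- Only the `p ^ k`-th power of `x` lifts on `H`; Frobenius turns `tr(a) x` into `tr(b) x ^ p ^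
  -- k`.
  set b : A := a ^ p ^ k with hb
  have hb' : ∀ h ∈ H, ρ h b = b := fun h hh => by rw [hb, map_pow, ha h hh]
  obtain ⟨w, hw⟩ := exists_sum_eq_cores_add (hx.frobPow (p := p) k)
    (fun y : Γ ⧸ H => AddMonoidHom.mulLeft (ρ y.out b)) fun g y m => by
      change ρ g (ρ y.out b * m) = ρ (g • y).out b * ρ g m
      rw [map_mul, out_smul_apply_eq hb']
  replace hw : ∀ g, ∑ y : Γ ⧸ H, ρ y.out b * x g ^ p ^ k = cores (ringEnd ρ) H
    (fun h => ρ ((1 : Γ) : Γ ⧸ H).out b * x h ^ p ^ k) g + (ρ g w - w) := hw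
  have hc' : IsCocycle ((permRep (ZMod p) (ringEnd ρ)).comp H.subtype)
      fun h => Finsupp.mapDomain (fun m => b * m) (c h) :=
    hc.mapDomain (ρ' := (ringEnd ρ).comp H.subtype) (fun m => b * m) fun g m => by
      change b * ρ g m = ρ g (b * m)
      rw [map_mul, hb' g g.2]
  have key : (fun g => (traceElt ρ H a * x g) ^ p ^ k) = fun g =>
      SmoothProfinite.permSum p (cores (permRep (ZMod p) (ringEnd ρ)) H
        (fun h => Finsupp.mapDomain (fun m => b * m) (c h)) g) + (ρ g w - w) := by
    funext g
    have h1 : (traceElt ρ H a * x g) ^ p ^ k =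
        ∑ y : Γ ⧸ H, ρ y.out b * x g ^ p ^ k := by
      rw [mul_pow, traceElt, ← frobPow_apply, map_sum, Finset.sum_mul]
      refine Finset.sum_congr rfl fun y _ => ?_
      rw [frobPow_apply, hb, map_pow]
    rw [h1, hw g]
    congr 1
    simp only [cores]
    rw [map_sum]
    refine Finset.sum_congr rfl fun y _ => ?_
    rw [permSum_permRep]
    congr 1
    rw [out_apply_eq hb', map_one]
    refine Eq.trans ?_ (permSum_mapDomain p (AddMonoidHom.mulLeft b) _).symm
    rw [hcx]
    rfl
  rw [key]
  exact (permSum hc'.cores).add (coboundary w)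

/-! ### Lifting along equivariant quotients of algebras -/

section Quotient

variable {ρ' : Γ →* (A' →+* A')} (π : A →+* A') (hπ : Function.Surjective π)
  (hρ : ∀ g a, π (ρ g a) = ρ' g (π a))

-- The norm of an arbitrary section `s`, with factors `g s(g⁻¹ b)`, is equivariant, and each of its
-- factors maps to `b`. For a `p`-group the resulting power is a power of Frobenius.
include hπ hρ in
theorem exists_equivariant_section [Finite Γ] : ∃ s : A' → A,
    (∀ g b, s (ρ' g b) = ρ g (s b)) ∧ ∀ b, π (s b) = b ^ Nat.card Γ := by
  have := Fintype.ofFinite Γ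
  choose s hs using hπ
  refine ⟨fun b => ∏ g : Γ, ρ g (s (ρ' g⁻¹ b)), fun g b => ?_, fun b => ?_⟩
  · beta_reduce
    rw [map_prod, ← Equiv.prod_comp (Equiv.mulLeft g) fun h => ρ h (s (ρ' h⁻¹ (ρ' g b)))]
    refine Finset.prod_congr rfl fun h _ => ?_
    rw [Equiv.coe_mulLeft, map_mul, mul_inv_rev, map_mul, RingHom.coe_mul, Function.comp_apply,
      RingHom.coe_mul, Function.comp_apply]
    rw [← Function.comp_apply (f := ρ' g⁻¹), ← RingHom.coe_mul, ← map_mul, inv_mul_cancel, map_one]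
    rfl
  · rw [map_prod]
    have : ∀ g : Γ, π (ρ g (s (ρ' g⁻¹ b))) = b := fun g => by
      rw [hρ, hs, ← Function.comp_apply (f := ρ' g), ← RingHom.coe_mul, ← map_mul, mul_inv_cancel,
        map_one]
      rfl
    rw [Finset.prod_congr rfl fun g _ => this g, Finset.prod_const, Finset.card_univ,
      Nat.card_eq_fintype_card]

-- The lift over the quotient is transported basis element by basis element along the equivariant
-- section; this costs an additional exponent `m`, where `|Γ| = p ^ m`.
include hπ hρ in
theorem exists_of_quotient [Finite Γ] (hΓ : IsPGroup p Γ)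
    (hx : FrobLiftable p ρ' fun g => π (x g)) :
    ∃ (k : ℕ) (c : Γ → A →₀ ZMod p), IsCocycle (permRep (ZMod p) (ringEnd ρ)) c ∧
      ∀ g, π (SmoothProfinite.permSum p (c g)) = π (x g ^ p ^ k) := by
  obtain ⟨k, c, hc, hcx⟩ := hx
  obtain ⟨m, hm⟩ := IsPGroup.iff_card.1 hΓ
  obtain ⟨s, hs, hs'⟩ := exists_equivariant_section π hπ hρ
  refine ⟨k + m, _, hc.mapDomain s hs, fun g => ?_⟩
  have := permSum_mapDomain p π.toAddMonoidHom (Finsupp.mapDomain s (c g))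
  refine this.symm.trans ?_
  rw [← Finsupp.mapDomain_comp]
  have e : (π.toAddMonoidHom ∘ s : A' → A') = fun b => b ^ p ^ m :=
    funext fun b => (hs' b).trans (by rw [hm])
  rw [e, permSum_mapDomain_pow, hcx, ← pow_mul, ← pow_add, map_pow]

-- After subtracting a lift, `x ^ p ^ k` becomes `f w`, where `w` is a cocycle only up to elements
-- killed by `f`. One more Frobenius gives `f (f ^ (p - 1) w ^ p)`, and the factor `f ^ (p - 1)`
-- kills the defect of `w ^ p`. So this is `f` times a genuine cocycle, to which the hypothesis
-- applies.
include hπ hρ in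
theorem of_quotient [Finite Γ] (hΓ : IsPGroup p Γ) (hx : IsCocycle (ringEnd ρ) x) (f : A)
    (hf : ∀ g, ρ g f = f)
    (hfx : ∀ u, IsCocycle (ringEnd ρ) u → FrobLiftable p ρ fun g => f * u g)
    (hker : ∀ a, π a = 0 → ∃ w, a = f * w) (hxπ : FrobLiftable p ρ' fun g => π (x g)) :
    FrobLiftable p ρ x := by
  obtain ⟨k, c, hc, hcx⟩ := exists_of_quotient π hπ hρ hΓ hxπ
  have hp : 2 ≤ p := (Fact.out : p.Prime).two_le
  have hy := (hx.frobPow (p := p) k).sub (isCocycle_permSum p hc)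
  choose w hw using fun g => hker (x g ^ p ^ k - SmoothProfinite.permSum p (c g)) (by
    rw [map_sub, hcx, sub_self])
  have hu : IsCocycle (ringEnd ρ) fun g => f ^ (p - 1) * w g ^ p := fun g h => by
    have e := hy g h
    simp only [Pi.sub_apply] at e
    rw [hw, hw, hw, ringEnd_apply, map_mul, hf, ← mul_add] at e
    have e' : f * (w (g * h) - (w g + ρ g (w h))) = 0 := by rw [mul_sub, e, sub_self]
    -- Here `p ≥ 2` matters: at least one factor `f` is left to kill the defect.
    have e'' : f ^ (p - 1) * (w (g * h) - (w g + ρ g (w h))) ^ p = 0 := by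
      obtain ⟨q, rfl⟩ := Nat.exists_eq_add_of_le hp
      rw [show 2 + q - 1 = q + 1 by omega, show 2 + q = (q + 1) + 1 by omega, pow_succ, pow_succ]
      linear_combination f ^ q * (w (g * h) - (w g + ρ g (w h))) ^ (q + 1) * e'
    have := map_sub (SmoothProfinite.frobPow p A 1) (w (g * h)) (w g + ρ g (w h))
    rw [map_add] at this
    simp only [frobPow_apply, pow_one] at this
    rw [this, mul_sub, sub_eq_zero] at e''
    change f ^ (p - 1) * w (g * h) ^ p = f ^ (p - 1) * w g ^ p + ρ g (f ^ (p - 1) * w h ^ p)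
    rw [e'', map_mul, map_pow, map_pow, hf, mul_add]
  refine of_pow (k + 1) ?_
  have key : (fun g => x g ^ p ^ (k + 1)) = fun g => f * (f ^ (p - 1) * w g ^ p) +
      SmoothProfinite.permSum p (Finsupp.mapDomain (fun a : A => a ^ p ^ 1) (c g)) := by
    funext g
    have h1 : f * (f ^ (p - 1) * w g ^ p) = (f * w g) ^ p := by
      rw [mul_pow, ← mul_assoc, ← pow_succ', Nat.sub_add_cancel (by omega)]
    have h2 := map_sub (SmoothProfinite.frobPow p A 1) (x g ^ p ^ k)
      (SmoothProfinite.permSum p (c g))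
    simp only [frobPow_apply, pow_one, hw] at h2
    rw [h1, h2, permSum_mapDomain_pow, pow_one, pow_succ, pow_mul]
    ring
  rw [key]
  exact (hfx _ hu).add (permSum (hc.mapDomain _ fun g a => (map_pow (ρ g) a _).symm))

end Quotient

end FrobLiftable

end FrobLift

end

end SmoothProfinite

namespace SmoothProfinite

noncomputable section

namespace FrobLiftable

/-! ### The ideal of traces from proper subgroups -/

section TraceIdeal

variable {Γ : Type*} [Group Γ] {A : Type*} [CommRing A]

/-- `f` is the trace of an element which is invariant under a proper subgroup. -/
def IsProperTrace (ρ : Γ →* (A →+* A)) (f : A) : Prop :=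
  ∃ (H : Subgroup Γ) (_ : Fintype (Γ ⧸ H)) (a : A), H ≠ ⊤ ∧ (∀ h ∈ H, ρ h a = a) ∧
    f = traceElt ρ H a

theorem IsProperTrace.apply_eq {ρ : Γ →* (A →+* A)} {f : A} (hf : IsProperTrace ρ f) (g : Γ) :
    ρ g f = f := by
  obtain ⟨H, _, a, -, ha, rfl⟩ := hf
  exact apply_traceElt ha g

theorem IsProperTrace.map {A' : Type*} [CommRing A'] {ρ : Γ →* (A →+* A)} {ρ' : Γ →* (A' →+* A')}
    (π : A →+* A') (hρ : ∀ g a, π (ρ g a) = ρ' g (π a)) {f : A} (hf : IsProperTrace ρ f) :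
    IsProperTrace ρ' (π f) := by
  obtain ⟨H, hH, a, hH', ha, rfl⟩ := hf
  refine ⟨H, hH, π a, hH', fun h hh => by rw [← hρ, ha h hh], ?_⟩
  simp only [traceElt, map_sum, hρ]

/-- The ideal generated by the traces of elements invariant under proper subgroups. -/
def traceIdeal (ρ : Γ →* (A →+* A)) : Ideal A := Ideal.span {f | IsProperTrace ρ f}

variable [Finite Γ] (ρ : Γ →* (A →+* A))

/-- Sum over each orbit separately: an orbit with stabilizer `H` contributes a multiple of a trace
from `H`. This trace is proper unless the orbit is a fixed point, and there the weight `w` vanishes.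
-/
theorem sum_mem_traceIdeal {X : Type*} [Fintype X] [MulAction Γ X] (w φ : X → A)
    (hw : ∀ (g : Γ) x, w (g • x) = w x) (hφ : ∀ (g : Γ) x, φ (g • x) = ρ g (φ x))
    (h0 : ∀ x, (∀ g : Γ, g • x = x) → w x = 0) :
    ∑ x, w x * φ x ∈ traceIdeal ρ := by
  classical
  have := Fintype.ofFinite Γ
  have := Fintype.ofFinite (Quotient (MulAction.orbitRel Γ X))
  have (ω : Quotient (MulAction.orbitRel Γ X)) : Fintype (Γ ⧸ MulAction.stabilizer Γ ω.out) :=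
    Fintype.ofFinite _
  rw [← Equiv.sum_comp (MulAction.selfEquivSigmaOrbitsQuotientStabilizer Γ X).symm,
    Fintype.sum_sigma]
  refine Ideal.sum_mem _ fun ω _ => ?_
  have e : ∀ y : Γ ⧸ MulAction.stabilizer Γ ω.out,
      (MulAction.selfEquivSigmaOrbitsQuotientStabilizer Γ X).symm ⟨ω, y⟩ = y.out • ω.out := by
    intro y
    conv_lhs => rw [← QuotientGroup.out_eq' y]
    rfl
  have e' : ∑ y : Γ ⧸ MulAction.stabilizer Γ ω.out,
      w ((MulAction.selfEquivSigmaOrbitsQuotientStabilizer Γ X).symm ⟨ω, y⟩) *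
        φ ((MulAction.selfEquivSigmaOrbitsQuotientStabilizer Γ X).symm ⟨ω, y⟩) =
      w ω.out * traceElt ρ (MulAction.stabilizer Γ ω.out) (φ ω.out) := by
    rw [traceElt, Finset.mul_sum]
    exact Finset.sum_congr rfl fun y _ => by rw [e, hw, hφ]
  rw [e']
  by_cases hs : MulAction.stabilizer Γ ω.out = ⊤
  · rw [h0 _ fun g => by rw [← MulAction.mem_stabilizer_iff, hs]; trivial, zero_mul]
    exact Ideal.zero_mem _
  · exact Ideal.mul_mem_left _ _ (Ideal.subset_span
      ⟨_, _, _, hs, fun h hh => by rw [← hφ, MulAction.mem_stabilizer_iff.1 hh], rfl⟩)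

-- The product of all `a + g (-a)` is zero because of the factor `g = 1`. Its expansion is indexed
-- by the subsets of `Γ`, on which `Γ` acts by translation with only two fixed points, the empty set
-- and `Γ`. These give the norm of `-a` and the power of `a`; the other terms add up to an element
-- of the ideal.
open scoped Pointwise in
theorem pow_card_add_prod_mem_traceIdeal [Fintype Γ] (a : A) :
    a ^ Nat.card Γ + ∏ g, ρ g (-a) ∈ traceIdeal ρ := by
  classical
  have h0 : ∏ g : Γ, (a + ρ g (-a)) = 0 :=
    Finset.prod_eq_zero (Finset.mem_univ (1 : Γ)) (by rw [map_one]; exact add_neg_cancel a)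
  rw [Finset.prod_add, Finset.powerset_univ] at h0
  -- The weight is set to zero on the two fixed subsets, as `sum_mem_traceIdeal` requires; their
  -- terms are put back by hand in `h2`.
  let w : Finset Γ → A := fun T => if T = ∅ ∨ T = Finset.univ then 0 else a ^ T.card
  let φ : Finset Γ → A := fun T => ∏ g ∈ Finset.univ \ T, ρ g (-a)
  have hc : ∀ (g : Γ) (T : Finset Γ), g • T = ∅ ∨ g • T = Finset.univ ↔ T = ∅ ∨ T = Finset.univ :=
    fun g T => by
      rw [Finset.smul_finset_eq_empty, ← Finset.card_eq_iff_eq_univ, Finset.card_smul_finset,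
        Finset.card_eq_iff_eq_univ]
  have h1 := sum_mem_traceIdeal ρ w φ
    (fun g T => by simp only [w, hc, Finset.card_smul_finset])
    (fun g T => by
      have : Finset.univ \ g • T = g • (Finset.univ \ T) := by
        rw [Finset.smul_finset_sdiff, Finset.smul_finset_univ]
      simp only [φ]
      rw [this, map_prod, ← Finset.image_smul, Finset.prod_image (MulAction.injective g).injOn]
      exact Finset.prod_congr rfl fun x _ => by rw [smul_eq_mul, map_mul]; rfl)
    (fun T hT => by
      refine if_pos ?_
      rcases T.eq_empty_or_nonempty with h | ⟨t, ht⟩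
      · exact Or.inl h
      · refine Or.inr (Finset.eq_univ_iff_forall.2 fun g => ?_)
        rw [← hT (g * t⁻¹)]
        simpa using Finset.smul_mem_smul_finset (a := g * t⁻¹) ht)
  have hne : (∅ : Finset Γ) ≠ Finset.univ := Finset.univ_nonempty.ne_empty.symm
  have h2 : ∑ T : Finset Γ, w T * φ T = -(a ^ Nat.card Γ + ∏ g, ρ g (-a)) := by
    have hs : ∀ F : Finset Γ → A, ∑ T, F T =
        ∑ T ∈ (Finset.univ.erase Finset.univ).erase ∅, F T + F ∅ + F Finset.univ := fun F => by
      rw [Finset.sum_erase_add _ _ (Finset.mem_erase.2 ⟨hne, Finset.mem_univ ∅⟩),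
        Finset.sum_erase_add _ _ (Finset.mem_univ Finset.univ)]
    rw [eq_neg_iff_add_eq_zero, ← h0, hs, hs]
    have : ∀ T ∈ (Finset.univ.erase Finset.univ).erase (∅ : Finset Γ), w T * φ T =
        (∏ i ∈ T, a) * ∏ i ∈ Finset.univ \ T, ρ i (-a) := fun T hT => by
      simp only [Finset.mem_erase] at hT
      simp only [w, φ, if_neg (not_or.2 ⟨hT.1, hT.2.1⟩), Finset.prod_const]
    rw [Finset.sum_congr rfl this]
    simp [w, φ, Nat.card_eq_fintype_card]
    ring
  rw [h2] at h1
  exact neg_mem_iff.1 h1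

/-- The elements `a` and `γ a` have the same norm, so the norms cancel. Hence `|Γ|`-th powers are
invariant modulo the trace ideal. -/
theorem pow_card_sub_apply_mem_traceIdeal (a : A) (γ : Γ) :
    a ^ Nat.card Γ - ρ γ (a ^ Nat.card Γ) ∈ traceIdeal ρ := by
  have := Fintype.ofFinite Γ
  have h := sub_mem (pow_card_add_prod_mem_traceIdeal ρ a)
    (pow_card_add_prod_mem_traceIdeal ρ (ρ γ a))
  have e : ∏ g, ρ g (-ρ γ a) = ∏ g, ρ g (-a) := by
    rw [← Equiv.prod_comp (Equiv.mulRight γ) fun g => ρ g (-a)]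
    refine Finset.prod_congr rfl fun g _ => ?_
    rw [Equiv.coe_mulRight, map_mul, ← map_neg (ρ γ)]
    rfl
  rw [e, add_sub_add_right_eq_sub, ← map_pow] at h
  exact h

end TraceIdeal

/-! ### Cocycles of finite `p`-groups, by induction on the order -/

section Main

/-- The action on the quotient by an invariant ideal. -/
def quotientAction {Γ : Type*} [Group Γ] {A : Type*} [CommRing A] (ρ : Γ →* (A →+* A)) (I : Ideal A)
    (hI : ∀ g, I ≤ I.comap (ρ g)) : Γ →* (A ⧸ I →+* A ⧸ I) where
  toFun g := Ideal.quotientMap I (ρ g) (hI g)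
  map_one' := Ideal.Quotient.ringHom_ext (RingHom.ext fun a => by
    simp only [RingHom.comp_apply, Ideal.quotientMap_mk, map_one]; rfl)
  map_mul' g h := Ideal.Quotient.ringHom_ext (RingHom.ext fun a => by
    simp only [RingHom.comp_apply, RingHom.coe_mul, Function.comp_apply, Ideal.quotientMap_mk,
      map_mul])

theorem le_comap_of_span {Γ : Type*} [Group Γ] {A : Type*} [CommRing A] (ρ : Γ →* (A →+* A))
    (s : Set A) (hs : ∀ f ∈ s, ∀ g, ρ g f = f) (g : Γ) :
    Ideal.span s ≤ (Ideal.span s).comap (ρ g) := by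
  rw [Ideal.span_le]
  intro f hf
  rw [SetLike.mem_coe, Ideal.mem_comap, hs f hf]
  exact Ideal.subset_span hf

variable {p : ℕ} [Fact p.Prime] {Γ : Type v} [Group Γ] [Finite Γ]

/-- Induction on the number of traces: modulo the first trace `f` the values of `x` lie in the ideal
of the remaining ones, and multiples of `f` are handled by `traceElt_mul` and the case of proper
subgroups. The algebra varies in the statement because the induction passes to quotients. -/
theorem of_mem_span (hΓ : IsPGroup p Γ)
    (ih : ∀ H : Subgroup Γ, H ≠ ⊤ → ∀ (A : Type u) [CommRing A] [Algebra (ZMod p) A]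
      (ρ : H →* (A →+* A)) (x : H → A), IsCocycle (ringEnd ρ) x → FrobLiftable p ρ x) :
    ∀ (n : ℕ) (A : Type u) [CommRing A] [Algebra (ZMod p) A] (ρ : Γ →* (A →+* A)) (l : List A)
      (x : Γ → A), l.length = n → (∀ f ∈ l, IsProperTrace ρ f) → IsCocycle (ringEnd ρ) x →
      (∀ g, x g ∈ Ideal.span {f | f ∈ l}) → FrobLiftable p ρ x := by
  intro n
  induction n with
  | zero =>
    intro A _ _ ρ l x hl _ _ hxl
    rw [List.length_eq_zero_iff] at hl
    subst hl
    have : x = fun _ => 0 := funext fun g => by simpa using hxl g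
    rw [this]
    exact zero
  | succ n IH =>
    intro A _ _ ρ l x hl hf hx hxl
    obtain ⟨f, l, rfl⟩ := List.exists_cons_of_length_eq_add_one hl
    rw [List.length_cons, add_left_inj] at hl
    have hf1 := hf f List.mem_cons_self
    let I : Ideal A := Ideal.span {f}
    let ρ' := quotientAction ρ I (le_comap_of_span ρ _ (by
      rintro _ rfl
      exact hf1.apply_eq))
    have hρ : ∀ g a, Ideal.Quotient.mk I (ρ g a) = ρ' g (Ideal.Quotient.mk I a) := fun g a => rfl
    refine of_quotient (ρ' := ρ') (Ideal.Quotient.mk I) Ideal.Quotient.mk_surjective hρ hΓ hx f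
      hf1.apply_eq (fun u hu => ?_) (fun a ha => ?_) ?_
    · obtain ⟨H, _, a, hH, ha, rfl⟩ := hf1
      exact traceElt_mul hu H ha (ih H hH A _ _ (hu.comp_hom H.subtype))
    · rw [Ideal.Quotient.eq_zero_iff_mem, Ideal.mem_span_singleton] at ha
      exact ha
    · refine IH (A ⧸ I) ρ' (l.map (Ideal.Quotient.mk I)) _ (by rw [List.length_map, hl]) ?_
        (hx.comp (Ideal.Quotient.mk I).toAddMonoidHom hρ) fun g => ?_
      · intro f' hf'
        obtain ⟨f', hf'', rfl⟩ := List.mem_map.1 hf'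
        exact (hf f' (List.mem_cons_of_mem _ hf'')).map _ hρ
      · have h := Ideal.mem_map_of_mem (Ideal.Quotient.mk I) (hxl g)
        rw [Ideal.map_span] at h
        refine (Ideal.span_le.2 ?_) h
        rintro _ ⟨f', hf', rfl⟩
        rcases List.mem_cons.1 hf' with rfl | hf'
        · have : Ideal.Quotient.mk I f' = 0 :=
            Ideal.Quotient.eq_zero_iff_mem.2 (Ideal.mem_span_singleton_self f')
          rw [this]
          exact Ideal.zero_mem _
        · exact Ideal.subset_span (List.mem_map_of_mem hf')

/-- A cocycle with invariant values lifts. -/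
theorem of_invariant {A : Type*} [CommRing A] [Algebra (ZMod p) A] {ρ : Γ →* (A →+* A)} {y : Γ → A}
    (hy : IsCocycle (ringEnd ρ) y) (hinv : ∀ g h, ρ g (y h) = y h) : FrobLiftable p ρ y := by
  let V : Submodule (ZMod p) A :=
    { carrier := {a | ∀ g, ρ g a = a}
      zero_mem' := fun g => map_zero _
      add_mem' := fun ha hb g => by rw [map_add, ha g, hb g]
      smul_mem' := fun c a ha g => by rw [ZMod.map_smul, ha g] }
  -- On invariant values a cocycle is a homomorphism, so a linear section of `𝔽_p[V] → V` turns it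
  -- into a homomorphism to `𝔽_p[V]`, whose basis is fixed by `Γ`.
  obtain ⟨ℓ, hℓ⟩ := (Finsupp.linearCombination (ZMod p) (id : V → V)).exists_rightInverse_of_surjective
    (LinearMap.range_eq_top.2 (Finsupp.linearCombination_id_surjective _ _))
  have hℓ' : ∀ v : V, SmoothProfinite.permSum p (ℓ v) = v := fun v => LinearMap.congr_fun hℓ v
  refine ⟨0, fun g => Finsupp.mapDomain Subtype.val (ℓ ⟨y g, fun h => hinv h g⟩), fun g h => ?_,
    fun g => ?_⟩
  · have h1 : (⟨y (g * h), fun h' => hinv h' _⟩ : V) =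
        ⟨y g, fun h => hinv h g⟩ + ⟨y h, fun h' => hinv h' h⟩ :=
      Subtype.ext ((hy g h).trans (congrArg (y g + ·) (hinv g h)))
    beta_reduce
    rw [h1, map_add, Finsupp.mapDomain_add, permRep_apply, ← Finsupp.mapDomain_comp]
    congr 2
    exact funext fun v => (v.2 g).symm
  · rw [pow_zero, pow_one]
    have := permSum_mapDomain p V.subtype.toAddMonoidHom (ℓ ⟨y g, fun h => hinv h g⟩)
    rw [hℓ'] at this
    exact this

/-- Modulo the trace ideal the cocycle lifts after raising it to the power `|Γ|`, since its values
become invariant. Bringing this lift back to `A` leaves a cocycle with values in the trace ideal,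
for which `of_mem_span` applies. -/
theorem of_isPGroup_aux (n : ℕ) : ∀ (Γ : Type v) [Group Γ] [Finite Γ], Nat.card Γ = n →
    IsPGroup p Γ → ∀ (A : Type u) [CommRing A] [Algebra (ZMod p) A] (ρ : Γ →* (A →+* A))
      (x : Γ → A), IsCocycle (ringEnd ρ) x → FrobLiftable p ρ x := by
  induction n using Nat.strong_induction_on with
  | _ n IH =>
    intro Γ _ _ hn hΓ A _ _ ρ x hx
    obtain ⟨m, hm⟩ := IsPGroup.iff_card.1 hΓ
    let J := traceIdeal ρ
    let ρ' := quotientAction ρ J (le_comap_of_span ρ _ fun f hf => IsProperTrace.apply_eq hf)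
    have hρ : ∀ g a, Ideal.Quotient.mk J (ρ g a) = ρ' g (Ideal.Quotient.mk J a) := fun g a => rfl
    have h1 : FrobLiftable p ρ' fun g => Ideal.Quotient.mk J (x g) := by
      have hx' := (hx.comp (ρ' := ringEnd ρ') (Ideal.Quotient.mk J).toAddMonoidHom hρ).frobPow
        (p := p) m
      refine of_pow m (of_invariant hx' fun g h => ?_)
      change ρ' g (Ideal.Quotient.mk J (x h) ^ p ^ m) = Ideal.Quotient.mk J (x h) ^ p ^ m
      rw [← map_pow, ← hρ, eq_comm, Ideal.Quotient.eq, ← hm]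
      exact pow_card_sub_apply_mem_traceIdeal ρ (x h) g
    obtain ⟨k, c, hc, hcx⟩ :=
      exists_of_quotient (Ideal.Quotient.mk J) Ideal.Quotient.mk_surjective hρ hΓ h1
    have hy := (hx.frobPow (p := p) k).sub (isCocycle_permSum p hc)
    -- As `Γ` is finite, finitely many traces suffice for all values of the cocycle.
    have hfin : ∀ g, ∃ T : Finset A, (T : Set A) ⊆ {f | IsProperTrace ρ f} ∧
        x g ^ p ^ k - SmoothProfinite.permSum p (c g) ∈ Ideal.span (T : Set A) := fun g =>
      Submodule.mem_span_finite_of_mem_span (Ideal.Quotient.eq.1 (hcx g).symm)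
    choose T hT hT' using hfin
    classical
    have := Fintype.ofFinite Γ
    have h2 := of_mem_span hΓ (fun H hH A _ _ ρ x hx =>
      IH (Nat.card H) (hn ▸ lt_of_le_of_ne H.card_le_card_group
        fun h => hH (H.eq_top_of_card_eq h)) H rfl (hΓ.to_subgroup H) A ρ x hx) _ A ρ (Finset.univ.biUnion T).toList
      _ rfl (fun f hf => by
        rw [Finset.mem_toList, Finset.mem_biUnion] at hf
        obtain ⟨g, -, hf⟩ := hf
        exact hT g hf) hy fun g => by
        refine Ideal.span_mono ?_ (hT' g)
        intro f hf
        rw [Set.mem_ofPred_eq, Finset.mem_toList, Finset.mem_biUnion]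
        exact ⟨g, Finset.mem_univ _, hf⟩
    refine of_pow k ?_
    have h3 := h2.add (permSum hc)
    simpa using h3

/-- For a finite `p`-group `Γ` acting on an `𝔽_p`-algebra `A`, every cocycle with values in `A` lifts,
up to Frobenius, to a cocycle with values in `𝔽_p[A]`. -/
theorem of_isPGroup {A : Type u} [CommRing A] [Algebra (ZMod p) A] (hΓ : IsPGroup p Γ)
    {ρ : Γ →* (A →+* A)} {x : Γ → A} (hx : IsCocycle (ringEnd ρ) x) : FrobLiftable p ρ x :=
  of_isPGroup_aux _ Γ rfl hΓ A ρ x hx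

end Main

end FrobLiftable

end

end SmoothProfinite

namespace SmoothProfinite

noncomputable section

/-! ## Twisted coefficients -/

section Twist

variable {p : ℕ} [Fact p.Prime] {Γ : Type v} [Group Γ] {M : Type*} [AddCommGroup M]
  [Module (ZMod p) M]

/-- The twist of an action on an `𝔽_p`-vector space by a character. -/
def twistEnd (ω : Γ →* (ZMod p)ˣ) (ρ : Γ →* AddMonoid.End M) : Γ →* AddMonoid.End M where
  toFun g := (DistribSMul.toAddMonoidHom M (ω g : ZMod p)).comp (ρ g : M →+ M)
  map_one' := AddMonoidHom.ext fun m => by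
    change ((ω 1 : (ZMod p)ˣ) : ZMod p) • ρ 1 m = m
    rw [map_one, map_one, Units.val_one, one_smul]
    rfl
  map_mul' g h := AddMonoidHom.ext fun m => by
    change ((ω (g * h) : (ZMod p)ˣ) : ZMod p) • ρ (g * h) m = (ω g : ZMod p) • ρ g ((ω h : ZMod p) • ρ h m)
    rw [map_mul, map_mul, Units.val_mul, mul_smul, ZMod.map_smul (ρ g)]
    rfl

theorem twistEnd_apply (ω : Γ →* (ZMod p)ˣ) (ρ : Γ →* AddMonoid.End M) (g : Γ) (m : M) :
    twistEnd ω ρ g m = (ω g : ZMod p) • ρ g m := rfl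

/-- Raising to the power `p ^ k` is the identity on `𝔽_p`, so the units of `𝔽_p` contain no
nontrivial element of `p`-power order. -/
theorem eq_one_of_isPGroup {P : Type*} [Group P] (hP : IsPGroup p P) (ω : P →* (ZMod p)ˣ) (g : P) :
    ω g = 1 := by
  obtain ⟨k, hk⟩ := hP g
  have h := congrArg ω hk
  rw [map_pow, map_one] at h
  rw [← h]
  ext
  rw [Units.val_pow_eq_pow_val, ZMod.pow_card_pow]

/-- The twist disappears on a Sylow subgroup. A lift found there is corestricted, and the index,
being prime to `p`, is inverted in `𝔽_p`. -/
theorem exists_permRep_lift_twist [Finite Γ] (ω : Γ →* (ZMod p)ˣ) (ρ : Γ →* AddMonoid.End M)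
    (hρ : ∀ P : Subgroup Γ, IsPGroup p P → ∀ x : P → M, IsCocycle (ρ.comp P.subtype) x →
      ∃ c : P → M →₀ ZMod p, IsCocycle (permRep (ZMod p) (ρ.comp P.subtype)) c ∧
        ∀ g, permSum p (c g) = x g)
    {x : Γ → M} (hx : IsCocycle (twistEnd ω ρ) x) :
    ∃ c : Γ → M →₀ ZMod p, IsCocycle (twistEnd ω (permRep (ZMod p) ρ)) c ∧
      ∀ g, permSum p (c g) = x g := by
  obtain ⟨P⟩ : Nonempty (Sylow p Γ) := inferInstance
  have := Fintype.ofFinite (Γ ⧸ P.1)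
  have hω : ∀ g : P.1, ω g = 1 := eq_one_of_isPGroup P.2 (ω.comp P.1.subtype)
  have htriv : ∀ {N : Type _} [AddCommGroup N] [Module (ZMod p) N] (ρ : Γ →* AddMonoid.End N),
      (twistEnd ω ρ).comp P.1.subtype = ρ.comp P.1.subtype := fun {N} _ _ ρ =>
    MonoidHom.ext fun g => AddMonoidHom.ext fun m => by
      change (ω g : ZMod p) • ρ g m = ρ g m
      rw [hω, Units.val_one, one_smul]
  obtain ⟨c, hc, hcx⟩ := hρ P.1 P.2 (fun g => x g) (by
    rw [← htriv]
    exact hx.comp_hom P.1.subtype)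
  -- With all endomorphisms equal to `1` this says that corestriction after restriction is the
  -- index, up to the coboundary of `w`; the latter lifts to the coboundary of the basis element
  -- `[w]`.
  obtain ⟨w, hw⟩ := exists_sum_eq_cores_add (H := P.1) hx (fun _ => 1) fun _ _ _ => rfl
  have hsum : ∀ g (d : M →₀ ZMod p), permSum p (twistEnd ω (permRep (ZMod p) ρ) g d) =
      twistEnd ω ρ g (permSum p d) := fun g d => by
    rw [twistEnd_apply, twistEnd_apply, ZMod.map_smul, permSum_permRep]
  have hc' : IsCocycle ((twistEnd ω (permRep (ZMod p) ρ)).comp P.1.subtype) c := by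
    rw [htriv]
    exact hc
  have hC := hc'.cores.add
    (IsCocycle.coboundary (twistEnd ω (permRep (ZMod p) ρ)) (Finsupp.single w 1))
  set k : ZMod p := (Fintype.card (Γ ⧸ P.1) : ZMod p)⁻¹ with hk
  have hk0 : (Fintype.card (Γ ⧸ P.1) : ZMod p) ≠ 0 := by
    rw [Ne, ZMod.natCast_eq_zero_iff, ← Nat.card_eq_fintype_card]
    exact P.not_dvd_index
  refine ⟨_, hC.comp (DistribSMul.toAddMonoidHom _ k) fun g d =>
    (ZMod.map_smul (twistEnd ω (permRep (ZMod p) ρ) g) k d).symm, fun g => ?_⟩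
  have e1 : permSum p (cores (twistEnd ω (permRep (ZMod p) ρ)) P.1 c g) =
      cores (twistEnd ω ρ) P.1 (fun h => x h) g := by
    simp only [cores, map_sum, hsum, hcx]
  have e2 := hw g
  simp only [AddMonoid.End.coe_one, id, Finset.sum_const, Finset.card_univ] at e2
  change permSum p (k • (cores (twistEnd ω (permRep (ZMod p) ρ)) P.1 c g +
    (twistEnd ω (permRep (ZMod p) ρ) g (Finsupp.single w 1) - Finsupp.single w 1))) = x g
  rw [ZMod.map_smul, map_add, map_sub, e1, hsum, permSum_single, one_smul]
  have e3 : cores (twistEnd ω ρ) P.1 (fun h => x h) g + (twistEnd ω ρ g w - w) =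
      Fintype.card (Γ ⧸ P.1) • x g := e2.symm
  rw [e3, ← Nat.cast_smul_eq_nsmul (ZMod p), smul_smul, hk, inv_mul_cancel₀ hk0, one_smul]

end Twist

/-! ## Lifting cocycles with values in permutation modules -/

section PermLift

variable {p : ℕ} [Fact p.Prime] {G : Type v} [Group G] [TopologicalSpace G]
  {χ : G →* ℤ_[p]ˣ}

theorem toZMod_surjective : Function.Surjective (PadicInt.toZMod : ℤ_[p] →+* ZMod p) :=
  ZMod.ringHom_surjective _

/-- The hypothesis lifts cohomology classes. To lift the cocycle itself, the coboundary by which it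
differs from the reduction of `d` is lifted by lifting the element `a` that defines it. -/
theorem IsOneInftyCyclotomic.exists_lift (hχ : IsOneInftyCyclotomic p χ) {H : Subgroup G}
    (hH : IsOpen (H : Set G)) {c : H → ZMod p} (hc : Continuous c)
    (hc' : ∀ g h, c (g * h) = c g + PadicInt.toZMod (χ g : ℤ_[p]) * c h) :
    ∃ d : H → ℤ_[p], Continuous d ∧ (∀ g h : H, d (g * h) = d g + (χ g : ℤ_[p]) * d h) ∧
      ∀ g, PadicInt.toZMod (d g) = c g := by
  obtain ⟨d, hd⟩ := hχ.2 H hH (QuotientAddGroup.mk ⟨c, hc, hc'⟩)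
  obtain ⟨d, rfl⟩ := QuotientAddGroup.mk_surjective d
  obtain ⟨a, ha⟩ := QuotientAddGroup.eq.1 hd
  obtain ⟨a, rfl⟩ := toZMod_surjective a
  have hχc : Continuous fun g : H => (χ g : ℤ_[p]) :=
    Units.continuous_val.comp (hχ.1.comp continuous_subtype_val)
  refine ⟨fun g => d.1 g + ((χ g : ℤ_[p]) * a - a), d.2.1.add ((hχc.mul continuous_const).sub
    continuous_const), fun g h => ?_, fun g => ?_⟩
  · beta_reduce
    have h1 : d.1 (g * h) = d.1 g + (χ g : ℤ_[p]) * d.1 h := d.2.2 g h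
    rw [h1, Subgroup.coe_mul, map_mul, Units.val_mul]
    ring
  · have h1 : -PadicInt.toZMod (d.1 g) + c g =
        PadicInt.toZMod (χ g : ℤ_[p]) * PadicInt.toZMod a - PadicInt.toZMod a := ha g
    rw [map_add, map_sub, map_mul]
    linear_combination -h1

variable [IsTopologicalGroup G]

/-- Shapiro's lemma at the level of cocycles: on an orbit, `c` is determined by its restriction to
the stabilizer of a representative `r x` and by the values `c (t y) y`. The restriction lifts since
the stabilizer is open, and the remaining values are lifted arbitrarily. -/
theorem IsOneInftyCyclotomic.exists_perm_lift (hχ : IsOneInftyCyclotomic p χ) {X : Type*}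
    [MulAction G X] (hX : ∀ x : X, IsOpen (MulAction.stabilizer G x : Set G)) (c : G → X → ZMod p)
    (hc : ∀ x, Continuous fun g => c g x)
    (hc' : ∀ g h x, c (g * h) x = c g x + PadicInt.toZMod (χ g : ℤ_[p]) * c h (g⁻¹ • x)) :
    ∃ d : G → X → ℤ_[p], (∀ x, Continuous fun g => d g x) ∧
      (∀ g h x, d (g * h) x = d g x + (χ g : ℤ_[p]) * d h (g⁻¹ • x)) ∧
      ∀ g x, PadicInt.toZMod (d g x) = c g x := by
  classical
  let r : X → X := fun x => (Quotient.mk (MulAction.orbitRel G X) x).out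
  have hr : ∀ x, ∃ t : G, t • r x = x := fun x =>
    MulAction.orbitRel_apply.1
      ((MulAction.orbitRel G X).symm (@Quotient.mk_out X (MulAction.orbitRel G X) x))
  have hr' : ∀ (g : G) x, r (g • x) = r x := fun g x => by
    simp only [r]
    rw [Quotient.sound (s := MulAction.orbitRel G X) (MulAction.orbitRel_apply.2 ⟨g, rfl⟩)]
  choose t ht using hr
  have hd : ∀ x : X, ∃ D : G → ℤ_[p], (∀ h ∈ MulAction.stabilizer G x, ContinuousAt D h ∧
      PadicInt.toZMod (D h) = c h x ∧ ∀ h' ∈ MulAction.stabilizer G x,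
        D (h * h') = D h + (χ h : ℤ_[p]) * D h') := fun x => by
    obtain ⟨d, hd, hd', hd''⟩ := hχ.exists_lift (hX x)
      (c := fun h => c h x) ((hc x).comp continuous_subtype_val) fun g h => by
        have : (g : G)⁻¹ • x = x := (inv_mem g.2)
        rw [Subgroup.coe_mul, hc', this]
    -- The value `0` outside the stabilizer is never used; since the stabilizer is open, it does not
    -- affect continuity at its points.
    refine ⟨fun g => if hg : g ∈ MulAction.stabilizer G x then d ⟨g, hg⟩ else 0, fun h hh =>
      ⟨?_, ?_, fun h' hh' => ?_⟩⟩
    · refine ((hX x).isOpenEmbedding_subtypeVal.continuousAt_iff (x := ⟨h, hh⟩)).1 ?_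
      exact (hd.continuousAt (x := (⟨h, hh⟩ : MulAction.stabilizer G x))).congr
        (Filter.Eventually.of_forall fun g => by
          change d g = if hg : (g : G) ∈ MulAction.stabilizer G x then d ⟨g, hg⟩ else 0
          rw [dif_pos g.2])
    · beta_reduce
      rw [dif_pos hh]
      exact hd'' _
    · beta_reduce
      rw [dif_pos hh, dif_pos hh', dif_pos (mul_mem hh hh')]
      exact hd' ⟨h, hh⟩ ⟨h', hh'⟩
  choose D hD using hd
  -- These arbitrary lifts enter only through a coboundary; they make the reduction of the lift
  -- equal to `c`, and not only cohomologous to it.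
  choose b hb using fun y => toZMod_surjective (p := p) (c (t y) y)
  let η : G → X → G := fun g y => (t y)⁻¹ * (g * t (g⁻¹ • y))
  have hη : ∀ g y, η g y ∈ MulAction.stabilizer G (r y) := fun g y => by
    rw [MulAction.mem_stabilizer_iff]
    simp only [η]
    rw [mul_smul, mul_smul, ← hr' g⁻¹ y, ht, smul_inv_smul, inv_smul_eq_iff, hr', ht]
  have hηm : ∀ g h y, η (g * h) y = η g y * η h (g⁻¹ • y) := fun g h y => by
    simp only [η, mul_inv_rev, mul_smul]
    group
  have hct : ∀ y, c (t y)⁻¹ (r y) + PadicInt.toZMod (χ (t y)⁻¹ : ℤ_[p]) * c (t y) y = 0 := fun y => by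
    have h1 := hc' (t y)⁻¹ (t y) (r y)
    rw [inv_inv, ht, inv_mul_cancel] at h1
    have h2 := hc' 1 1 (r y)
    simp only [mul_one, map_one, Units.val_one, inv_one, one_smul, one_mul] at h2
    rw [← h1]
    simpa using h2
  have hχi : ∀ g : G, (χ g : ℤ_[p]) * (χ g⁻¹ : ℤ_[p]) = 1 := fun g => by
    rw [← Units.val_mul, ← map_mul, mul_inv_cancel, map_one, Units.val_one]
  -- Expanding `c` by the cocycle rule along `g = t y * η g y * (t (g⁻¹ • y))⁻¹` gives three terms;
  -- the formula lifts them one by one, the last being rewritten by `hct`.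
  refine ⟨fun g y => (χ (t y) : ℤ_[p]) * D (r y) (η g y) + b y - (χ g : ℤ_[p]) * b (g⁻¹ • y),
    fun y => ?_, fun g h y => ?_, fun g y => ?_⟩
  · rw [continuous_iff_continuousAt]
    intro g₀
    have hχc : Continuous fun g : G => (χ g : ℤ_[p]) := Units.continuous_val.comp hχ.1
    -- Stabilizers are open, so `g⁻¹ • y` is locally constant in `g` and the choices attached to it
    -- can be frozen.
    have hev : ∀ᶠ g in nhds g₀, g⁻¹ • y = g₀⁻¹ • y := by
      have hopen : IsOpen {g : G | g * g₀⁻¹ ∈ MulAction.stabilizer G y} :=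
        (hX y).preimage (continuous_id.mul continuous_const)
      filter_upwards [hopen.mem_nhds (by
        change g₀ * g₀⁻¹ ∈ MulAction.stabilizer G y
        rw [mul_inv_cancel]
        exact one_mem _)] with g hg
      have : (g * g₀⁻¹)⁻¹ • y = y := inv_mem hg
      rw [mul_inv_rev, inv_inv, mul_smul] at this
      conv_rhs => rw [← this]
      rw [inv_smul_smul]
    have h1 : ContinuousAt (fun g : G => D (r y) ((t y)⁻¹ * (g * t (g₀⁻¹ • y)))) g₀ :=
      ContinuousAt.comp (f := fun g : G => (t y)⁻¹ * (g * t (g₀⁻¹ • y))) (hD _ _ (hη g₀ y)).1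
        (continuous_const.mul (continuous_id.mul continuous_const)).continuousAt
    have h2 : ContinuousAt (fun g : G => (χ (t y) : ℤ_[p]) *
        D (r y) ((t y)⁻¹ * (g * t (g₀⁻¹ • y))) + b y - (χ g : ℤ_[p]) * b (g₀⁻¹ • y)) g₀ :=
      ((continuousAt_const.mul h1).add continuousAt_const).sub
        (hχc.continuousAt.mul continuousAt_const)
    refine h2.congr (hev.mono fun g hg => ?_)
    simp only [η, hg]
  · have h1 := (hD _ _ (hη g y)).2.2 (η h (g⁻¹ • y)) (by
      have := hη h (g⁻¹ • y)
      rwa [hr'] at this)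
    have h2 : (χ (t y) : ℤ_[p]) * (χ (η g y) : ℤ_[p]) = (χ g : ℤ_[p]) * (χ (t (g⁻¹ • y)) : ℤ_[p]) := by
      rw [← Units.val_mul, ← Units.val_mul, ← map_mul, ← map_mul, mul_inv_cancel_left]
    beta_reduce
    rw [hηm, h1, hr', mul_inv_rev, mul_smul, map_mul χ g h, Units.val_mul]
    linear_combination (D (r y) (η h (g⁻¹ • y))) * h2
  · have h1 := (hD _ _ (hη g y)).2.1
    have h2 : c g y = c (t y * η g y * (t (g⁻¹ • y))⁻¹) y := by simp [η]
    have h3 : (t y)⁻¹ • y = r y := by rw [inv_smul_eq_iff, ht]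
    have h4 : (η g y)⁻¹ • r y = r y := inv_mem (hη g y)
    have h5 := hct (g⁻¹ • y)
    rw [hr'] at h5
    have h6 : (χ (t y) : ℤ_[p]) * ((χ (η g y) : ℤ_[p]) * (χ (t (g⁻¹ • y))⁻¹ : ℤ_[p])) = χ g := by
      rw [← Units.val_mul, ← Units.val_mul, ← map_mul, ← map_mul]
      congr 2
      simp only [η]
      group
    have h7 := congrArg (PadicInt.toZMod (p := p)) h6
    rw [map_mul, map_mul] at h7
    rw [mul_assoc, hc', hc', h3, h4] at h2
    rw [map_sub, map_add, map_mul, map_mul, h1, hb, hb, h2]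
    linear_combination (-PadicInt.toZMod (χ (t y) : ℤ_[p]) * PadicInt.toZMod (χ (η g y) : ℤ_[p])) * h5 +
      c (t (g⁻¹ • y)) (g⁻¹ • y) * h7

end PermLift

end

end SmoothProfinite

namespace SmoothProfinite

noncomputable section

variable {p : ℕ} [Fact p.Prime]

/-! ## Coordinates of truncated Witt vectors in characteristic `p` -/

section Coordinates

variable {R : Type*} [CommRing R]

/-- Write `x = [x₀] + V y`; the identity `[a] V y = V ([a ^ p] y)` reduces the coefficient `i + 1`
of `x` to the coefficient `i` of `y`. Consequently the coordinate of index `i` of a section of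
`W_s(L)` behaves like a section of the `p ^ i`-th power of `L`. -/
theorem teichmuller_mul_coeff_of_charP [CharP R p] (i : ℕ) (a : R) (x : WittVector p R) :
    (WittVector.teichmuller p a * x).coeff i = a ^ p ^ i * x.coeff i := by
  induction i generalizing a x with
  | zero => rw [WittVector.mul_coeff_zero, WittVector.teichmuller_coeff_zero, pow_zero, pow_one]
  | succ i ih =>
    let y : WittVector p R := WittVector.mk p fun n => x.coeff (n + 1)
    have hdis : ∀ b : R, ∀ z : WittVector p R, ∀ n, (WittVector.teichmuller p b).coeff n = 0 ∨
        (WittVector.verschiebung z).coeff n = 0 := fun b z n => by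
      cases n with
      | zero => exact Or.inr (WittVector.verschiebung_coeff_zero z)
      | succ n => exact Or.inl (WittVector.teichmuller_coeff_pos p b _ n.succ_pos)
    have hx : x = WittVector.teichmuller p (x.coeff 0) + WittVector.verschiebung y := by
      ext n
      rw [WittVector.coeff_add_of_disjoint _ _ _ (hdis _ _)]
      cases n with
      | zero => rw [WittVector.teichmuller_coeff_zero, WittVector.verschiebung_coeff_zero, add_zero]
      | succ n =>
        rw [WittVector.teichmuller_coeff_pos p _ _ n.succ_pos, zero_add,
          WittVector.verschiebung_coeff_add_one]
        rfl
    have hF : WittVector.frobenius (WittVector.teichmuller p a) = WittVector.teichmuller p (a ^ p) := by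
      rw [WittVector.frobenius_eq_map_frobenius, WittVector.map_teichmuller]
      rfl
    conv_lhs => rw [hx]
    rw [mul_add, ← map_mul, mul_comm _ (WittVector.verschiebung y),
      ← WittVector.verschiebung_mul_frobenius, hF,
      WittVector.coeff_add_of_disjoint _ _ _ (hdis _ _),
      WittVector.teichmuller_coeff_pos p _ _ i.succ_pos, zero_add,
      WittVector.verschiebung_coeff_add_one, mul_comm, ih, ← pow_mul, ← pow_succ']
    rfl

theorem coeff_wittTeich_mul (hp : (p : R) = 0) {s : ℕ} (a : R) (x : TruncatedWittVector p s R)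
    (i : Fin s) : (wittTeich p s a * x).coeff i = a ^ p ^ (i : ℕ) * x.coeff i := by
  cases subsingleton_or_nontrivial R with
  | inl h => exact Subsingleton.elim _ _
  | inr h =>
    have : CharP R p := (CharP.charP_iff_prime_eq_zero (Fact.out : p.Prime)).2 hp
    obtain ⟨x, rfl⟩ := WittVector.truncate_surjective p s R x
    rw [wittTeich, ← map_mul, WittVector.coeff_truncate, WittVector.coeff_truncate,
      teichmuller_mul_coeff_of_charP]

theorem coeff_p_nsmul_zero (hp : (p : R) = 0) {s : ℕ} (x : TruncatedWittVector p s R)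
    (i : Fin s) (hi : (i : ℕ) = 0) : (p • x).coeff i = 0 := by
  cases subsingleton_or_nontrivial R with
  | inl h => exact Subsingleton.elim _ _
  | inr h =>
    have : CharP R p := (CharP.charP_iff_prime_eq_zero (Fact.out : p.Prime)).2 hp
    obtain ⟨x, rfl⟩ := WittVector.truncate_surjective p s R x
    rw [← map_nsmul, WittVector.coeff_truncate, nsmul_eq_mul, mul_comm, hi,
      WittVector.mul_charP_coeff_zero]

/-- In characteristic `p`, multiplication by `p` is Verschiebung after Frobenius. -/
theorem coeff_p_nsmul_succ (hp : (p : R) = 0) {s : ℕ} (x : TruncatedWittVector p s R)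
    (i j : Fin s) (hi : (i : ℕ) = j + 1) : (p • x).coeff i = x.coeff j ^ p := by
  cases subsingleton_or_nontrivial R with
  | inl h => exact Subsingleton.elim _ _
  | inr h =>
    have : CharP R p := (CharP.charP_iff_prime_eq_zero (Fact.out : p.Prime)).2 hp
    obtain ⟨x, rfl⟩ := WittVector.truncate_surjective p s R x
    rw [← map_nsmul, WittVector.coeff_truncate, WittVector.coeff_truncate, nsmul_eq_mul, mul_comm,
      hi, WittVector.mul_charP_coeff_succ]

end Coordinates

set_option linter.unusedSectionVars false

namespace IsPerfectOfChar

variable {S : Scheme.{u}} (hS : IsPerfectOfChar p S)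

include hS

theorem natCast_eq_zero (V : S.Opens) : (p : Γ(S, V)) = 0 := by
  rw [← map_natCast (S.presheaf.map (homOfLE (le_top : V ≤ ⊤)).op).hom, hS.char_eq, map_zero]

/-- The `p`-th root of a function. -/
def root (V : S.Opens) (a : Γ(S, V)) : Γ(S, V) := ((hS.bijective_frob V).2 a).choose

theorem root_pow (V : S.Opens) (a : Γ(S, V)) : hS.root V a ^ p = a :=
  ((hS.bijective_frob V).2 a).choose_spec

theorem pow_inj {V : S.Opens} {a b : Γ(S, V)} (h : a ^ p = b ^ p) : a = b :=
  (hS.bijective_frob V).1 h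

theorem pow_pow_inj (k : ℕ) {V : S.Opens} {a b : Γ(S, V)} (h : a ^ p ^ k = b ^ p ^ k) : a = b := by
  induction k with
  | zero => simpa using h
  | succ k ih =>
    rw [pow_succ, pow_mul, pow_mul] at h
    exact ih (hS.pow_inj h)

theorem eq_zero_of_pow {V : S.Opens} {a : Γ(S, V)} (h : a ^ p = 0) : a = 0 :=
  hS.pow_inj (by rw [h, zero_pow (Fact.out : p.Prime).ne_zero])

end IsPerfectOfChar

/-! ## Coordinates of sections of Teichmüller lifts -/

section Sections

variable {S : Scheme.{u}} {L : S.Modules}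

instance (s : ℕ) (U : S.Opens) : AddCommGroup (wittSections p L s U) :=
  AddSubgroup.toAddCommGroup _

instance (s : ℕ) (U : S.Opens) : AddCommMonoid (wittSections p L s U) :=
  AddCommGroup.toAddCommMonoid

instance (s : ℕ) (U : S.Opens) : AddGroup (wittSections p L s U) :=
  AddCommGroup.toAddGroup

instance (s : ℕ) (U : S.Opens) : AddMonoid (wittSections p L s U) :=
  AddCommMonoid.toAddMonoid

instance (s : ℕ) (U : S.Opens) : AddZeroClass (wittSections p L s U) :=
  AddMonoid.toAddZeroClass

/-- Restriction of functions. -/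
abbrev fres {V W : S.Opens} (h : W ≤ V) : Γ(S, V) →+* Γ(S, W) :=
  (S.presheaf.map (homOfLE h).op).hom

theorem fres_fres {V W X : S.Opens} (h : W ≤ V) (h' : X ≤ W) (a : Γ(S, V)) :
    fres h' (fres h a) = fres (h'.trans h) a := by
  change (S.presheaf.map _ ≫ S.presheaf.map _) a = _
  rw [← S.presheaf.map_comp]
  rfl

theorem Gen.res_res {V W X : S.Opens} (h : W ≤ V) (h' : X ≤ W) (e : Gen L V) :
    (e.res h).res h' = e.res (h'.trans h) :=
  Subtype.ext (map_map_apply _ _ _ _)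

/-- Restriction of sections of `W_s(L)`. -/
abbrev wres (L : S.Modules) (s : ℕ) {U V : S.Opens} (h : V ≤ U) :
    wittSections p L s U →+ wittSections p L s V :=
  ((wittLine p L s).map (homOfLE h).op).hom

theorem wres_apply {s : ℕ} {U V : S.Opens} (h : V ≤ U) (f : wittSections p L s U)
    (W : {W : S.Opens // W ≤ V}) (e : Gen L W.1) :
    (wres L s h f).1 W e = f.1 ⟨W.1, W.2.trans h⟩ e := rfl

/-- Reduction of sections of `W_{s+1}(L)`. -/
abbrev wred (L : S.Modules) (s : ℕ) (U : S.Opens) :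
    wittSections p L (s + 1) U →+ wittSections p L s U :=
  ((wittLineReduction p L s).app (op U)).hom

theorem coeff_wred {s : ℕ} {U : S.Opens} (f : wittSections p L (s + 1) U)
    (V : {V : S.Opens // V ≤ U}) (e : Gen L V.1) (i : Fin s) :
    ((wred L s U f).1 V e).coeff i = (f.1 V e).coeff i.castSucc :=
  TruncatedWittVector.coeff_truncate (Nat.le_succ s) i (f.1 V e)

theorem wittSections_ext {s : ℕ} {U : S.Opens} {f g : wittSections p L s U}
    (h : ∀ V e i, (f.1 V e).coeff i = (g.1 V e).coeff i) : f = g :=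
  Subtype.ext (funext fun V => funext fun e => TruncatedWittVector.ext fun i => h V e i)

theorem coeff_res_section {s : ℕ} {U : S.Opens} (f : wittSections p L s U)
    (V V' : {V : S.Opens // V ≤ U}) (h : V'.1 ≤ V.1) (e : Gen L V.1) (i : Fin s) :
    (f.1 V' (e.res h)).coeff i = fres h ((f.1 V e).coeff i) := by
  rw [f.2.1 V V' h e, coeff_wittMap]

variable (hS : IsPerfectOfChar p S)

include hS

theorem coeff_smul_section {s : ℕ} {U : S.Opens} (f : wittSections p L s U)
    (V : {V : S.Opens // V ≤ U}) (e e' : Gen L V.1) (a : Γ(S, V.1)) (h : e'.1 = a • e.1)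
    (i : Fin s) : (f.1 V e).coeff i = a ^ p ^ (i : ℕ) * (f.1 V e').coeff i := by
  rw [f.2.2 V e e' a h, coeff_wittTeich_mul (hS.natCast_eq_zero V.1)]

/-- The section of `W_s(L)` with given coordinates. -/
def wittOfCoeff {s : ℕ} {U : S.Opens}
    (b : ∀ V : {V : S.Opens // V ≤ U}, Gen L V.1 → ℕ → Γ(S, V.1))
    (hres : ∀ (V V' : {V : S.Opens // V ≤ U}) (h : V'.1 ≤ V.1) (e : Gen L V.1) (i : Fin s),
      b V' (e.res h) i = fres h (b V e i))
    (hsmul : ∀ (V : {V : S.Opens // V ≤ U}) (e e' : Gen L V.1) (a : Γ(S, V.1)) (i : Fin s),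
      e'.1 = a • e.1 → b V e i = a ^ p ^ (i : ℕ) * b V e' i) : wittSections p L s U :=
  ⟨fun V e => TruncatedWittVector.mk p fun i => b V e i,
    fun V V' h e => by
      ext i
      rw [coeff_wittMap, TruncatedWittVector.coeff_mk, TruncatedWittVector.coeff_mk, hres],
    fun V e e' a h => by
      ext i
      rw [coeff_wittTeich_mul (hS.natCast_eq_zero V.1), TruncatedWittVector.coeff_mk,
        TruncatedWittVector.coeff_mk, hsmul _ _ _ _ _ h]⟩

theorem coeff_wittOfCoeff {s : ℕ} {U : S.Opens}
    (b : ∀ V : {V : S.Opens // V ≤ U}, Gen L V.1 → ℕ → Γ(S, V.1)) (hres) (hsmul)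
    (V : {V : S.Opens // V ≤ U}) (e : Gen L V.1) (i : Fin s) :
    ((wittOfCoeff hS (s := s) b hres hsmul).1 V e).coeff i = b V e i :=
  TruncatedWittVector.coeff_mk _ _

/-- The coordinates of a section, extended by zero. -/
theorem exists_extend {s : ℕ} {U : S.Opens} (f : wittSections p L s U) (t : ℕ) :
    ∃ g : wittSections p L t U, ∀ V e (i : Fin t), (g.1 V e).coeff i =
      if h : (i : ℕ) < s then (f.1 V e).coeff ⟨i, h⟩ else 0 := by
  refine ⟨wittOfCoeff hS (fun V e i => if h : i < s then (f.1 V e).coeff ⟨i, h⟩ else 0)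
    (fun V V' h e i => ?_) (fun V e e' a i h => ?_), fun V e i => coeff_wittOfCoeff hS _ _ _ V e i⟩
  · split_ifs with hi
    · exact coeff_res_section f V V' h e _
    · exact (map_zero _).symm
  · split_ifs with hi
    · exact coeff_smul_section hS f V e e' a h _
    · exact (mul_zero _).symm

theorem wred_surjective (s : ℕ) (U : S.Opens) : Function.Surjective (wred (p := p) L s U) := by
  intro f
  obtain ⟨g, hg⟩ := exists_extend hS f (s + 1)
  refine ⟨g, wittSections_ext fun V e i => ?_⟩
  rw [coeff_wred, hg, dif_pos (show ((i.castSucc : Fin (s + 1)) : ℕ) < s from i.2)]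
  rfl

omit hS in
theorem coeff_nsmul_section {s : ℕ} {U : S.Opens} (n : ℕ) (f : wittSections p L s U)
    (V : {V : S.Opens // V ≤ U}) (e : Gen L V.1) : (n • f).1 V e = n • f.1 V e := rfl

/-- Multiplication by `p` shifts the coordinates and raises them to the power `p`. The last
coordinate is lost, and the others are not, since Frobenius is injective. -/
theorem p_nsmul_eq_zero_iff {s : ℕ} {U : S.Opens} (f : wittSections p L (s + 1) U) :
    p • f = 0 ↔ wred L s U f = 0 := by
  constructor
  · intro h
    refine wittSections_ext fun V e i => ?_
    have h1 : ((p • f).1 V e).coeff i.succ = 0 := by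
      rw [h]
      exact TruncatedWittVector.coeff_zero p (s + 1) _ _
    rw [coeff_nsmul_section, coeff_p_nsmul_succ (hS.natCast_eq_zero V.1) _ _ i.castSucc (by simp)] at h1
    rw [coeff_wred, hS.eq_zero_of_pow h1]
    exact (TruncatedWittVector.coeff_zero p s _ _).symm
  · intro h
    refine wittSections_ext fun V e i => ?_
    have h0 : ((0 : wittSections p L (s + 1) U).1 V e).coeff i = 0 :=
      TruncatedWittVector.coeff_zero p (s + 1) _ _
    rw [h0, coeff_nsmul_section]
    refine Fin.cases ?_ (fun i => ?_) i
    · exact coeff_p_nsmul_zero (hS.natCast_eq_zero V.1) _ _ rfl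
    · rw [coeff_p_nsmul_succ (hS.natCast_eq_zero V.1) _ _ i.castSucc (by simp), ← coeff_wred, h]
      have : ((0 : wittSections p L s U).1 V e).coeff i = 0 :=
        TruncatedWittVector.coeff_zero p s _ _
      rw [this, zero_pow (Fact.out : p.Prime).ne_zero]

/-- The quotient has as coordinates the `p`-th roots of the shifted coordinates of `f`. They exist
because `S` is perfect, and uniqueness of roots makes them compatible with restriction and change of
generator. -/
theorem exists_eq_p_nsmul {s : ℕ} {U : S.Opens} (f : wittSections p L (s + 1) U)
    (h : ∀ V e, (f.1 V e).coeff 0 = 0) : ∃ g : wittSections p L (s + 1) U, f = p • g := by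
  -- The last coordinate is killed by `p` and is therefore set to zero.
  let c : ∀ V : {V : S.Opens // V ≤ U}, Gen L V.1 → ℕ → Γ(S, V.1) := fun V e i =>
    if h : i < s then hS.root V.1 ((f.1 V e).coeff ⟨i + 1, by omega⟩) else 0
  have hc : ∀ V e i (h : i < s), c V e i ^ p = (f.1 V e).coeff ⟨i + 1, by omega⟩ :=
    fun V e i h => by
      simp only [c, dif_pos h]
      exact hS.root_pow _ _
  refine ⟨wittOfCoeff hS c (fun V V' h e i => ?_) (fun V e e' a i h => ?_), ?_⟩
  · by_cases hi : (i : ℕ) < s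
    · refine hS.pow_inj ?_
      rw [hc _ _ _ hi, ← map_pow, hc _ _ _ hi, coeff_res_section]
    · simp only [c, dif_neg hi, map_zero]
  · by_cases hi : (i : ℕ) < s
    · refine hS.pow_inj ?_
      rw [hc _ _ _ hi, mul_pow, hc _ _ _ hi, coeff_smul_section hS f V e e' a h, ← pow_mul,
        ← pow_succ]
    · simp only [c, dif_neg hi, mul_zero]
  · refine wittSections_ext fun V e i => ?_
    rw [coeff_nsmul_section]
    revert i
    refine Fin.cases ?_ (fun i => ?_)
    · rw [h, coeff_p_nsmul_zero (hS.natCast_eq_zero V.1) _ _ rfl]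
    · rw [coeff_p_nsmul_succ (hS.natCast_eq_zero V.1) _ _ i.castSucc (by simp), coeff_wittOfCoeff]
      exact (hc V e i i.2).symm

end Sections

/-! ## Gluing -/

section Gluing

variable {S : Scheme.{u}} {L : S.Modules}

theorem wittSections_eq_of_locally {s : ℕ} {U : S.Opens} {f g : wittSections p L s U}
    (h : ∀ x ∈ U, ∃ (V : S.Opens) (hV : V ≤ U), x ∈ V ∧ wres L s hV f = wres L s hV g) :
    f = g := by
  refine wittSections_ext fun W e i => ?_
  choose V hV hxV hfg using fun x : W.1 => h x (W.2 x.2)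
  refine S.sheaf.eq_of_locally_eq' (fun x : W.1 => W.1 ⊓ V x) W.1
    (fun x => homOfLE inf_le_left) (fun x hx => ?_) _ _ fun x => ?_
  · exact Opens.mem_iSup.2 ⟨⟨x, hx⟩, hx, hxV _⟩
  · have h1 := coeff_res_section f W ⟨W.1 ⊓ V x, inf_le_left.trans W.2⟩ inf_le_left e i
    have h2 := coeff_res_section g W ⟨W.1 ⊓ V x, inf_le_left.trans W.2⟩ inf_le_left e i
    refine h1.symm.trans (Eq.trans ?_ h2)
    have := congrArg (fun k : wittSections p L s (V x) =>
      (k.1 ⟨W.1 ⊓ V x, inf_le_right⟩ (e.res inf_le_left)).coeff i) (hfg x)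
    exact this

/-- Sections of `W_s(L)` which are determined and exist locally exist globally. -/
theorem wittSections_glue (hS : IsPerfectOfChar p S) {s : ℕ} {U : S.Opens}
    (Q : ∀ V : S.Opens, wittSections p L s V → Prop)
    (hres : ∀ (V V' : S.Opens) (h : V' ≤ V) f, Q V f → Q V' (wres L s h f))
    (huniq : ∀ V f f', Q V f → Q V f' → f = f')
    (hex : ∀ x ∈ U, ∃ V : S.Opens, x ∈ V ∧ ∃ f, Q V f) :
    ∃ f : wittSections p L s U, ∀ (V : S.Opens) (h : V ≤ U) f', Q V f' → wres L s h f = f' := by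
  choose V hxV f hf using fun x : U => hex x x.2
  have hcomp : ∀ x y : U, ∀ W : S.Opens, ∀ (hx : W ≤ V x) (hy : W ≤ V y),
      wres L s hx (f x) = wres L s hy (f y) := fun x y W hx hy =>
    huniq W _ _ (hres _ _ _ _ (hf x)) (hres _ _ _ _ (hf y))
  -- Each coordinate is glued separately as a function on `W`. Functions agreeing locally are equal,
  -- which later gives compatibility with restriction and with change of generator.
  have key : ∀ (W : {W : S.Opens // W ≤ U}) (e : Gen L W.1) (i : Fin s),
      ∃ a : Γ(S, W.1), ∀ (x : U) (X : S.Opens) (hX : X ≤ W.1) (hX' : X ≤ V x),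
        fres hX a = ((f x).1 ⟨X, hX'⟩ (e.res hX)).coeff i := fun W e i => by
    obtain ⟨a, ha, -⟩ := S.sheaf.existsUnique_gluing' (fun x : U => W.1 ⊓ V x) W.1
      (fun x => homOfLE inf_le_left)
      (fun x hx => Opens.mem_iSup.2 ⟨⟨x, W.2 hx⟩, hx, hxV _⟩)
      (fun x => ((f x).1 ⟨W.1 ⊓ V x, inf_le_right⟩ (e.res inf_le_left)).coeff i) (fun x y => by
        let X : S.Opens := (W.1 ⊓ V x) ⊓ (W.1 ⊓ V y)
        have h1 := coeff_res_section (f x) ⟨W.1 ⊓ V x, inf_le_right⟩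
          ⟨X, inf_le_left.trans inf_le_right⟩ inf_le_left (e.res inf_le_left) i
        have h2 := coeff_res_section (f y) ⟨W.1 ⊓ V y, inf_le_right⟩
          ⟨X, inf_le_right.trans inf_le_right⟩ inf_le_right (e.res inf_le_left) i
        refine h1.symm.trans (Eq.trans ?_ h2)
        have h3 := hcomp x y X (inf_le_left.trans inf_le_right) (inf_le_right.trans inf_le_right)
        have h4 := congrArg (fun k : wittSections p L s X => (k.1 ⟨X, le_rfl⟩
          ((e.res inf_le_left).res (inf_le_left : X ≤ W.1 ⊓ V x))).coeff i) h3
        have h5 : (e.res (inf_le_left : W.1 ⊓ V x ≤ W.1)).res (inf_le_left : X ≤ W.1 ⊓ V x) =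
            (e.res (inf_le_left : W.1 ⊓ V y ≤ W.1)).res (inf_le_right : X ≤ W.1 ⊓ V y) := by
          rw [Gen.res_res, Gen.res_res]
        refine h4.trans ?_
        rw [h5]
        rfl)
    refine ⟨a, fun x X hX hX' => ?_⟩
    have h1 : fres inf_le_left a =
      ((f x).1 ⟨W.1 ⊓ V x, inf_le_right⟩ (e.res inf_le_left)).coeff i := ha x
    have h2 := coeff_res_section (f x) ⟨W.1 ⊓ V x, inf_le_right⟩ ⟨X, hX'⟩ (le_inf hX hX')
      (e.res inf_le_left) i
    rw [← h1, Gen.res_res] at h2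
    exact (fres_fres _ _ (a : Γ(S, W.1))).symm.trans h2.symm
  choose a ha using key
  have hext : ∀ (W : {W : S.Opens // W ≤ U}) (b c : Γ(S, W.1)),
      (∀ (x : U) (X : S.Opens) (hX : X ≤ W.1), X ≤ V x → fres hX b = fres hX c) → b = c :=
    fun W b c h => S.sheaf.eq_of_locally_eq' (fun x : U => W.1 ⊓ V x) W.1
      (fun x => homOfLE inf_le_left)
      (fun x hx => Opens.mem_iSup.2 ⟨⟨x, W.2 hx⟩, hx, hxV _⟩) _ _ fun x =>
        h x _ inf_le_left inf_le_right
  let b : ∀ W : {W : S.Opens // W ≤ U}, Gen L W.1 → ℕ → Γ(S, W.1) := fun W e i =>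
    if h : i < s then a W e ⟨i, h⟩ else 0
  have hb : ∀ W e (i : Fin s), b W e i = a W e i := fun W e i => dif_pos i.2
  refine ⟨wittOfCoeff hS b (fun W W' h e i => ?_) (fun W e e' c i h => ?_), fun X hX f' hf' => ?_⟩
  · rw [hb, hb]
    refine hext _ _ _ fun x X hX hX' => ?_
    rw [ha _ _ _ x X hX hX', fres_fres, ha _ _ _ x X (hX.trans h) hX', Gen.res_res]
  · rw [hb, hb]
    refine hext _ _ _ fun x X hX hX' => ?_
    rw [map_mul, map_pow, ha _ _ _ x X hX hX', ha _ _ _ x X hX hX']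
    refine coeff_smul_section hS (f x) ⟨X, hX'⟩ _ _ _ ?_ i
    change L.presheaf.map _ e'.1 = _ • L.presheaf.map _ e.1
    rw [h]
    exact L.map_smul _ _ _
  · refine wittSections_eq_of_locally fun x hx => ⟨X ⊓ V ⟨x, hX hx⟩, inf_le_left, ⟨hx, hxV _⟩, ?_⟩
    have h1 : wres L s inf_le_left f' =
        wres L s (inf_le_right : X ⊓ V ⟨x, hX hx⟩ ≤ _) (f ⟨x, hX hx⟩) :=
      huniq _ _ _ (hres _ _ _ _ hf') (hres _ _ _ _ (hf _))
    rw [h1]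
    refine wittSections_ext fun W e i => ?_
    rw [wres_apply, wres_apply, wres_apply, coeff_wittOfCoeff, hb]
    have h2 := ha ⟨W.1, (W.2.trans inf_le_left).trans hX⟩ e i ⟨x, hX hx⟩ W.1 le_rfl
      (W.2.trans inf_le_right)
    have h3 : ∀ c : Γ(S, W.1), fres le_rfl c = c := fun c =>
      congrArg (fun k : Γ(S, W.1) ⟶ Γ(S, W.1) => k c) (S.presheaf.map_id _)
    have h4 : e.res le_rfl = e := Subtype.ext
      (congrArg (fun k : L.presheaf.obj (op W.1) ⟶ L.presheaf.obj (op W.1) => k e.1)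
        (L.presheaf.map_id _))
    rw [h3, h4] at h2
    exact h2

end Gluing

end

end SmoothProfinite

namespace SmoothProfinite

noncomputable section

set_option linter.unusedSectionVars false

variable {p : ℕ} [Fact p.Prime]

/-! ## The action of `p`-adic integers on `p`-power torsion groups -/

section PadicSmul

/-- The action of `ℤ_p` on a group killed by `p ^ s`. -/
def padicSmul (s : ℕ) {B : Type*} [AddCommGroup B] (a : ℤ_[p]) (x : B) : B :=
  (PadicInt.toZModPow s a).val • x

variable {s : ℕ} {B : Type*} [AddCommGroup B] {x y : B}

theorem padicSmul_eq (hx : p ^ s • x = 0) {a : ℤ_[p]} {n : ℕ}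
    (h : (n : ZMod (p ^ s)) = PadicInt.toZModPow s a) : padicSmul s a x = n • x :=
  GSchemeAction.GStructure.nsmul_eq_of_cast_eq hx (by rw [ZMod.natCast_zmod_val, h])

theorem padicSmul_add (hx : p ^ s • x = 0) (a b : ℤ_[p]) :
    padicSmul s (a + b) x = padicSmul s a x + padicSmul s b x := by
  rw [padicSmul_eq hx (n := (PadicInt.toZModPow s a).val + (PadicInt.toZModPow s b).val) (by
    rw [Nat.cast_add, ZMod.natCast_zmod_val, ZMod.natCast_zmod_val, map_add]), add_nsmul]
  rfl

theorem padicSmul_mul (hx : p ^ s • x = 0) (a b : ℤ_[p]) :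
    padicSmul s (a * b) x = padicSmul s a (padicSmul s b x) := by
  rw [padicSmul_eq hx (n := (PadicInt.toZModPow s a).val * (PadicInt.toZModPow s b).val) (by
    rw [Nat.cast_mul, ZMod.natCast_zmod_val, ZMod.natCast_zmod_val, map_mul]), mul_nsmul']
  rfl

theorem padicSmul_natCast (hx : p ^ s • x = 0) (n : ℕ) : padicSmul s (n : ℤ_[p]) x = n • x :=
  padicSmul_eq hx (by rw [map_natCast])

theorem padicSmul_one (hx : p ^ s • x = 0) : padicSmul s (1 : ℤ_[p]) x = x := by
  rw [← Nat.cast_one, padicSmul_natCast hx, one_nsmul]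

theorem padicSmul_map {B' : Type*} [AddCommGroup B'] (f : B →+ B') (a : ℤ_[p]) (x : B) :
    f (padicSmul s a x) = padicSmul s a (f x) := map_nsmul f _ _

theorem padicSmul_succ (hx : p ^ s • x = 0) (a : ℤ_[p]) :
    padicSmul (s + 1) a x = padicSmul s a x := by
  refine (padicSmul_eq hx ?_).symm
  rw [← PadicInt.cast_toZModPow s (s + 1) (Nat.le_succ s) a, ← ZMod.natCast_val]

theorem padicSmul_one_eq [Module (ZMod p) B] (a : ℤ_[p]) (x : B) :
    padicSmul 1 a x = PadicInt.toZMod a • x := by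
  have h : (((PadicInt.toZModPow 1 a).val : ℕ) : ZMod p) = PadicInt.toZMod a := by
    have h1 : a - ((PadicInt.toZModPow 1 a).val : ℤ_[p]) ∈
        RingHom.ker (PadicInt.toZModPow 1 : ℤ_[p] →+* ZMod (p ^ 1)) := by
      rw [RingHom.mem_ker, map_sub, map_natCast, ZMod.natCast_zmod_val, sub_self]
    rw [PadicInt.ker_toZModPow, pow_one, Ideal.mem_span_singleton] at h1
    obtain ⟨b, hb⟩ := h1
    have h2 := congrArg (PadicInt.toZMod (p := p)) hb
    rw [map_sub, map_natCast, map_mul, map_natCast, CharP.cast_eq_zero (ZMod p) p, zero_mul, sub_eq_zero] at h2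
    exact h2.symm
  rw [← h, Nat.cast_smul_eq_nsmul]
  rfl

theorem continuous_eq_zero_of_toZModPow {G : Type*} [TopologicalSpace G] {c : G → ℤ_[p]}
    (hc : Continuous c) (s : ℕ) : IsOpen {g | PadicInt.toZModPow s (c g) = 0} :=
  (isOpen_discrete ({0} : Set (ZMod (p ^ s)))).preimage ((continuous_toZModPow p s).comp hc)

end PadicSmul

variable {S : Scheme.{u}} {L : S.Modules}

theorem pow_nsmul_wittSections (hS : IsPerfectOfChar p S) {s : ℕ} {U : S.Opens}
    (f : wittSections p L s U) : p ^ s • f = 0 :=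
  pow_p_nsmul_wittLine p hS.char_eq L s U f

theorem eq_zero_of_wittSections_zero {U : S.Opens} (f : wittSections p L 0 U) : f = 0 :=
  wittSections_ext fun _ _ i => i.elim0

/-! ## Global sections of `W(L)` -/

variable (p L) in
/-- The group of global sections of `W(L)`. -/
def wittLim : AddSubgroup (∀ s, wittSections p L s ⊤) where
  carrier := {m | ∀ s, wred L s ⊤ (m (s + 1)) = m s}
  zero_mem' s := map_zero _
  add_mem' {m n} hm hn s := by rw [Pi.add_apply, map_add, hm s, hn s]; rfl
  neg_mem' {m} hm s := by rw [Pi.neg_apply, map_neg, hm s]; rfl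

instance : AddCommGroup (wittLim p L) := AddSubgroup.toAddCommGroup _

instance : AddCommMonoid (wittLim p L) := AddCommGroup.toAddCommMonoid

instance : AddGroup (wittLim p L) := AddCommGroup.toAddGroup

instance : AddMonoid (wittLim p L) := AddCommMonoid.toAddMonoid

instance : AddZeroClass (wittLim p L) := AddMonoid.toAddZeroClass

namespace wittLim

/-- The reduction `W(L) → W_s(L)` on global sections. -/
def pr (s : ℕ) : wittLim p L →+ wittSections p L s ⊤ :=
  (Pi.evalAddMonoidHom _ s).comp (wittLim p L).subtype

theorem wred_pr (m : wittLim p L) (s : ℕ) : wred L s ⊤ (pr (s + 1) m) = pr s m := m.2 s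

theorem ext {m n : wittLim p L} (h : ∀ s, pr s m = pr s n) : m = n := Subtype.ext (funext h)

theorem pr_of_le {m : wittLim p L} {s t : ℕ} (h : s ≤ t) (ht : pr t m = 0) : pr s m = 0 := by
  induction t, h using Nat.le_induction with
  | base => exact ht
  | succ t _ ih => exact ih (by rw [← wred_pr, ht, map_zero])

theorem coeff_zero_pr (m : wittLim p L) (s : ℕ) (V : {V : S.Opens // V ≤ ⊤}) (e : Gen L V.1) :
    ((pr (s + 1) m).1 V e).coeff 0 = ((pr 1 m).1 V e).coeff 0 := by
  induction s with
  | zero => rfl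
  | succ s ih =>
    rw [← ih, ← wred_pr m (s + 1), coeff_wred]
    rfl

variable (hS : IsPerfectOfChar p S)

include hS

/-- Extending the coordinates by zero gives sections at all levels, compatible with reduction. No
cohomological obstruction occurs, because the coordinates themselves are global objects. -/
theorem pr_surjective (s : ℕ) : Function.Surjective (pr (p := p) (L := L) s) := by
  intro f
  choose g hg using exists_extend hS f
  refine ⟨⟨g, fun t => wittSections_ext fun V e i => ?_⟩, wittSections_ext fun V e i => ?_⟩
  · rw [coeff_wred, hg, hg]
    rfl
  · refine (hg s V e i).trans ?_
    rw [dif_pos i.2]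

/-- The vanishing of `p • m` at level `s + 1` gives that of `m` at level `s`, by
`p_nsmul_eq_zero_iff`; all levels are available in the limit. -/
theorem eq_zero_of_p_nsmul {m : wittLim p L} (h : p • m = 0) : m = 0 :=
  ext fun s => by
    rw [← wred_pr, map_zero, ← p_nsmul_eq_zero_iff hS, ← map_nsmul, h, map_zero]

theorem eq_zero_of_pow_nsmul (k : ℕ) {m : wittLim p L} (h : p ^ k • m = 0) : m = 0 := by
  induction k with
  | zero => simpa using h
  | succ k ih => exact ih (eq_zero_of_p_nsmul hS (by rw [← mul_nsmul', ← pow_succ', h]))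

theorem pr_p_nsmul_eq_zero_iff (m : wittLim p L) (s : ℕ) :
    pr (s + 1) (p • m) = 0 ↔ pr s m = 0 := by
  rw [map_nsmul, p_nsmul_eq_zero_iff hS, wred_pr]

/-- At level `s + 1` the quotient by `p` is defined only up to its last coordinate. Its reduction to
level `s` is unique, and these reductions form a compatible system. -/
theorem exists_p_nsmul {m : wittLim p L} (h : pr 1 m = 0) : ∃ n, m = p • n := by
  have h0 : ∀ s V e, ((pr (s + 1) m).1 V e).coeff 0 = 0 := fun s V e => by
    rw [coeff_zero_pr, h]
    exact TruncatedWittVector.coeff_zero p 1 _ _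
  choose y hy using fun s => exists_eq_p_nsmul hS (pr (s + 1) m) (h0 s)
  refine ⟨⟨fun s => wred L s ⊤ (y s), fun s => ?_⟩, ext fun s => ?_⟩
  · have h1 : p • (wred L (s + 1) ⊤ (y (s + 1)) - y s) = 0 := by
      rw [nsmul_sub, ← map_nsmul, ← hy, ← hy, wred_pr, sub_self]
    rw [p_nsmul_eq_zero_iff hS, map_sub, sub_eq_zero] at h1
    exact h1
  · have h1 : pr s m = p • wred L s ⊤ (y s) := by rw [← map_nsmul, ← hy, wred_pr]
    exact h1

theorem pr_pow_nsmul (m : wittLim p L) (k : ℕ) : pr k (p ^ k • m) = 0 := by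
  rw [map_nsmul]
  exact pow_nsmul_wittSections hS _

theorem pr_pow_nsmul_eq_zero_iff (m : wittLim p L) (k s : ℕ) :
    pr (s + k) (p ^ k • m) = 0 ↔ pr s m = 0 := by
  induction k generalizing m with
  | zero => simp
  | succ k ih =>
    rw [pow_succ', mul_nsmul', ← add_assoc, pr_p_nsmul_eq_zero_iff hS, ih]

theorem exists_pow_nsmul (k : ℕ) {m : wittLim p L} (h : pr k m = 0) : ∃ n, m = p ^ k • n := by
  induction k generalizing m with
  | zero => exact ⟨m, by simp⟩
  | succ k ih =>
    obtain ⟨n, rfl⟩ := exists_p_nsmul hS (pr_of_le (by omega) h)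
    rw [pr_p_nsmul_eq_zero_iff hS] at h
    obtain ⟨n, rfl⟩ := ih h
    exact ⟨n, by rw [pow_succ', mul_nsmul']⟩

end wittLim

/-! ## The action of `G` on global sections -/

section Action

variable {G : Type v} [Group G] [TopologicalSpace G] {A : GSchemeAction G S}
  (σ : A.Linearization L) {χ : G →* ℤ_[p]ˣ}

theorem GSchemeAction.top_le_image (A : GSchemeAction G S) (g : G) :
    (⊤ : S.Opens) ≤ A.image g ⊤ := le_rfl

theorem wred_wittAct (s : ℕ) (g : G) {U V : S.Opens} (h : V ≤ A.image g U)
    (f : wittSections p L (s + 1) U) :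
    wred L s V (σ.wittAct p (s + 1) g h f) = σ.wittAct p s g h (wred L s U f) :=
  Subtype.ext (funext fun _ => funext fun _ => truncate_wittMap p (Nat.le_succ s) _ _)

theorem wittTwist_apply (hp : (p : Γ(S, ⊤)) = 0) (hχ : Continuous χ) (s : ℕ) (g : G) {U V : S.Opens}
    (h : V ≤ A.image g U) (f : wittSections p L s U) :
    (σ.wittTwist p hp hχ s).act g h f = padicSmul s (χ g : ℤ_[p]) (σ.wittAct p s g h f) := rfl

theorem wred_wittTwist (hS : IsPerfectOfChar p S) (hχ : Continuous χ) (s : ℕ) (g : G)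
    {U V : S.Opens} (h : V ≤ A.image g U) (f : wittSections p L (s + 1) U) :
    wred L s V ((σ.wittTwist p hS.char_eq hχ (s + 1)).act g h f) =
      (σ.wittTwist p hS.char_eq hχ s).act g h (wred L s U f) := by
  have e2 : wred L s V (padicSmul (s + 1) (χ g : ℤ_[p]) (σ.wittAct p (s + 1) g h f)) =
      padicSmul (s + 1) (χ g : ℤ_[p]) (wred L s V (σ.wittAct p (s + 1) g h f)) :=
    map_nsmul (wred L s V) _ _
  rw [padicSmul_succ (pow_nsmul_wittSections hS _), wred_wittAct] at e2
  exact e2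

variable (hS : IsPerfectOfChar p S) (hχ : Continuous χ)

/-- The action of `G` on the global sections of a sheaf. -/
def topEnd {M : TopCat.Presheaf Ab.{u} S} (τ : A.GStructure M) :
    G →* AddMonoid.End (M.obj (op ⊤)) where
  toFun g := τ.act g (A.top_le_image g)
  map_one' := AddMonoidHom.ext fun x => (τ.act_one _ le_rfl x).trans
    (congrArg (fun k : M.obj (op ⊤) ⟶ M.obj (op ⊤) => k x) (M.map_id _))
  map_mul' g h := AddMonoidHom.ext fun x => (τ.act_mul g h _ _ _ x).symm

/-- The action of `G` on the global sections of `W(L)(1)`. -/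
def limAct : G →* AddMonoid.End (wittLim p L) where
  toFun g :=
    { toFun := fun m => ⟨fun s => (σ.wittTwist p hS.char_eq hχ s).act g (A.top_le_image g) (m.1 s),
        fun s => (wred_wittTwist σ hS hχ s g _ _).trans (congrArg _ (m.2 s))⟩
      map_zero' := Subtype.ext (funext fun s => map_zero _)
      map_add' := fun m n => Subtype.ext (funext fun s => map_add _ _ _) }
  map_one' := AddMonoidHom.ext fun m => wittLim.ext fun s =>
    congrArg (fun k : AddMonoid.End (wittSections p L s ⊤) => k (m.1 s))
      (map_one (topEnd (σ.wittTwist p hS.char_eq hχ s)))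
  map_mul' g h := AddMonoidHom.ext fun m => wittLim.ext fun s =>
    congrArg (fun k : AddMonoid.End (wittSections p L s ⊤) => k (m.1 s))
      (map_mul (topEnd (σ.wittTwist p hS.char_eq hχ s)) g h)

/-- The Teichmüller lift of global sections of `L`. -/
def teichSection (s : ℕ) (f : wittSections p L 1 ⊤) : wittSections p L s ⊤ :=
  ⟨fun V e => wittTeich p s ((f.1 V e).coeff 0), fun V V' h e => by
      beta_reduce
      rw [coeff_res_section f V V' h e, wittMap_wittTeich],
    fun V e e' a h => by
      beta_reduce
      rw [coeff_smul_section hS f V e e' a h, Fin.val_zero, pow_zero, pow_one, wittTeich, map_mul,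
        map_mul]
      rfl⟩

theorem wred_teichSection (s : ℕ) (f : wittSections p L 1 ⊤) :
    wred L s ⊤ (teichSection hS (s + 1) f) = teichSection hS s f :=
  Subtype.ext (funext fun _ => funext fun _ => truncate_wittTeich p (Nat.le_succ s) _)

theorem teichSection_one (f : wittSections p L 1 ⊤) : teichSection hS 1 f = f := by
  refine wittSections_ext fun V e i => ?_
  obtain rfl : i = 0 := Subsingleton.elim _ _
  change (WittVector.truncate 1 (WittVector.teichmuller p _)).coeff 0 = _
  rw [WittVector.coeff_truncate]
  exact WittVector.teichmuller_coeff_zero p _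

theorem wittAct_teichSection (s : ℕ) (g : G) (f : wittSections p L 1 ⊤) :
    σ.wittAct p s g (A.top_le_image g) (teichSection hS s f) =
      teichSection hS s (σ.wittAct p 1 g (A.top_le_image g) f) := by
  refine Subtype.ext (funext fun V => funext fun e => ?_)
  change wittMap p s _ (wittTeich p s _) = wittTeich p s ((wittMap p 1 _ _).coeff 0)
  rw [wittMap_wittTeich, coeff_wittMap]

end Action

end

end SmoothProfinite

/-! ### From algebras to sections of a line bundle: removing the Frobenius -/

namespace SmoothProfinite

noncomputable section

set_option linter.unusedSectionVars false

variable {p : ℕ} [Fact p.Prime]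

/-- The module `M` sits in the algebra through `i`, and `b k` undoes the Frobenius power on its
image. Applying `b k` to basis elements turns the lift of `x ^ p ^ k` in `𝔽_p[A]` into a lift of `x`
in `𝔽_p[M]`. -/
theorem exists_permRep_lift_of_isPGroup {Γ : Type v} [Group Γ] [Finite Γ] (hΓ : IsPGroup p Γ)
    {A : Type u} [CommRing A] [Algebra (ZMod p) A] {M : Type*} [AddCommGroup M] [Module (ZMod p) M]
    (ρA : Γ →* (A →+* A)) (ρ : Γ →* AddMonoid.End M) (i : M →+ A)
    (hi : ∀ g m, i (ρ g m) = ρA g (i m)) (b : ℕ → A →+ M) (hb : ∀ k g a, b k (ρA g a) = ρ g (b k a))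
    (hbi : ∀ k m, b k (i m ^ p ^ k) = m) {x : Γ → M} (hx : IsCocycle ρ x) :
    ∃ c : Γ → M →₀ ZMod p, IsCocycle (permRep (ZMod p) ρ) c ∧ ∀ g, permSum p (c g) = x g := by
  obtain ⟨k, c, hc, hcx⟩ := FrobLiftable.of_isPGroup hΓ (hx.comp (ρ' := ringEnd ρA) i hi)
  refine ⟨fun g => Finsupp.mapDomain (b k) (c g),
    hc.comp (Finsupp.mapDomain.addMonoidHom (b k)) fun g a => ?_, fun g => ?_⟩
  · change Finsupp.mapDomain (b k) (Finsupp.mapDomain _ a) =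
      Finsupp.mapDomain (ρ g) (Finsupp.mapDomain (b k) a)
    rw [← Finsupp.mapDomain_comp, ← Finsupp.mapDomain_comp]
    congr 1
    exact funext (hb k g)
  · rw [permSum_mapDomain p (b k), hcx, hbi]

theorem coeff_zero_add_of_length_one {R : Type*} [CommRing R] (x y : TruncatedWittVector p 1 R) :
    (x + y).coeff 0 = x.coeff 0 + y.coeff 0 := by
  obtain ⟨x, rfl⟩ := WittVector.truncate_surjective p 1 _ x
  obtain ⟨y, rfl⟩ := WittVector.truncate_surjective p 1 _ y
  rw [← map_add, WittVector.coeff_truncate, WittVector.coeff_truncate, WittVector.coeff_truncate,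
    Fin.val_zero, WittVector.add_coeff_zero]

variable {S : Scheme.{u}} {L : S.Modules}

/-! ## The graded ring of sections of powers of a line bundle -/

variable (L) in
/-- The ring of formal series `∑ fₙ`, where `fₙ` is a global section of the `n`-th power of `L`. -/
def gradedSections : Subring (∀ V : S.Opens, Gen L V → PowerSeries Γ(S, V)) where
  carrier := {F | (∀ (V V' : S.Opens) (h : V' ≤ V) (e : Gen L V),
      F V' (e.res h) = PowerSeries.map (fres h) (F V e)) ∧
    -- Rescaling by `a` multiplies the coefficient of degree `n` by `a ^ n`, as a change of
    -- generator does for the `n`-th power of `L`.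
    ∀ (V : S.Opens) (e e' : Gen L V) (a : Γ(S, V)), e'.1 = a • e.1 →
      F V e = PowerSeries.rescale a (F V e')}
  zero_mem' := ⟨fun V V' h e => (map_zero _).symm, fun V e e' a h => (map_zero _).symm⟩
  one_mem' := ⟨fun V V' h e => (map_one _).symm, fun V e e' a h => (map_one _).symm⟩
  add_mem' := fun {F F'} hF hF' => ⟨fun V V' h e => by
      simp only [Pi.add_apply, map_add, hF.1 V V' h e, hF'.1 V V' h e],
    fun V e e' a h => by simp only [Pi.add_apply, map_add, ← hF.2 V e e' a h, ← hF'.2 V e e' a h]⟩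
  mul_mem' := fun {F F'} hF hF' => ⟨fun V V' h e => by
      simp only [Pi.mul_apply, map_mul, hF.1 V V' h e, hF'.1 V V' h e],
    fun V e e' a h => by simp only [Pi.mul_apply, map_mul, ← hF.2 V e e' a h, ← hF'.2 V e e' a h]⟩
  neg_mem' := fun {F} hF => ⟨fun V V' h e => by simp only [Pi.neg_apply, map_neg, hF.1 V V' h e],
    fun V e e' a h => by simp only [Pi.neg_apply, map_neg, ← hF.2 V e e' a h]⟩

namespace gradedSections

theorem ext {F F' : gradedSections L} (h : ∀ V e, F.1 V e = F'.1 V e) : F = F' :=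
  Subtype.ext (funext fun V => funext fun e => h V e)

theorem natCast_eq_zero (hS : IsPerfectOfChar p S) : (p : gradedSections L) = 0 :=
  ext fun V e => by
    change (p : PowerSeries Γ(S, V)) = 0
    rw [← map_natCast PowerSeries.C, hS.natCast_eq_zero, map_zero]

/-- The algebra structure over `𝔽_p`. -/
abbrev algebra (hS : IsPerfectOfChar p S) : Algebra (ZMod p) (gradedSections L) :=
  haveI := ringChar.charP (gradedSections L)
  ZMod.algebra' (gradedSections L) (ringChar (gradedSections L))
    (ringChar.dvd (natCast_eq_zero hS))

section Action

variable {G : Type v} [Group G] [TopologicalSpace G] {A : GSchemeAction G S}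
  (σ : A.Linearization L)

/-- The action of an element of `G` on the graded ring. -/
def act (g : G) : gradedSections L →+* gradedSections L where
  toFun F := ⟨fun V e => PowerSeries.map (A.ringAct g (A.le_image_image_inv g V))
      (F.1 (A.image g⁻¹ V) (σ.genAct g⁻¹ le_rfl e)),
    fun V V' h e => by
      beta_reduce
      rw [σ.genAct_res g⁻¹ le_rfl h (A.image_mono g⁻¹ h),
        ← σ.res_genAct g⁻¹ le_rfl (A.image_mono g⁻¹ h), F.2.1 _ _ (A.image_mono g⁻¹ h)]
      ext n
      simp only [PowerSeries.coeff_map]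
      exact (GSchemeAction.ringAct_res g _ _ (h.trans (A.le_image_image_inv g V)) _).trans
        (GSchemeAction.res_ringAct g _ h _).symm,
    fun V e e' a he => by
      beta_reduce
      rw [F.2.2 (A.image g⁻¹ V) _ (σ.genAct g⁻¹ le_rfl e') (A.ringAct g⁻¹ le_rfl a) (by
          change σ.act g⁻¹ _ e'.1 = _ • σ.act g⁻¹ _ e.1
          rw [he, σ.act_smul])]
      ext n
      have h1 : A.ringAct g (A.le_image_image_inv g V) (A.ringAct g⁻¹ le_rfl a) = a := by
        rw [A.ringAct_mul g g⁻¹ _ _ (by rw [mul_inv_cancel, A.image_one]),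
          A.ringAct_of_mem_ker (by rw [mul_inv_cancel]; exact one_mem _) _ le_rfl]
        exact congrArg (fun k : Γ(S, V) ⟶ Γ(S, V) => k a) (S.presheaf.map_id _)
      rw [PowerSeries.coeff_map, PowerSeries.coeff_rescale, PowerSeries.coeff_rescale, map_mul,
        map_pow, h1, PowerSeries.coeff_map]⟩
  map_one' := ext fun V e => map_one _
  map_zero' := ext fun V e => map_zero _
  map_add' F F' := ext fun V e => map_add _ _ _
  map_mul' F F' := ext fun V e => map_mul _ _ _

theorem coeff_act (g : G) (F : gradedSections L) (V : S.Opens) (e : Gen L V) (n : ℕ) :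
    PowerSeries.coeff n ((act σ g F).1 V e) = A.ringAct g (A.le_image_image_inv g V)
      (PowerSeries.coeff n (F.1 (A.image g⁻¹ V) (σ.genAct g⁻¹ le_rfl e))) :=
  PowerSeries.coeff_map _ _ _

theorem act_of_trivial {g : G} (hg : g ∈ A.toAut.ker)
    (hact : ∀ {U V : S.Opens} (h : V ≤ A.image g⁻¹ U) (h' : V ≤ U) (x : Γ(L, U)),
      σ.act g⁻¹ h x = L.presheaf.map (homOfLE h').op x) : act σ g = RingHom.id _ := by
  refine RingHom.ext fun F => ext fun V e => ?_
  have hW : A.image g⁻¹ V ≤ V := (A.image_eq_of_mem_ker (inv_mem hg) V).le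
  have he : σ.genAct g⁻¹ le_rfl e = e.res hW := Subtype.ext (hact le_rfl hW e.1)
  ext n
  rw [coeff_act, he, F.2.1 V _ hW, PowerSeries.coeff_map]
  refine ((GSchemeAction.ringAct_res (A := A) g (A.le_image_image_inv g V) hW
    (A.image_eq_of_mem_ker hg V).ge _).trans (A.ringAct_of_mem_ker hg _ le_rfl _)).trans ?_
  exact congrArg (fun k : Γ(S, V) ⟶ Γ(S, V) => k (PowerSeries.coeff n (F.1 V e)))
    (S.presheaf.map_id _)

theorem act_act (g g' : G) (F : gradedSections L) : act σ g (act σ g' F) = act σ (g * g') F := by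
  refine ext fun X e => ?_
  ext n
  have h₁ : A.image g'⁻¹ (A.image g⁻¹ X) ≤ A.image (g * g')⁻¹ X := by
    rw [← A.image_mul, mul_inv_rev]
  have he : σ.genAct g'⁻¹ le_rfl (σ.genAct g⁻¹ le_rfl e) =
      (σ.genAct (g * g')⁻¹ le_rfl e).res h₁ := by
    rw [σ.res_genAct, σ.genAct_genAct g'⁻¹ g⁻¹ _ _ (by rw [A.image_mul])]
    exact σ.genAct_congr (mul_inv_rev g g').symm _ _ e
  rw [coeff_act, coeff_act, coeff_act, he, F.2.1 _ _ h₁, PowerSeries.coeff_map]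
  have e₁ := GSchemeAction.ringAct_res (A := A) g' (A.le_image_image_inv g' (A.image g⁻¹ X)) h₁
    ((A.le_image_image_inv g' _).trans (A.image_mono g' h₁))
    (PowerSeries.coeff n (F.1 _ (σ.genAct (g * g')⁻¹ le_rfl e)))
  refine (congrArg (A.ringAct g (A.le_image_image_inv g X)) e₁).trans ?_
  exact A.ringAct_mul g g' _ _ _ _

/-- The action of `G` on the graded ring. -/
def actHom : G →* (gradedSections L →+* gradedSections L) where
  toFun := act σ
  map_one' := act_of_trivial σ (one_mem _) fun {U V} h h' x => by
    rw [σ.act_congr inv_one h (h'.trans (A.image_one U).ge), σ.act_one _ h']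
  map_mul' g h := RingHom.ext fun F => (act_act σ g h F).symm

end Action

/-- The inclusion of the part of degree one. -/
def ofWitt (hS : IsPerfectOfChar p S) : wittSections p L 1 ⊤ →+ gradedSections L where
  toFun f := ⟨fun V e => PowerSeries.monomial 1 ((f.1 ⟨V, le_top⟩ e).coeff 0),
    fun V V' h e => by
      beta_reduce
      rw [coeff_res_section f ⟨V, le_top⟩ ⟨V', le_top⟩ h e]
      ext n
      rw [PowerSeries.coeff_map, PowerSeries.coeff_monomial, PowerSeries.coeff_monomial, apply_ite (fres h), map_zero],
    fun V e e' a h => by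
      beta_reduce
      rw [coeff_smul_section hS f ⟨V, le_top⟩ e e' a h]
      ext n
      rw [PowerSeries.coeff_rescale, PowerSeries.coeff_monomial, PowerSeries.coeff_monomial]
      split_ifs with hn
      · rw [hn, Fin.val_zero, pow_zero]
      · rw [mul_zero]⟩
  map_zero' := ext fun V e => by
    change PowerSeries.monomial 1 ((0 : TruncatedWittVector p 1 Γ(S, V)).coeff 0) = 0
    rw [TruncatedWittVector.coeff_zero, map_zero]
  map_add' f f' := ext fun V e => by
    have h : ((f + f').1 ⟨V, le_top⟩ e).coeff 0 =
        (f.1 ⟨V, le_top⟩ e).coeff 0 + (f'.1 ⟨V, le_top⟩ e).coeff 0 :=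
      coeff_zero_add_of_length_one _ _
    change PowerSeries.monomial 1 (((f + f').1 ⟨V, le_top⟩ e).coeff 0) =
      PowerSeries.monomial 1 _ + PowerSeries.monomial 1 _
    rw [h, map_add]

theorem ofWitt_apply (hS : IsPerfectOfChar p S) (f : wittSections p L 1 ⊤) (V : S.Opens) (e : Gen L V) :
    (ofWitt hS f).1 V e = PowerSeries.monomial 1 ((f.1 ⟨V, le_top⟩ e).coeff 0) := rfl


theorem exists_pow_eq (hS : IsPerfectOfChar p S) (k : ℕ) (V : S.Opens) (a : Γ(S, V)) :
    ∃ b : Γ(S, V), b ^ p ^ k = a := by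
  induction k generalizing a with
  | zero => exact ⟨a, by simp⟩
  | succ k ih =>
    obtain ⟨b, hb⟩ := ih (hS.root V a)
    exact ⟨b, by rw [pow_succ, pow_mul, hb, hS.root_pow]⟩

theorem pow_pow_add (hS : IsPerfectOfChar p S) (k : ℕ) {V : S.Opens} (x y : Γ(S, V)) :
    (x + y) ^ p ^ k = x ^ p ^ k + y ^ p ^ k := by
  cases subsingleton_or_nontrivial Γ(S, V) with
  | inl h => exact Subsingleton.elim _ _
  | inr h =>
    have : CharP Γ(S, V) p :=
      (CharP.charP_iff_prime_eq_zero (Fact.out : p.Prime)).2 (hS.natCast_eq_zero V)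
    exact add_pow_char_pow x y p k

/-- The `p ^ k`-th root of the coefficient of degree `p ^ k`. -/
def rootCoeff (hS : IsPerfectOfChar p S) (k : ℕ) (F : gradedSections L) (V : S.Opens) (e : Gen L V) :
    Γ(S, V) :=
  (exists_pow_eq hS k V (PowerSeries.coeff (p ^ k) (F.1 V e))).choose

theorem rootCoeff_pow (hS : IsPerfectOfChar p S) (k : ℕ) (F : gradedSections L) (V : S.Opens)
    (e : Gen L V) : rootCoeff hS k F V e ^ p ^ k = PowerSeries.coeff (p ^ k) (F.1 V e) :=
  (exists_pow_eq hS k V (PowerSeries.coeff (p ^ k) (F.1 V e))).choose_spec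

/-- The section of `L` which is the `p ^ k`-th root of the part of degree `p ^ k`. -/
def rootSection (hS : IsPerfectOfChar p S) (k : ℕ) (F : gradedSections L) : wittSections p L 1 ⊤ :=
  wittOfCoeff hS (fun V e _ => rootCoeff hS k F V.1 e)
    (fun V V' h e i => hS.pow_pow_inj k (by
      rw [← map_pow, rootCoeff_pow, rootCoeff_pow, F.2.1 V.1 V'.1 h e, PowerSeries.coeff_map]))
    (fun V e e' a i h => hS.pow_pow_inj k (by
      rw [mul_pow, rootCoeff_pow, rootCoeff_pow, F.2.2 V.1 e e' a h, PowerSeries.coeff_rescale,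
        Fin.val_eq_zero i, pow_zero, pow_one]))

theorem coeff_rootSection_pow (hS : IsPerfectOfChar p S) (k : ℕ) (F : gradedSections L)
    (V : {V : S.Opens // V ≤ ⊤}) (e : Gen L V.1) :
    ((rootSection hS k F).1 V e).coeff 0 ^ p ^ k = PowerSeries.coeff (p ^ k) (F.1 V.1 e) :=
  (congrArg (fun z : Γ(S, V.1) => z ^ p ^ k) (coeff_wittOfCoeff hS _ _ _ V e 0)).trans
    (rootCoeff_pow hS k F V.1 e)

theorem ext_toWitt (hS : IsPerfectOfChar p S) (k : ℕ) {f f' : wittSections p L 1 ⊤}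
    (h : ∀ V e, (f.1 V e).coeff 0 ^ p ^ k = (f'.1 V e).coeff 0 ^ p ^ k) : f = f' :=
  wittSections_ext fun V e i => by
    obtain rfl : i = 0 := Subsingleton.elim _ _
    exact hS.pow_pow_inj k (h V e)

/-- The `p ^ k`-th root of the part of degree `p ^ k`. -/
def toWitt (hS : IsPerfectOfChar p S) (k : ℕ) : gradedSections L →+ wittSections p L 1 ⊤ :=
  AddMonoidHom.mk' (rootSection hS k) fun F F' => ext_toWitt hS k fun V e => by
    refine Eq.trans ?_ (congrArg (fun z : Γ(S, V.1) => z ^ p ^ k)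
      (coeff_zero_add_of_length_one _ _).symm)
    rw [pow_pow_add hS, coeff_rootSection_pow, coeff_rootSection_pow, coeff_rootSection_pow]
    exact map_add _ _ _

theorem coeff_toWitt_pow (hS : IsPerfectOfChar p S) (k : ℕ) (F : gradedSections L)
    (V : {V : S.Opens // V ≤ ⊤}) (e : Gen L V.1) :
    ((toWitt hS k F).1 V e).coeff 0 ^ p ^ k = PowerSeries.coeff (p ^ k) (F.1 V.1 e) :=
  coeff_rootSection_pow hS k F V e

theorem toWitt_ofWitt_pow (hS : IsPerfectOfChar p S) (k : ℕ) (f : wittSections p L 1 ⊤) :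
    toWitt hS k (ofWitt hS f ^ p ^ k) = f := by
  refine ext_toWitt hS k fun V e => ?_
  rw [coeff_toWitt_pow]
  change PowerSeries.coeff (p ^ k) (PowerSeries.monomial 1 ((f.1 V e).coeff 0) ^ p ^ k) = _
  rw [PowerSeries.monomial_pow, mul_one, PowerSeries.coeff_monomial_same]

variable {G : Type v} [Group G] [TopologicalSpace G] {A : GSchemeAction G S}
  (σ : A.Linearization L)

theorem coeff_wittAct (s : ℕ) (g : G) {U U' : S.Opens} (h : U' ≤ A.image g U)
    (f : wittSections p L s U) (V : {V : S.Opens // V ≤ U'}) (e : Gen L V.1) (i : Fin s) :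
    ((σ.wittAct p s g h f).1 V e).coeff i = A.ringAct g (A.le_image_image_inv g V.1)
      ((f.1 ⟨A.image g⁻¹ V.1, A.le_image_of_inv_le h V.1 V.2⟩ (σ.genAct g⁻¹ le_rfl e)).coeff i) :=
  coeff_wittMap p _ _ _ _

theorem ofWitt_wittAct (hS : IsPerfectOfChar p S) (g : G) (f : wittSections p L 1 ⊤) :
    ofWitt hS (σ.wittAct p 1 g (A.top_le_image g) f) = act σ g (ofWitt hS f) := by
  refine ext fun V e => ?_
  ext n
  rw [coeff_act, ofWitt_apply, ofWitt_apply, PowerSeries.coeff_monomial, PowerSeries.coeff_monomial,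
    coeff_wittAct, apply_ite (A.ringAct g _), map_zero]

theorem toWitt_act (hS : IsPerfectOfChar p S) (k : ℕ) (g : G) (F : gradedSections L) :
    toWitt hS k (act σ g F) = σ.wittAct p 1 g (A.top_le_image g) (toWitt hS k F) := by
  refine ext_toWitt hS k fun V e => ?_
  rw [coeff_toWitt_pow, coeff_act, coeff_wittAct, ← map_pow, coeff_toWitt_pow]

end gradedSections

end

end SmoothProfinite

namespace SmoothProfinite

noncomputable section

set_option linter.unusedSectionVars false

variable {p : ℕ} [Fact p.Prime] {S : Scheme.{u}} {L : S.Modules}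

/-! ## Lifting cocycles with values in `W_k(L)(1)` -/

theorem exists_open_normal_le {G : Type v} [Group G] [TopologicalSpace G] [IsTopologicalGroup G]
    [CompactSpace G] [TotallyDisconnectedSpace G] {U : Set G} (hU : IsOpen U) (h1 : (1 : G) ∈ U) :
    ∃ N : Subgroup G, N.Normal ∧ IsOpen (N : Set G) ∧ (N : Set G) ⊆ U := by
  obtain ⟨N, hN⟩ := ProfiniteGrp.exist_openNormalSubgroup_sub_open_nhds_of_one hU h1
  exact ⟨N.toSubgroup, N.isNormal', N.isOpen', hN⟩

variable {G : Type v} [Group G] [TopologicalSpace G] {A : GSchemeAction G S}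
  (σ : A.Linearization L) {χ : G →* ℤ_[p]ˣ}

variable (p) in
/-- The action of `G` on the global sections of `W_s(L)`. -/
def wittEnd (s : ℕ) : G →* AddMonoid.End (wittSections p L s ⊤) := topEnd (σ.wittGStructure p s)

theorem wittEnd_one_apply (s : ℕ) (f : wittSections p L s ⊤) : wittEnd p σ s 1 f = f :=
  congrArg (fun k : AddMonoid.End (wittSections p L s ⊤) => k f) (map_one (wittEnd p σ s))

theorem wittEnd_mul_apply (s : ℕ) (g h : G) (f : wittSections p L s ⊤) :
    wittEnd p σ s (g * h) f = wittEnd p σ s g (wittEnd p σ s h f) :=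
  congrArg (fun k : AddMonoid.End (wittSections p L s ⊤) => k f) (map_mul (wittEnd p σ s) g h)

theorem wittEnd_inv_apply (s : ℕ) (g : G) (f : wittSections p L s ⊤) :
    wittEnd p σ s g (wittEnd p σ s g⁻¹ f) = f := by
  rw [← wittEnd_mul_apply, mul_inv_cancel, wittEnd_one_apply]

theorem wittEnd_apply_inv (s : ℕ) (g : G) (f : wittSections p L s ⊤) :
    wittEnd p σ s g⁻¹ (wittEnd p σ s g f) = f := by
  have := wittEnd_inv_apply σ s g⁻¹ f
  rwa [inv_inv] at this

/-- The action of `G` on the global sections of `W_s(L)(1)`. -/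
def wittTwistEnd (hS : IsPerfectOfChar p S) (hχ : Continuous χ) (s : ℕ) :
    G →* AddMonoid.End (wittSections p L s ⊤) := topEnd (σ.wittTwist p hS.char_eq hχ s)

theorem wittTwistEnd_apply (hS : IsPerfectOfChar p S) (hχ : Continuous χ) (s : ℕ) (g : G)
    (f : wittSections p L s ⊤) :
    wittTwistEnd σ hS hχ s g f = padicSmul s (χ g : ℤ_[p]) (wittEnd p σ s g f) := rfl

theorem wittEnd_of_trivial {s : ℕ} {g : G} (hg : g ∈ A.toAut.ker)
    (hact : ∀ {U V : S.Opens} (h : V ≤ A.image g⁻¹ U) (h' : V ≤ U) (x : Γ(L, U)),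
      σ.act g⁻¹ h x = L.presheaf.map (homOfLE h').op x) (f : wittSections p L s ⊤) :
    wittEnd p σ s g f = f :=
  σ.wittAct_of_trivial p s hg hact (A.top_le_image g) le_rfl f

theorem pr_limAct_eq (hS : IsPerfectOfChar p S) (hχ : Continuous χ) (g : G) (m : wittLim p L)
    (s : ℕ) : wittLim.pr s (limAct σ hS hχ g m) = wittTwistEnd σ hS hχ s g (wittLim.pr s m) := rfl

theorem wittEnd_teichSection (hS : IsPerfectOfChar p S) (s : ℕ) (g : G)
    (f : wittSections p L 1 ⊤) :
    wittEnd p σ s g (teichSection hS s f) = teichSection hS s (wittEnd p σ 1 g f) :=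
  wittAct_teichSection σ hS s g f

namespace wittLim

theorem pr_zero (s : ℕ) : pr s (0 : wittLim p L) = 0 := rfl

theorem pr_add (s : ℕ) (m n : wittLim p L) : pr s (m + n) = pr s m + pr s n := rfl

theorem pr_sub (s : ℕ) (m n : wittLim p L) : pr s (m - n) = pr s m - pr s n := rfl

theorem pr_neg (s : ℕ) (m : wittLim p L) : pr s (-m) = -pr s m := rfl

theorem pr_nsmul (s k : ℕ) (m : wittLim p L) : pr s (k • m) = k • pr s m := rfl

end wittLim

/-- Finite sums of multiples of Teichmüller representatives. -/
def teichSum (hS : IsPerfectOfChar p S) (T : Finset (wittSections p L 1 ⊤))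
    (d : wittSections p L 1 ⊤ → ℤ_[p]) : wittLim p L :=
  ⟨fun s => ∑ f ∈ T, padicSmul s (d f) (teichSection hS s f), fun s => by
    beta_reduce
    refine (map_sum (wred (p := p) L s ⊤) _ T).trans (Finset.sum_congr rfl fun f _ => ?_)
    have e := padicSmul_map (wred (p := p) L s ⊤) (s := s + 1) (d f) (teichSection hS (s + 1) f)
    rw [wred_teichSection, padicSmul_succ (pow_nsmul_wittSections hS _)] at e
    exact e⟩

theorem pr_teichSum (hS : IsPerfectOfChar p S) (T : Finset (wittSections p L 1 ⊤))
    (d : wittSections p L 1 ⊤ → ℤ_[p]) (s : ℕ) :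
    wittLim.pr s (teichSum hS T d) = ∑ f ∈ T, padicSmul s (d f) (teichSection hS s f) := rfl

/-- The Teichmüller map sends `ℤ_p[V](1)` equivariantly to `W(L)(1)`, where `V` is the group of
global sections of `L`; the cocycle `d` is pushed forward along it. Only the coefficients on `T` are
kept: as `T` is stable under `G`, they still form a cocycle, and their sums are finite. -/
theorem exists_teich_cocycle [IsTopologicalGroup G] [CompactSpace G] [TotallyDisconnectedSpace G]
    (hS : IsPerfectOfChar p S) (hχ : Continuous χ)
    (T : Finset (wittSections p L 1 ⊤))
    (hT : ∀ g, ∀ f ∈ T, wittEnd p σ 1 g f ∈ T)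
    (d : G → wittSections p L 1 ⊤ → ℤ_[p]) (hd : ∀ f, Continuous fun g => d g f)
    (hd' : ∀ g h f, d (g * h) f =
      d g f + (χ g : ℤ_[p]) * d h (wittEnd p σ 1 g⁻¹ f)) :
    ∃ β : G → wittLim p L, IsCocycle (Γ := G) (M := wittLim p L) (limAct σ hS hχ) β ∧
      (∀ g, wittLim.pr 1 (β g) = ∑ f ∈ T, padicSmul 1 (d g f) f) ∧
      ∀ s, ∃ N : Subgroup G, IsOpen (N : Set G) ∧ ∀ g ∈ N, wittLim.pr s (β g) = 0 := by
  classical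
  have hpr : ∀ s (x : wittSections p L s ⊤), p ^ s • x = 0 := fun s x => pow_nsmul_wittSections hS x
  refine ⟨fun g => teichSum hS T (d g), fun g h => wittLim.ext fun s => ?_, fun g => ?_, fun s => ?_⟩
  · rw [wittLim.pr_add, pr_limAct_eq, pr_teichSum, pr_teichSum, pr_teichSum]
    have e1 : wittTwistEnd σ hS hχ s g (∑ f ∈ T, padicSmul s (d h f) (teichSection hS s f)) =
        ∑ f ∈ T, padicSmul s (χ g : ℤ_[p]) (padicSmul s (d h f)
          (teichSection hS s (wittEnd p σ 1 g f))) := by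
      rw [map_sum]
      refine Finset.sum_congr rfl fun f _ => ?_
      rw [wittTwistEnd_apply, ← wittEnd_teichSection]
      exact congrArg _ (padicSmul_map (wittEnd p σ s g : _ →+ _) _ _)
    have e2 : ∑ f ∈ T, padicSmul s (χ g : ℤ_[p]) (padicSmul s (d h f)
          (teichSection hS s (wittEnd p σ 1 g f))) =
        ∑ f ∈ T, padicSmul s (χ g : ℤ_[p]) (padicSmul s (d h (wittEnd p σ 1 g⁻¹ f))
          (teichSection hS s f)) :=
      Finset.sum_nbij' (wittEnd p σ 1 g) (wittEnd p σ 1 g⁻¹) (fun f hf => hT _ f hf)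
        (fun f hf => hT _ f hf) (fun f _ => wittEnd_apply_inv σ 1 g f)
        (fun f _ => wittEnd_inv_apply σ 1 g f) (fun f _ => by rw [wittEnd_apply_inv])
    rw [e1, e2, ← Finset.sum_add_distrib]
    refine Finset.sum_congr rfl fun f _ => ?_
    rw [hd', padicSmul_add (hpr _ _), padicSmul_mul (hpr _ _)]
  · rw [pr_teichSum]
    exact Finset.sum_congr rfl fun f _ => by rw [teichSection_one]
  -- At level `s` only the finitely many coefficients modulo `p ^ s` matter. They vanish at `1` and
  -- are locally constant, so they vanish on an open subgroup.
  · have ho : IsOpen (⋂ f ∈ T, {g | PadicInt.toZModPow s (d g f) = 0}) :=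
      isOpen_biInter_finset fun f _ => continuous_eq_zero_of_toZModPow (hd f) s
    obtain ⟨N, -, hN, hN'⟩ := exists_open_normal_le ho (by
      refine Set.mem_iInter₂.2 fun f _ => ?_
      have h1 := hd' 1 1 f
      rw [inv_one, wittEnd_one_apply, mul_one, MonoidHom.map_one, Units.val_one, one_mul,
        left_eq_add] at h1
      change PadicInt.toZModPow s (d 1 f) = 0
      rw [h1, RingHom.map_zero])
    refine ⟨N, hN, fun g hg => ?_⟩
    rw [pr_teichSum]
    refine Finset.sum_eq_zero fun f hf => ?_
    have h0 : PadicInt.toZModPow s (d g f) = 0 := Set.mem_iInter₂.1 (hN' hg) f hf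
    rw [padicSmul, h0, ZMod.val_zero, zero_nsmul]

theorem wittSections_p_nsmul (hS : IsPerfectOfChar p S) (f : wittSections p L 1 ⊤) : p • f = 0 := by
  have := pow_nsmul_wittSections hS f
  rwa [pow_one] at this

/-- The cocycle factors through a finite quotient of `G`, where it lifts to the twisted permutation
module over `𝔽_p`; the functions `c g` are the coefficients of this lift. -/
theorem exists_perm_cocycle [IsTopologicalGroup G] [CompactSpace G] [TotallyDisconnectedSpace G]
    [Module (ZMod p) (wittSections p L 1 ⊤)]
    (hS : IsPerfectOfChar p S) (hχ : Continuous χ) {x : G → wittSections p L 1 ⊤}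
    (hx : IsCocycle (wittTwistEnd σ hS hχ 1) x)
    (hx0 : ∃ N : Subgroup G, IsOpen (N : Set G) ∧ ∀ g ∈ N, x g = 0) :
    ∃ (T : Finset (wittSections p L 1 ⊤)) (c : G → wittSections p L 1 ⊤ → ZMod p),
      (∀ g, ∀ f ∈ T, wittEnd p σ 1 g f ∈ T) ∧
      (∀ f, Continuous fun g => c g f) ∧
      (∀ g h f, c (g * h) f = c g f + PadicInt.toZMod (χ g : ℤ_[p]) *
        c h (wittEnd p σ 1 g⁻¹ f)) ∧
      (∀ g, ∑ f ∈ T, c g f • f = x g) := by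
  classical
  let ω : G →* (ZMod p)ˣ := (Units.map (PadicInt.toZMod (p := p)).toMonoidHom).comp χ
  let ρ : G →* AddMonoid.End (wittSections p L 1 ⊤) := wittEnd p σ 1
  have hρ : ∀ g f, wittTwistEnd σ hS hχ 1 g f = (ω g : ZMod p) • ρ g f :=
    fun g f => padicSmul_one_eq _ _
  obtain ⟨N₀, hN₀, hN₀', hact⟩ := σ.exists_open
  obtain ⟨N₁, hN₁, hx1⟩ := hx0
  have hω : IsOpen (ω.ker : Set G) := by
    have hc : Continuous fun g : G => PadicInt.toZMod (χ g : ℤ_[p]) :=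
      (continuous_toZMod p).comp (Units.continuous_val.comp hχ)
    convert (isOpen_discrete ({1} : Set (ZMod p))).preimage hc using 1
    ext g
    simp [ω, MonoidHom.mem_ker, Units.ext_iff]
  -- `N` acts trivially on `S` and `L`, kills `x` and has trivial character modulo `p`, so that all
  -- data descend to `G ⧸ N`.
  obtain ⟨N, hNn, hN, hN'⟩ := exists_open_normal_le ((hN₀.inter hN₁).inter hω)
    ⟨⟨one_mem N₀, one_mem N₁⟩, one_mem ω.ker⟩
  have hρN : N ≤ ρ.ker := fun g hg => by
    exact AddMonoidHom.ext fun f => wittEnd_of_trivial σ (hN₀' (hN' hg).1.1) (fun h h' x =>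
      hact g⁻¹ (inv_mem (hN' hg).1.1) h h' x) f
  have hρAN : N ≤ (gradedSections.actHom σ).ker := fun g hg =>
    gradedSections.act_of_trivial σ (hN₀' (hN' hg).1.1) (fun h h' x =>
      hact g⁻¹ (inv_mem (hN' hg).1.1) h h' x)
  have hωN : N ≤ ω.ker := fun g hg => (hN' hg).2
  have : Finite (G ⧸ N) := Subgroup.quotient_finite_of_isOpen N hN
  let ω' := QuotientGroup.lift N ω hωN
  let ρ' := QuotientGroup.lift N ρ hρN
  let ρA := QuotientGroup.lift N (gradedSections.actHom σ) hρAN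
  have hxN : ∀ g, ∀ n ∈ N, x (g * n) = x g := fun g n hn => by
    rw [hx g n, hx1 n (hN' hn).1.2, map_zero, add_zero]
  let x' : G ⧸ N → wittSections p L 1 ⊤ := Quotient.lift x fun a b hab => by
    rw [← hxN a (a⁻¹ * b) (QuotientGroup.leftRel_apply.1 hab), mul_inv_cancel_left]
  have hx' : IsCocycle (twistEnd ω' ρ') x' := by
    intro a b
    induction a using QuotientGroup.induction_on with | H g => ?_
    induction b using QuotientGroup.induction_on with | H h => ?_
    exact (hx g h).trans (congrArg _ (hρ g (x h)))
  let := gradedSections.algebra (L := L) hS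
  obtain ⟨c, hc, hcx⟩ := exists_permRep_lift_twist ω' ρ' (fun P hP y hy =>
    exists_permRep_lift_of_isPGroup hP (ρA.comp P.subtype) (ρ'.comp P.subtype)
      (gradedSections.ofWitt hS) (fun g m => by
        obtain ⟨g, hg⟩ := g
        induction g using QuotientGroup.induction_on with | H g => ?_
        exact gradedSections.ofWitt_wittAct σ hS g m)
      (gradedSections.toWitt hS) (fun k g a => by
        obtain ⟨g, hg⟩ := g
        induction g using QuotientGroup.induction_on with | H g => ?_
        exact gradedSections.toWitt_act σ hS k g a)
      (gradedSections.toWitt_ofWitt_pow hS) hy) hx'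
  have := Fintype.ofFinite (G ⧸ N)
  -- The finite set `T` consists of all translates of the supports of the lift; this makes it stable
  -- under `G`.
  refine ⟨Finset.univ.biUnion fun a : G ⧸ N => Finset.univ.biUnion fun b : G ⧸ N =>
    (c b).support.image (ρ' a), fun g f => c g f, fun g f hf => ?_, fun f => ?_, fun g h f => ?_,
    fun g => ?_⟩
  · simp only [Finset.mem_biUnion, Finset.mem_image, Finset.mem_univ, true_and] at hf ⊢
    obtain ⟨a, b, y, hy, rfl⟩ := hf
    exact ⟨(g : G ⧸ N) * a, b, y, hy, by rw [map_mul]; rfl⟩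
  · have := QuotientGroup.discreteTopology hN
    exact (continuous_of_discreteTopology (f := fun a : G ⧸ N => c a f)).comp
      QuotientGroup.continuous_mk
  · have h1 := congrArg (fun k : wittSections p L 1 ⊤ →₀ ZMod p => k f) (hc g h)
    refine h1.trans ?_
    have h2 : Finsupp.mapDomain (ρ g) (c h) f = c h (ρ g⁻¹ f) := by
      conv_lhs => rw [← wittEnd_inv_apply σ 1 g f]
      exact Finsupp.mapDomain_apply (Function.LeftInverse.injective (wittEnd_apply_inv σ 1 g)) _ _
    change c g f + PadicInt.toZMod (χ g : ℤ_[p]) * Finsupp.mapDomain (ρ g) (c h) f = _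
    rw [h2]
  · refine Eq.trans ?_ (hcx g)
    refine (Finsupp.sum_of_support_subset _ (fun f hf => ?_) (fun f a => a • f)
      fun f _ => zero_smul _ _).symm
    simp only [Finset.mem_biUnion, Finset.mem_image, Finset.mem_univ, true_and]
    exact ⟨1, g, f, hf, by rw [map_one]; rfl⟩

/-- The three lifts are composed: from `V(1)` to `𝔽_p[V](1)`, then to `ℤ_p[V](1)` by the cyclotomic
hypothesis, then to `W(L)(1)` by the Teichmüller map, with `V` the global sections of `L`.
Stabilizers of sections are open because the action is naive. -/
theorem exists_lim_lift_one [IsTopologicalGroup G] [CompactSpace G] [TotallyDisconnectedSpace G]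
    (hS : IsPerfectOfChar p S) (hχ : IsOneInftyCyclotomic p χ) {x : G → wittSections p L 1 ⊤}
    (hx : IsCocycle (wittTwistEnd σ hS hχ.1 1) x)
    (hx0 : ∃ N : Subgroup G, IsOpen (N : Set G) ∧ ∀ g ∈ N, x g = 0) :
    ∃ β : G → wittLim p L, IsCocycle (Γ := G) (M := wittLim p L) (limAct σ hS hχ.1) β ∧
      (∀ g, wittLim.pr 1 (β g) = x g) ∧
      ∀ s, ∃ N : Subgroup G, IsOpen (N : Set G) ∧ ∀ g ∈ N, wittLim.pr s (β g) = 0 := by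
  let : Module (ZMod p) (wittSections p L 1 ⊤) := AddCommGroup.zmodModule (wittSections_p_nsmul hS)
  obtain ⟨T, c, hT, hc, hc', hcx⟩ := exists_perm_cocycle σ hS hχ.1 hx hx0
  let : MulAction G (wittSections p L 1 ⊤) :=
    { smul := fun g f => wittEnd p σ 1 g f
      one_smul := fun f => congrArg (fun k : AddMonoid.End (wittSections p L 1 ⊤) => k f)
        (map_one (wittEnd p σ 1))
      mul_smul := fun g h f => congrArg (fun k : AddMonoid.End (wittSections p L 1 ⊤) => k f)
        (map_mul (wittEnd p σ 1) g h) }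
  obtain ⟨N₀, hN₀, hN₀', hact⟩ := σ.exists_open
  obtain ⟨d, hd, hd', hdc⟩ := hχ.exists_perm_lift (fun f : wittSections p L 1 ⊤ =>
    Subgroup.isOpen_mono (H₁ := N₀) (fun g hg => wittEnd_of_trivial σ (hN₀' hg) (fun h h' x =>
      hact g⁻¹ (inv_mem hg) h h' x) f) hN₀) c hc hc'
  obtain ⟨β, hβ, hβ', hβ''⟩ := exists_teich_cocycle σ hS hχ.1 T hT d hd hd'
  refine ⟨β, hβ, fun g => ?_, hβ''⟩
  rw [hβ', ← hcx]
  exact Finset.sum_congr rfl fun f _ => by rw [padicSmul_one_eq, hdc]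

theorem nsmul_cocycle_defect {Γ M : Type*} [Group Γ] [AddCommGroup M] {ρ : Γ →* AddMonoid.End M}
    {z β w : Γ → M} (hβ : IsCocycle ρ β) {n : ℕ} (hw : ∀ g, z g - β g = n • w g) (g h : Γ) :
    n • (w (g * h) - (w g + ρ g (w h))) = z (g * h) - (z g + ρ g (z h)) := by
  rw [nsmul_sub, nsmul_add, ← map_nsmul, ← hw, ← hw, ← hw, hβ g h, map_sub]
  abel

theorem nsmul_sub_eq_sub_add_nsmul {Γ M : Type*} [AddCommGroup M] {z β w : Γ → M} {n : ℕ}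
    (hw : ∀ g, z g - β g = n • w g) (γ : Γ → M) (g : Γ) :
    n • (w g - γ g) = z g - (β + n • γ) g := by
  rw [nsmul_sub, ← hw, Pi.add_apply, Pi.smul_apply, sub_add_eq_sub_sub]

/-- A cocycle at level `k` is represented by a cochain `z` in `W(L)` satisfying the identity only at
level `k`. Lifting its reduction at level `1` to a cocycle `β` leaves `z - β = p w`; division by `p`
lowers the level by one, so `w` is a cocycle at level `k - 1` and the induction applies to it. -/
theorem exists_lim_lift [IsTopologicalGroup G] [CompactSpace G] [TotallyDisconnectedSpace G]
    (hS : IsPerfectOfChar p S) (hχ : IsOneInftyCyclotomic p χ) (k : ℕ) {z : G → wittLim p L}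
    (hz : ∀ g h, wittLim.pr k (z (g * h) - (z g + limAct σ hS hχ.1 g (z h))) = 0)
    (hz0 : ∃ N : Subgroup G, IsOpen (N : Set G) ∧ ∀ g ∈ N, wittLim.pr k (z g) = 0) :
    ∃ β : G → wittLim p L, IsCocycle (Γ := G) (M := wittLim p L) (limAct σ hS hχ.1) β ∧
      (∀ g, wittLim.pr k (z g - β g) = 0) ∧
      ∀ s, ∃ N : Subgroup G, IsOpen (N : Set G) ∧ ∀ g ∈ N, wittLim.pr s (β g) = 0 := by
  induction k generalizing z with
  | zero =>
    refine ⟨0, fun g h => ?_, fun g => eq_zero_of_wittSections_zero _, fun s =>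
      ⟨⊤, isOpen_univ, fun g _ => map_zero _⟩⟩
    simp only [Pi.zero_apply, map_zero, add_zero]
  | succ k ih =>
    obtain ⟨β, hβ, hβ', hβ''⟩ := exists_lim_lift_one σ hS hχ (x := fun g => wittLim.pr 1 (z g))
      (fun g h => by
        have h1 := wittLim.pr_of_le (show 1 ≤ k + 1 by omega) (hz g h)
        rw [wittLim.pr_sub, sub_eq_zero] at h1
        exact h1)
      (by
        obtain ⟨N, hN, hN'⟩ := hz0
        exact ⟨N, hN, fun g hg => wittLim.pr_of_le (show 1 ≤ k + 1 by omega) (hN' g hg)⟩)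
    choose w hw using fun g => wittLim.exists_p_nsmul hS (m := z g - β g) (by
      rw [wittLim.pr_sub, hβ', sub_self])
    obtain ⟨γ, hγ, hγ', hγ''⟩ := ih (z := w) (fun g h => by
        exact (wittLim.pr_p_nsmul_eq_zero_iff hS _ _).1
          ((congrArg (wittLim.pr (k + 1)) (nsmul_cocycle_defect hβ hw g h)).trans (hz g h)))
      (by
        obtain ⟨N, hN, hN'⟩ := hz0
        obtain ⟨N₁, hN₁, hN₁'⟩ := hβ'' (k + 1)
        refine ⟨N ⊓ N₁, hN.inter hN₁, fun g hg => ?_⟩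
        refine (wittLim.pr_p_nsmul_eq_zero_iff hS _ _).1 ?_
        rw [← hw, wittLim.pr_sub, hN' g hg.1, hN₁' g hg.2, sub_zero])
    refine ⟨β + p • γ, hβ.add (hγ.nsmul p), fun g => ?_, fun s => ?_⟩
    · exact (congrArg (wittLim.pr (k + 1)) (nsmul_sub_eq_sub_add_nsmul hw γ g)).symm.trans
        ((wittLim.pr_p_nsmul_eq_zero_iff hS _ _).2 (hγ' g))
    · obtain ⟨N, hN, hN'⟩ := hβ'' s
      obtain ⟨N₁, hN₁, hN₁'⟩ := hγ'' s
      refine ⟨N ⊓ N₁, hN.inter hN₁, fun g hg => ?_⟩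
      rw [Pi.add_apply, Pi.smul_apply, wittLim.pr_add, wittLim.pr_nsmul, hN' g hg.1, hN₁' g hg.2, nsmul_zero,
        add_zero]

end

end SmoothProfinite

namespace SmoothProfinite

noncomputable section

set_option linter.unusedSectionVars false

variable {p : ℕ} [Fact p.Prime] {S : Scheme.{u}}

/-! ## Semilinear maps between torsors -/

namespace Torsor

variable {M : TopCat.Presheaf Ab.{u} S} (P : Torsor M)

/-- Restriction of sections of a torsor. -/
def res {U V : S.Opens} (h : V ≤ U) (x : P.sheaf.1.obj (op U)) : P.sheaf.1.obj (op V) :=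
  P.sheaf.1.map (homOfLE h).op x

theorem res_res {U V W : S.Opens} (h : V ≤ U) (h' : W ≤ V) (x : P.sheaf.1.obj (op U)) :
    P.res h' (P.res h x) = P.res (h'.trans h) x :=
  (congrArg (fun k : P.sheaf.1.obj (op U) ⟶ P.sheaf.1.obj (op W) => k x)
    (P.sheaf.1.map_comp (homOfLE h).op (homOfLE h').op)).symm

theorem res_vadd {U V : S.Opens} (h : V ≤ U) (m : M.obj (op U)) (x : P.sheaf.1.obj (op U)) :
    P.res h (P.vadd m x) = P.vadd (M.map (homOfLE h).op m) (P.res h x) := P.map_vadd h m x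

theorem res_self {U : S.Opens} (x : P.sheaf.1.obj (op U)) : P.res le_rfl x = x :=
  congrArg (fun k : P.sheaf.1.obj (op U) ⟶ P.sheaf.1.obj (op U) => k x) (P.sheaf.1.map_id _)

theorem vadd_comm {U : S.Opens} (m n : M.obj (op U)) (x : P.sheaf.1.obj (op U)) :
    P.vadd m (P.vadd n x) = P.vadd n (P.vadd m x) := by
  rw [← P.add_vadd, ← P.add_vadd, add_comm]

theorem vadd_right_cancel {U : S.Opens} {m n : M.obj (op U)} {x : P.sheaf.1.obj (op U)}
    (h : P.vadd m x = P.vadd n x) : m = n :=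
  (P.existsUnique_vadd x (P.vadd n x)).unique h rfl

theorem exists_vadd {U : S.Opens} (x y : P.sheaf.1.obj (op U)) : ∃ m, P.vadd m x = y :=
  (P.existsUnique_vadd x y).exists

end Torsor

namespace Torsor

variable {L : S.Modules} {s : ℕ} (P : Torsor (wittLine p L s))

/-- The action of global sections of `W_s(L)`. -/
def shift (m : wittSections p L s ⊤) {U : S.Opens} (x : P.sheaf.1.obj (op U)) :
    P.sheaf.1.obj (op U) := P.vadd (wres L s le_top m) x

theorem shift_zero {U : S.Opens} (x : P.sheaf.1.obj (op U)) : P.shift 0 x = x := by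
  refine Eq.trans ?_ (P.zero_vadd x)
  exact congrArg (fun k => P.vadd k x) (map_zero (wres (p := p) L s (le_top : U ≤ ⊤)))

theorem shift_shift (m n : wittSections p L s ⊤) {U : S.Opens} (x : P.sheaf.1.obj (op U)) :
    P.shift m (P.shift n x) = P.shift (m + n) x := by
  refine (P.add_vadd _ _ x).symm.trans ?_
  exact congrArg (fun k => P.vadd k x) (map_add (wres (p := p) L s (le_top : U ≤ ⊤)) m n).symm

theorem res_shift (m : wittSections p L s ⊤) {U V : S.Opens} (h : V ≤ U)
    (x : P.sheaf.1.obj (op U)) : P.res h (P.shift m x) = P.shift m (P.res h x) := P.map_vadd h _ x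

theorem shift_vadd (m : wittSections p L s ⊤) {U : S.Opens} (n : (wittLine p L s).obj (op U))
    (x : P.sheaf.1.obj (op U)) : P.shift m (P.vadd n x) = P.vadd n (P.shift m x) :=
  P.vadd_comm (wres L s le_top m) n x

end Torsor

variable {G : Type v} [Group G] [TopologicalSpace G] {A : GSchemeAction G S}

/-- Morphisms of torsors which are semilinear with respect to the action of `g ∈ G`. -/
structure SemiHom {M : TopCat.Presheaf Ab.{u} S} (τ : A.GStructure M) (g : G) (P Q : Torsor M) where
  map : ∀ {U V : S.Opens}, V ≤ A.image g U → P.sheaf.1.obj (op U) → Q.sheaf.1.obj (op V)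
  map_res : ∀ {U U' V : S.Opens} (h : V ≤ A.image g U') (h' : U' ≤ U) (h'' : V ≤ A.image g U)
    (x : P.sheaf.1.obj (op U)), map h (P.res h' x) = map h'' x
  res_map : ∀ {U V V' : S.Opens} (h : V ≤ A.image g U) (h' : V' ≤ V) (h'' : V' ≤ A.image g U)
    (x : P.sheaf.1.obj (op U)), Q.res h' (map h x) = map h'' x
  map_vadd : ∀ {U V : S.Opens} (h : V ≤ A.image g U) (m : M.obj (op U)) (x : P.sheaf.1.obj (op U)),
    map h (P.vadd m x) = Q.vadd (τ.act g h m) (map h x)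

namespace SemiHom

section General

variable {M : TopCat.Presheaf Ab.{u} S} {τ : A.GStructure M} {g g' : G} {P Q R : Torsor M}

/-- The morphism with the same underlying map, if two elements of `G` act in the same way. -/
def congr (f : SemiHom τ g P Q) (hi : ∀ U, A.image g' U = A.image g U)
    (hact : ∀ {U V : S.Opens} (h : V ≤ A.image g' U) (h' : V ≤ A.image g U) (m : M.obj (op U)),
      τ.act g' h m = τ.act g h' m) : SemiHom τ g' P Q where
  map {U _} h x := f.map (h.trans (hi U).le) x
  map_res h h' h'' x := f.map_res _ h' _ x
  res_map h h' h'' x := f.res_map _ h' _ x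
  map_vadd h m x := by rw [f.map_vadd, hact h]

/-- The identity, if `g` acts trivially. -/
def refl (hi : ∀ U, A.image g U = U)
    (hact : ∀ {U V : S.Opens} (h : V ≤ A.image g U) (h' : V ≤ U) (m : M.obj (op U)),
      τ.act g h m = M.map (homOfLE h').op m) : SemiHom τ g P P where
  map {U _} h x := P.res (h.trans (hi U).le) x
  map_res h h' h'' x := P.res_res _ _ x
  res_map h h' h'' x := P.res_res _ _ x
  map_vadd {U _} h m x := by rw [hact h (h.trans (hi U).le), P.res_vadd]

/-- Composition of semilinear maps. -/
def comp (f : SemiHom τ g Q R) (f' : SemiHom τ g' P Q) : SemiHom τ (g * g') P R where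
  map {U V} h x := f.map (U := A.image g' U) (V := V) (h.trans (A.image_mul g g' U).le)
    (f'.map le_rfl x)
  map_res {U U' V} h h' h'' x := by
    rw [f'.map_res le_rfl h' (A.image_mono g' h'), ← f'.res_map le_rfl (A.image_mono g' h'),
      f.map_res]
  res_map h h' h'' x := f.res_map _ _ _ _
  map_vadd {U V} h m x := by
    rw [f'.map_vadd, f.map_vadd, τ.act_mul g g' _ _ h]

theorem comp_map (f : SemiHom τ g Q R) (f' : SemiHom τ g' P Q) {U V W : S.Opens}
    (h : W ≤ A.image g V) (h' : V ≤ A.image g' U) (h'' : W ≤ A.image (g * g') U)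
    (x : P.sheaf.1.obj (op U)) : (f.comp f').map h'' x = f.map h (f'.map h' x) := by
  have := f'.res_map (le_refl (A.image g' U)) h' h' x
  rw [← this, f.map_res]
  rfl

/-- The composition of a semilinear map with a morphism of torsors. -/
def homComp (f : TorsorHom (𝟙 M) Q R) (f' : SemiHom τ g P Q) : SemiHom τ g P R where
  map {U V} h x := f.hom.app (op V) (f'.map h x)
  map_res h h' h'' x := congrArg _ (f'.map_res h h' h'' x)
  res_map {U V V'} h h' h'' x := by
    rw [← f'.res_map h h' h'']
    exact (congrArg (fun k => k (f'.map h x)) (f.hom.naturality (homOfLE h').op)).symm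
  map_vadd {U V} h m x := by
    rw [f'.map_vadd, f.map_vadd]
    rfl

/-- The composition of a morphism of torsors with a semilinear map. -/
def compHom (f : SemiHom τ g Q R) (f' : TorsorHom (𝟙 M) P Q) : SemiHom τ g P R where
  map {U V} h x := f.map h (f'.hom.app (op U) x)
  map_res {U U' V} h h' h'' x := by
    rw [← f.map_res h h' h'']
    exact congrArg _ (congrArg (fun k => k x) (f'.hom.naturality (homOfLE h').op))
  res_map {U V V'} h h' h'' x := f.res_map h h' h'' _
  map_vadd {U V} h m x := by
    rw [f'.map_vadd, f.map_vadd]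
    rfl

/-- The semilinear maps given by an action of `G` on a torsor. -/
def ofGStructure (ρ : P.GStructure τ) (g : G) : SemiHom τ g P P where
  map h x := ρ.act g h x
  map_res {U U' V} h h' h'' x := by
    have e : ∀ k (_ : k = g) (h₁ : V ≤ A.image k U), ρ.act k h₁ x = ρ.act g h'' x := by
      rintro _ rfl h₁
      rfl
    rw [← e (g * 1) (mul_one g) (by rwa [mul_one]),
      ← ρ.act_mul g 1 h (h'.trans (A.image_one U).ge), ρ.act_one _ h']
    rfl
  res_map {U V V'} h h' h'' x := by
    have e : ∀ k (_ : k = g) (h₁ : V' ≤ A.image k U), ρ.act k h₁ x = ρ.act g h'' x := by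
      rintro _ rfl h₁
      rfl
    rw [← e (1 * g) (one_mul g) (by rwa [one_mul]),
      ← ρ.act_mul 1 g (h'.trans (A.image_one V).ge) h, ρ.act_one _ h']
    rfl
  map_vadd h m x := ρ.act_vadd g h m x

/-- The semilinear map given by an isomorphism of the translate of a torsor. -/
def ofTranslate (f : TorsorHom (𝟙 M) (P.translate τ g) Q) : SemiHom τ g P Q where
  map {U V} h x := f.hom.app (op V) (P.res ((A.image_inv_le_iff g).2 h) x)
  map_res h h' h'' x := congrArg _ (P.res_res _ _ x)
  res_map {U V V'} h h' h'' x := by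
    refine (congrArg (fun k => k (P.res ((A.image_inv_le_iff g).2 h) x))
      (f.hom.naturality (homOfLE h').op)).symm.trans ?_
    exact congrArg (f.hom.app (op V')) (P.res_res _ (A.image_mono g⁻¹ h') x)
  map_vadd {U V} h m x := by
    have h1 : M.map (homOfLE ((A.image_inv_le_iff g).2 h)).op m =
        τ.act g⁻¹ (le_refl (A.image g⁻¹ V)) (τ.act g h m) := by
      rw [τ.act_mul g⁻¹ g le_rfl h (by
          rw [inv_mul_cancel, A.image_one]; exact (A.image_inv_le_iff g).2 h),
        τ.act_congr (inv_mul_cancel g) _ (by rw [A.image_one]; exact (A.image_inv_le_iff g).2 h),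
        τ.act_one]
    rw [P.res_vadd, h1]
    exact f.map_vadd (τ.act g h m) (P.res ((A.image_inv_le_iff g).2 h) x)

end General

section Witt

variable {L : S.Modules} {s : ℕ} {τ : A.GStructure (wittLine p L s)} {g : G}
  {P Q : Torsor (wittLine p L s)}

theorem map_shift (f : SemiHom τ g P Q) (m : wittSections p L s ⊤) {U V : S.Opens}
    (h : V ≤ A.image g U) (x : P.sheaf.1.obj (op U)) :
    f.map h (P.shift m x) = Q.shift (topEnd τ g m) (f.map h x) := by
  refine (f.map_vadd h _ x).trans (congrArg (fun k => Q.vadd k (f.map h x)) ?_)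
  exact (τ.act_res g h le_top le_top m).trans (τ.res_act g (A.top_le_image g) le_top m).symm

/-- The map `m + f`, for a global section `m` of `W_s(L)`. -/
def shift (f : SemiHom τ g P Q) (m : wittSections p L s ⊤) : SemiHom τ g P Q where
  map h x := Q.shift m (f.map h x)
  map_res h h' h'' x := by rw [f.map_res h h' h'']
  res_map h h' h'' x := by rw [Q.res_shift, f.res_map h h' h'']
  map_vadd h n x := by rw [f.map_vadd, Q.shift_vadd]

/-- One test section near each point is enough, so it may be taken among the reductions of sections
of higher level. -/
theorem shift_ext_of_locally (f : SemiHom τ g P Q) {m n : wittSections p L s ⊤}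
    (h : ∀ z : S, ∃ (U : S.Opens) (x : P.sheaf.1.obj (op U)), z ∈ U ∧
      ∀ {V : S.Opens} (h : V ≤ A.image g U), Q.shift m (f.map h x) = Q.shift n (f.map h x)) :
    m = n := by
  refine wittSections_eq_of_locally fun x _ => ?_
  obtain ⟨U, y, hU, h⟩ := h (A.invHom g x)
  exact ⟨A.image g U, le_top, hU, Q.vadd_right_cancel (h le_rfl)⟩

theorem shift_ext (f : SemiHom τ g P Q) {m n : wittSections p L s ⊤}
    (h : ∀ {U V : S.Opens} (h : V ≤ A.image g U) (x : P.sheaf.1.obj (op U)),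
      Q.shift m (f.map h x) = Q.shift n (f.map h x)) : m = n :=
  f.shift_ext_of_locally fun z => by
    obtain ⟨U, hU, ⟨y⟩⟩ := P.exists_local z
    exact ⟨U, y, hU, fun h' => h h' y⟩

/-- A local section `y` measures the difference of the two maps near a point. Any other section is
`n + y`, and both maps change by the same `g n`; hence the difference does not depend on `y`, and
the local differences glue. -/
theorem exists_shift_eq (hS : IsPerfectOfChar p S) (f f' : SemiHom τ g P Q) :
    ∃ m : wittSections p L s ⊤, ∀ {U V : S.Opens} (h : V ≤ A.image g U)
      (x : P.sheaf.1.obj (op U)), f'.map h x = Q.shift m (f.map h x) := by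
  let Z : ∀ W : S.Opens, wittSections p L s W → Prop := fun W m =>
    ∀ {U V : S.Opens} (h : V ≤ A.image g U) (hV : V ≤ W) (x : P.sheaf.1.obj (op U)),
      f'.map h x = Q.vadd (wres L s hV m) (f.map h x)
  have hZ : ∀ (U : S.Opens) (_ : P.sheaf.1.obj (op U)), ∃ m, Z (A.image g U) m := fun U y => by
    obtain ⟨m, hm⟩ := Q.exists_vadd (f.map (le_refl (A.image g U)) y) (f'.map le_rfl y)
    refine ⟨m, fun {U' V} h hV x => ?_⟩
    have hUU : V ≤ A.image g (U ⊓ U') := le_inf hV h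
    obtain ⟨n, hn⟩ := P.exists_vadd (P.res (inf_le_left : U ⊓ U' ≤ U) y) (P.res inf_le_right x)
    have e : ∀ k : SemiHom τ g P Q, k.map h x = Q.vadd (τ.act g hUU n) (k.map hV y) := fun k => by
      rw [← k.map_res hUU inf_le_right h x, ← hn, k.map_vadd, k.map_res]
    have e' : f'.map hV y = Q.vadd (wres L s hV m) (f.map hV y) := by
      have h1 := congrArg (Q.res hV) hm
      rw [Q.res_vadd, f.res_map _ _ hV, f'.res_map _ _ hV] at h1
      exact h1.symm
    rw [e f, e f', e']
    exact Q.vadd_comm _ (wres L s hV m) _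
  obtain ⟨m, hm⟩ := wittSections_glue hS (U := ⊤) Z
    (fun V V' h m hm {U W} h' hW x => hm h' (hW.trans h) x)
    (fun V m m' hm hm' => wittSections_eq_of_locally fun x hx => by
      obtain ⟨U, hU, ⟨y⟩⟩ := P.exists_local (A.invHom g x)
      exact ⟨V ⊓ A.image g U, inf_le_left, ⟨hx, hU⟩, Q.vadd_right_cancel
        ((hm (U := U) inf_le_right inf_le_left y).symm.trans (hm' inf_le_right inf_le_left y))⟩)
    (fun x _ => by
      obtain ⟨U, hU, ⟨y⟩⟩ := P.exists_local (A.invHom g x)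
      exact ⟨A.image g U, hU, hZ U y⟩)
  refine ⟨m, fun {U V} h x => ?_⟩
  obtain ⟨m', hm'⟩ := hZ U x
  rw [hm' h h x, ← hm (A.image g U) le_top m' hm']
  rfl

end Witt

end SemiHom

end

end SmoothProfinite

namespace SmoothProfinite

noncomputable section

set_option linter.unusedSectionVars false

variable {p : ℕ} [Fact p.Prime] {S : Scheme.{u}} {L : S.Modules}

/-! ## Semilinear automorphisms of `W(L)`-torsors -/

namespace WittTorsor

variable (P : WittTorsor p L)

/-- Reduction of sections of a `W(L)`-torsor. -/
def red (s : ℕ) {U : S.Opens} (x : (P.level (s + 1)).sheaf.1.obj (op U)) :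
    (P.level s).sheaf.1.obj (op U) := (P.trans s).hom.app (op U) x

theorem red_vadd (s : ℕ) {U : S.Opens} (m : wittSections p L (s + 1) U)
    (x : (P.level (s + 1)).sheaf.1.obj (op U)) :
    P.red s ((P.level (s + 1)).vadd m x) = (P.level s).vadd (wred L s U m) (P.red s x) :=
  (P.trans s).map_vadd m x

theorem red_shift (s : ℕ) {U : S.Opens} (m : wittSections p L (s + 1) ⊤)
    (x : (P.level (s + 1)).sheaf.1.obj (op U)) :
    P.red s ((P.level (s + 1)).shift m x) = (P.level s).shift (wred L s ⊤ m) (P.red s x) :=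
  P.red_vadd s (wres L (s + 1) le_top m) x

theorem red_res (s : ℕ) {U V : S.Opens} (h : V ≤ U) (x : (P.level (s + 1)).sheaf.1.obj (op U)) :
    P.red s ((P.level (s + 1)).res h x) = (P.level s).res h (P.red s x) :=
  congrArg (fun k => k x) ((P.trans s).hom.naturality (homOfLE h).op)

end WittTorsor

variable {G : Type v} [Group G] [TopologicalSpace G] {A : GSchemeAction G S}

/-- Compatible systems of `g`-semilinear endomorphisms of the components of a `W(L)`-torsor. -/
structure LimHom (T : ∀ s, A.GStructure (wittLine p L s)) (P : WittTorsor p L) (g : G) where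
  level : ∀ s, SemiHom (T s) g (P.level s) (P.level s)
  trans : ∀ (s : ℕ) {U V : S.Opens} (h : V ≤ A.image g U)
    (x : (P.level (s + 1)).sheaf.1.obj (op U)),
    P.red s ((level (s + 1)).map h x) = (level s).map h (P.red s x)

namespace LimHom

variable {T : ∀ s, A.GStructure (wittLine p L s)} {P : WittTorsor p L} {g g' : G}

theorem nonempty_of_isGInvariant (hP : P.IsGInvariant T) (g : G) : Nonempty (LimHom T P g) := by
  obtain ⟨f, hf⟩ := hP g
  refine ⟨fun s => SemiHom.ofTranslate (f s), fun s {U V} h x => ?_⟩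
  have h1 := hf s V ((P.level (s + 1)).res ((A.image_inv_le_iff g).2 h) x)
  refine h1.symm.trans (congrArg ((f s).hom.app (op V)) ?_)
  exact P.red_res s _ x

/-- The map `m + f`, for a global section `m` of `W(L)`. -/
def shift (m : wittLim p L) (f : LimHom T P g) : LimHom T P g where
  level s := (f.level s).shift (wittLim.pr s m)
  trans s U V h x := by
    refine (P.red_shift s _ _).trans ?_
    rw [f.trans, wittLim.wred_pr]
    rfl

theorem shift_map (m : wittLim p L) (f : LimHom T P g) (s : ℕ) {U V : S.Opens} (h : V ≤ A.image g U)
    (x : (P.level s).sheaf.1.obj (op U)) : ((f.shift m).level s).map h x =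
      (P.level s).shift (wittLim.pr s m) ((f.level s).map h x) := rfl

/-- The morphism with the same underlying map, if two elements of `G` act in the same way. -/
def congr (f : LimHom T P g) (hi : ∀ U, A.image g' U = A.image g U)
    (hact : ∀ s {U V : S.Opens} (h : V ≤ A.image g' U) (h' : V ≤ A.image g U)
      (m : (wittLine p L s).obj (op U)), (T s).act g' h m = (T s).act g h' m) : LimHom T P g' where
  level s := (f.level s).congr hi (hact s)
  trans s {U _} h x := f.trans s (h.trans (hi U).le) x

/-- Composition. -/
def comp (f : LimHom T P g) (f' : LimHom T P g') : LimHom T P (g * g') where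
  level s := (f.level s).comp (f'.level s)
  trans s {U _} h x :=
    (f.trans s (h.trans (A.image_mul g g' U).le) _).trans (congrArg _ (f'.trans s le_rfl x))

theorem comp_map (f : LimHom T P g) (f' : LimHom T P g') (s : ℕ) {U V W : S.Opens}
    (h : W ≤ A.image g V) (h' : V ≤ A.image g' U) (h'' : W ≤ A.image (g * g') U)
    (x : (P.level s).sheaf.1.obj (op U)) :
    ((f.comp f').level s).map h'' x = (f.level s).map h ((f'.level s).map h' x) :=
  SemiHom.comp_map _ _ _ _ _ _

theorem shift_ext (f : LimHom T P g) {m n : wittLim p L}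
    (h : ∀ (s : ℕ) {U V : S.Opens} (h : V ≤ A.image g U) (x : (P.level s).sheaf.1.obj (op U)),
      (P.level s).shift (wittLim.pr s m) ((f.level s).map h x) =
        (P.level s).shift (wittLim.pr s n) ((f.level s).map h x)) : m = n :=
  wittLim.ext fun s => (f.level s).shift_ext (h s)

/-- The difference exists at each level, and these differences are compatible because they are
unique. Compatibility is tested on reductions of sections of level `s + 1`, which exist locally. -/
theorem exists_shift_eq (hS : IsPerfectOfChar p S) (f f' : LimHom T P g) :
    ∃ m : wittLim p L, ∀ (s : ℕ) {U V : S.Opens} (h : V ≤ A.image g U)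
      (x : (P.level s).sheaf.1.obj (op U)), (f'.level s).map h x =
        (P.level s).shift (wittLim.pr s m) ((f.level s).map h x) := by
  choose m hm using fun s => SemiHom.exists_shift_eq hS (f.level s) (f'.level s)
  refine ⟨⟨m, fun s => (f.level s).shift_ext_of_locally fun z => ?_⟩, fun s {U V} h x => hm s h x⟩
  obtain ⟨U, hU, ⟨y⟩⟩ := (P.level (s + 1)).exists_local z
  refine ⟨U, P.red s y, hU, fun {V} h => ?_⟩
  have h1 := congrArg (P.red s) (hm (s + 1) h y)
  rw [f'.trans, hm s h] at h1
  refine Eq.trans ?_ h1.symm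
  refine ((P.red_shift s _ _).trans ?_).symm
  rw [f.trans]

end LimHom

end

end SmoothProfinite

namespace SmoothProfinite

noncomputable section

set_option linter.unusedSectionVars false

/-! ## Splitting of extensions with a section invariant under a subgroup of finite index -/

section Algebra

variable {Γ : Type*} [Group Γ] {M : Type*} [AddCommGroup M]

/-- The usual proof that the order of a finite group kills its second cohomology: sum the cocycle
identity over the last variable, which runs through `Γ ⧸ N`. The cochain `b` is the sum of `c g`
over the cosets. -/
theorem exists_card_nsmul_eq (ρ : Γ →* AddMonoid.End M) (c : Γ → Γ → M)
    (hc : ∀ g h k, c g h + c (g * h) k = ρ g (c h k) + c g (h * k)) (N : Subgroup Γ)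
    [Fintype (Γ ⧸ N)] (hN : ∀ g h, ∀ n ∈ N, c g (h * n) = c g h)
    (hN' : ∀ n ∈ N, ∀ h, c n h = 0) :
    ∃ b : Γ → M, (∀ g h, Fintype.card (Γ ⧸ N) • c g h = ρ g (b h) + b g - b (g * h)) ∧
      ∀ n ∈ N, b n = 0 := by
  let c' : Γ → Γ ⧸ N → M := fun g => Quotient.lift (c g) fun h k hk => by
    rw [← hN g h (h⁻¹ * k) (QuotientGroup.leftRel_apply.1 hk), mul_inv_cancel_left]
  refine ⟨fun g => ∑ q, c' g q, fun g h => ?_, fun n hn => Finset.sum_eq_zero fun q _ => ?_⟩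
  · have h1 : ∀ q, c g h + c' (g * h) q = ρ g (c' h q) + c' g (h • q) := fun q => by
      induction q using QuotientGroup.induction_on with | H k => ?_
      exact hc g h k
    have h2 : ∑ q, c' g (h • q) = ∑ q, c' g q :=
      Equiv.sum_comp (MulAction.toPerm h : Equiv.Perm (Γ ⧸ N)) (c' g)
    have h3 := Finset.sum_congr (s₁ := Finset.univ) rfl fun q _ => h1 q
    rw [Finset.sum_add_distrib, Finset.sum_add_distrib, h2, Finset.sum_const, Finset.card_univ,
      ← map_sum] at h3
    rw [← h3]
    abel
  · induction q using QuotientGroup.induction_on with | H k => ?_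
    exact hN' n hn k

theorem nsmul_defect_eq_zero {ρ : Γ →* AddMonoid.End M} {c : Γ → Γ → M} {n : ℕ} {b β e : Γ → M}
    (hb : ∀ g h, n • c g h = ρ g (b h) + b g - b (g * h)) (hβ : IsCocycle ρ β)
    (he : ∀ g, b g - β g = n • e g) (g h : Γ) :
    n • (c g h - (ρ g (e h) + e g - e (g * h))) = 0 := by
  rw [nsmul_sub, nsmul_sub, nsmul_add, ← map_nsmul, ← he, ← he, ← he, hb, hβ g h, map_sub]
  abel

theorem defect_of_nsmul {ρ : Γ →* AddMonoid.End M} {c : Γ → Γ → M} {n k : ℕ} {b b' : Γ → M}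
    (hb : ∀ g h, (k * n) • c g h = ρ g (b h) + b g - b (g * h)) (hb' : ∀ g, n • b' g = b g)
    (g h : Γ) : n • (k • c g h - (ρ g (b' h) + b' g - b' (g * h))) = 0 := by
  rw [nsmul_sub, nsmul_sub, nsmul_add, ← map_nsmul, hb', hb', hb', ← mul_nsmul', mul_comm, hb]
  abel

theorem cocycle_defect_eq {ρ : Γ →* AddMonoid.End M} {c : Γ → Γ → M} {k : ℕ} {b : Γ → M}
    (hb : ∀ g h, k • c g h = ρ g (b h) + b g - b (g * h)) (g h : Γ) :
    b (g * h) - (b g + ρ g (b h)) = k • -c g h := by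
  rw [smul_neg, hb]
  abel

theorem neg_add_defect_eq {ρ : Γ →* AddMonoid.End M} {c : Γ → Γ → M} {e : Γ → M}
    (h : ∀ g h, c g h = ρ g (e h) + e g - e (g * h)) (g k : Γ) :
    -e g + ρ g (-e k) + c g k = -e (g * k) := by
  rw [h, map_neg]
  abel

end Algebra

variable {p : ℕ} [Fact p.Prime] {S : Scheme.{u}} {L : S.Modules}

namespace wittLim

/-- The action of `ℤ_p` on the global sections of `W(L)`. -/
def padicSmul (hS : IsPerfectOfChar p S) (a : ℤ_[p]) (m : wittLim p L) : wittLim p L :=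
  ⟨fun s => SmoothProfinite.padicSmul s a (pr s m), fun s => by
    have e := padicSmul_map (wred (p := p) L s ⊤) (s := s + 1) a (pr (s + 1) m)
    rw [wred_pr, padicSmul_succ (pow_nsmul_wittSections hS _)] at e
    exact e⟩

theorem pr_padicSmul (hS : IsPerfectOfChar p S) (a : ℤ_[p]) (m : wittLim p L) (s : ℕ) :
    pr s (padicSmul hS a m) = SmoothProfinite.padicSmul s a (pr s m) := rfl

theorem padicSmul_padicSmul (hS : IsPerfectOfChar p S) (a b : ℤ_[p]) (m : wittLim p L) :
    padicSmul hS a (padicSmul hS b m) = padicSmul hS (a * b) m :=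
  ext fun _ => (padicSmul_mul (pow_nsmul_wittSections hS _) a b).symm

theorem padicSmul_one (hS : IsPerfectOfChar p S) (m : wittLim p L) : padicSmul hS 1 m = m :=
  ext fun _ => SmoothProfinite.padicSmul_one (pow_nsmul_wittSections hS _)

theorem padicSmul_natCast (hS : IsPerfectOfChar p S) (n : ℕ) (m : wittLim p L) :
    padicSmul hS n m = n • m :=
  ext fun _ => SmoothProfinite.padicSmul_natCast (pow_nsmul_wittSections hS _) n

theorem padicSmul_zero (hS : IsPerfectOfChar p S) (a : ℤ_[p]) :
    padicSmul hS a (0 : wittLim p L) = 0 := ext fun _ => nsmul_zero _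

theorem exists_nsmul_of_not_dvd (hS : IsPerfectOfChar p S) {n : ℕ} (hn : ¬ p ∣ n)
    (m : wittLim p L) : ∃ m', n • m' = m := by
  have hu : IsUnit (n : ℤ_[p]) := PadicInt.isUnit_iff.2
    (PadicInt.norm_natCast_eq_one_iff.2 ((Nat.Prime.coprime_iff_not_dvd Fact.out).2 hn))
  obtain ⟨v, hv⟩ := hu.exists_right_inv
  exact ⟨padicSmul hS v m, by rw [← padicSmul_natCast hS, padicSmul_padicSmul, hv, padicSmul_one]⟩

theorem eq_zero_of_nsmul_of_not_dvd (hS : IsPerfectOfChar p S) {n : ℕ} (hn : ¬ p ∣ n)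
    {m : wittLim p L} (h : n • m = 0) : m = 0 := by
  have hu : IsUnit (n : ℤ_[p]) := PadicInt.isUnit_iff.2
    (PadicInt.norm_natCast_eq_one_iff.2 ((Nat.Prime.coprime_iff_not_dvd Fact.out).2 hn))
  obtain ⟨v, hv⟩ := hu.exists_left_inv
  rw [← padicSmul_one hS m, ← hv, ← padicSmul_padicSmul, padicSmul_natCast, h, padicSmul_zero]

end wittLim

variable {G : Type v} [Group G] [TopologicalSpace G] {A : GSchemeAction G S}
  (σ : A.Linearization L) {χ : G →* ℤ_[p]ˣ}

-- A torsion class in the second cohomology of `W(L)(1)` vanishes because cocycles lift. The order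
-- of `G ⧸ N` kills `c`, and its part prime to `p` acts invertibly, so `p ^ k c` is the coboundary
-- of some `b'`. Then `b'` is a cocycle at level `k`; if `β` lifts it, `b' - β = p ^ k e`, and
-- dividing by `p ^ k` shows that `c` is the coboundary of `e`.
set_option maxHeartbeats 1000000 in
theorem exists_defect_eq [IsTopologicalGroup G] [CompactSpace G] [TotallyDisconnectedSpace G]
    (hS : IsPerfectOfChar p S) (hχ : IsOneInftyCyclotomic p χ) (c : G → G → wittLim p L)
    (hc : ∀ g h k, c g h + c (g * h) k = limAct σ hS hχ.1 g (c h k) + c g (h * k))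
    (N : Subgroup G) (hNo : IsOpen (N : Set G)) (hN : ∀ g h, ∀ n ∈ N, c g (h * n) = c g h)
    (hN' : ∀ n ∈ N, ∀ h, c n h = 0) :
    ∃ e : G → wittLim p L, (∀ g h, c g h = limAct σ hS hχ.1 g (e h) + e g - e (g * h)) ∧
      ∀ s, ∃ N' : Subgroup G, IsOpen (N' : Set G) ∧ ∀ g ∈ N', wittLim.pr s (e g) = 0 := by
  have : Finite (G ⧸ N) := Subgroup.quotient_finite_of_isOpen N hNo
  have := Fintype.ofFinite (G ⧸ N)
  obtain ⟨b, hb, hbN⟩ := exists_card_nsmul_eq (limAct σ hS hχ.1) c hc N hN hN'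
  obtain ⟨k, n, hn, hkn⟩ := Nat.exists_eq_pow_mul_and_not_dvd
    (Fintype.card_ne_zero (α := G ⧸ N)) p (Fact.out : p.Prime).ne_one
  rw [hkn] at hb
  choose b' hb' using fun g => wittLim.exists_nsmul_of_not_dvd hS hn (b g)
  have hb'' : ∀ g h, p ^ k • c g h = limAct σ hS hχ.1 g (b' h) + b' g - b' (g * h) := fun g h =>
    sub_eq_zero.1 (wittLim.eq_zero_of_nsmul_of_not_dvd hS hn (defect_of_nsmul hb hb' g h))
  have hbN' : ∀ g ∈ N, b' g = 0 := fun g hg =>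
    wittLim.eq_zero_of_nsmul_of_not_dvd hS hn ((hb' g).trans (hbN g hg))
  obtain ⟨β, hβ, hβ', hβ''⟩ := exists_lim_lift σ hS hχ k (z := b')
    (fun g h => (congrArg (wittLim.pr k) (cocycle_defect_eq hb'' g h)).trans
      (wittLim.pr_pow_nsmul hS _ k))
    ⟨N, hNo, fun g hg => by rw [hbN' g hg, wittLim.pr_zero]⟩
  choose e he using fun g => wittLim.exists_pow_nsmul hS k (hβ' g)
  refine ⟨e, fun g h => sub_eq_zero.1 (wittLim.eq_zero_of_pow_nsmul hS k
    (nsmul_defect_eq_zero hb'' hβ he g h)), fun s => ?_⟩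
  -- Division by `p ^ k` costs `k` levels.
  obtain ⟨N', hN'o, hN'⟩ := hβ'' (s + k)
  refine ⟨N ⊓ N', hNo.inter hN'o, fun g hg => ?_⟩
  rw [← wittLim.pr_pow_nsmul_eq_zero_iff hS _ k, ← he, wittLim.pr_sub, hbN' g hg.1, hN' g hg.2,
    wittLim.pr_zero, sub_zero]

end

end SmoothProfinite

/-! ### Splitting the extension when an open subgroup acts trivially at all levels -/

namespace SmoothProfinite

noncomputable section

set_option linter.unusedSectionVars false

variable {p : ℕ} [Fact p.Prime] {S : Scheme.{u}} {L : S.Modules} {P : WittTorsor p L}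
variable {G : Type v} [Group G] [TopologicalSpace G] {A : GSchemeAction G S}

theorem GSchemeAction.image_mul_of_mem_ker (A : GSchemeAction G S) (g : G) {n : G}
    (hn : n ∈ A.toAut.ker) (U : S.Opens) : A.image (g * n) U = A.image g U := by
  rw [A.image_mul, A.image_eq_of_mem_ker hn]

theorem GSchemeAction.image_mul_of_mem_ker_left (A : GSchemeAction G S) (g : G) {n : G}
    (hn : n ∈ A.toAut.ker) (U : S.Opens) : A.image (n * g) U = A.image g U := by
  rw [A.image_mul, A.image_eq_of_mem_ker hn]

theorem GSchemeAction.GStructure.act_mul_of_trivial {M : TopCat.Presheaf Ab.{u} S}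
    (τ : A.GStructure M) {n : G} (hn : n ∈ A.toAut.ker)
    (hact : ∀ {U V : S.Opens} (h : V ≤ A.image n U) (h' : V ≤ U) (m : M.obj (op U)),
      τ.act n h m = M.map (homOfLE h').op m) (g : G) {U V : S.Opens} (h : V ≤ A.image (g * n) U)
    (h' : V ≤ A.image g U) (m : M.obj (op U)) : τ.act (g * n) h m = τ.act g h' m := by
  rw [← τ.act_mul g n h' (A.image_eq_of_mem_ker hn U).ge h, hact _ le_rfl, τ.act_res g h' le_rfl h']

namespace LimHom

variable {T : ∀ s, A.GStructure (wittLine p L s)}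

/-- A multiplicative and naive family of semilinear automorphisms. -/
structure IsSplitting (ρ : ∀ g, LimHom T P g) : Prop where
  map_map : ∀ (g g' : G) (s : ℕ) {U V W : S.Opens} (h : W ≤ A.image g V) (h' : V ≤ A.image g' U)
    (h'' : W ≤ A.image (g * g') U) (x : (P.level s).sheaf.1.obj (op U)),
    ((ρ g).level s).map h (((ρ g').level s).map h' x) = ((ρ (g * g')).level s).map h'' x
  exists_open : ∀ s, ∃ N : Subgroup G, IsOpen (N : Set G) ∧ N ≤ A.toAut.ker ∧
    ∀ g ∈ N, ∀ {U V : S.Opens} (h : V ≤ A.image g U) (h' : V ≤ U)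
      (x : (P.level s).sheaf.1.obj (op U)), ((ρ g).level s).map h x = (P.level s).res h' x

theorem map_congr (e : ∀ g, LimHom T P g) {g g' : G} (hg : g = g') (s : ℕ) {U V : S.Opens}
    (h : V ≤ A.image g U) (h' : V ≤ A.image g' U) (x : (P.level s).sheaf.1.obj (op U)) :
    ((e g).level s).map h x = ((e g').level s).map h' x := by
  subst hg
  rfl

/-- A family of semilinear automorphisms which is invariant under a normal subgroup acting
trivially. -/
theorem exists_invariant_family (N : Subgroup G) [N.Normal] (hN : N ≤ A.toAut.ker)
    (hact : ∀ n ∈ N, ∀ s {U V : S.Opens} (h : V ≤ A.image n U) (h' : V ≤ U)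
      (m : (wittLine p L s).obj (op U)), (T s).act n h m = (wittLine p L s).map (homOfLE h').op m)
    (hT : ∀ g, Nonempty (LimHom T P g)) :
    ∃ e : ∀ g, LimHom T P g,
      (∀ g, ∀ n ∈ N, ∀ s {U V : S.Opens} (h : V ≤ A.image (g * n) U) (h' : V ≤ A.image g U)
        (x : (P.level s).sheaf.1.obj (op U)),
        ((e (g * n)).level s).map h x = ((e g).level s).map h' x) ∧
      ∀ n ∈ N, ∀ s {U V : S.Opens} (h : V ≤ A.image n U) (h' : V ≤ U)
        (x : (P.level s).sheaf.1.obj (op U)), ((e n).level s).map h x = (P.level s).res h' x := by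
  -- One map is chosen for each coset, the identity for the trivial one. It serves for all elements
  -- of the coset, since elements of `N` act trivially and do not change the meaning of
  -- semilinearity.
  have hF : ∀ q : G ⧸ N, ∃ F : LimHom T P q.out, q = 1 → ∀ s {U V : S.Opens}
      (h : V ≤ A.image q.out U) (h' : V ≤ U) (x : (P.level s).sheaf.1.obj (op U)),
      (F.level s).map h x = (P.level s).res h' x := fun q => by
    by_cases hq : q = 1
    · have hqN : q.out ∈ N := by
        rw [← QuotientGroup.eq_one_iff, QuotientGroup.out_eq', hq]
      exact ⟨⟨fun s => SemiHom.refl (A.image_eq_of_mem_ker (hN hqN)) (hact _ hqN s),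
        fun s {U V} h x => P.red_res s _ x⟩, fun _ s {U V} h h' x => rfl⟩
    · obtain ⟨F⟩ := hT q.out
      exact ⟨F, fun h => absurd h hq⟩
  choose F hF using hF
  have hout : ∀ g : G, ∃ n ∈ N, g = (g : G ⧸ N).out * n := fun g =>
    ⟨(g : G ⧸ N).out⁻¹ * g, QuotientGroup.eq.1 (QuotientGroup.out_eq' _), by
      rw [mul_inv_cancel_left]⟩
  have hi : ∀ g : G, ∀ U, A.image g U = A.image (g : G ⧸ N).out U := fun g U => by
    obtain ⟨n, hn, hg⟩ := hout g
    conv_lhs => rw [hg]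
    exact A.image_mul_of_mem_ker _ (hN hn) U
  have ha : ∀ g s {U V : S.Opens} (h : V ≤ A.image g U) (h' : V ≤ A.image (g : G ⧸ N).out U)
      (m : (wittLine p L s).obj (op U)), (T s).act g h m = (T s).act (g : G ⧸ N).out h' m :=
    fun g s {U V} h h' m => by
      obtain ⟨n, hn, hg⟩ := hout g
      rw [(T s).act_congr hg h (by rw [← hg]; exact h),
        (T s).act_mul_of_trivial (hN hn) (hact n hn s)]
  have key : ∀ {q q' : G ⧸ N} (_ : q = q') s {U V : S.Opens} (h : V ≤ A.image q.out U)
      (h' : V ≤ A.image q'.out U) (x : (P.level s).sheaf.1.obj (op U)),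
      ((F q).level s).map h x = ((F q').level s).map h' x := by
    rintro q _ rfl s U V h h' x
    rfl
  refine ⟨fun g => (F g).congr (hi g) (ha g), fun g n hn s {U V} h h' x => key ?_ s _ _ x,
    fun n hn s {U V} h h' x => hF n ((QuotientGroup.eq_one_iff n).2 hn) s _ h' x⟩
  rw [QuotientGroup.mk_mul, (QuotientGroup.eq_one_iff n).2 hn, mul_one]

end LimHom

section Splitting

variable (σ : A.Linearization L) {χ : G →* ℤ_[p]ˣ} (hS : IsPerfectOfChar p S)

theorem LimHom.map_shift {hχ : Continuous χ} {g : G}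
    (f : LimHom (σ.wittTwist p hS.char_eq hχ) P g) (m : wittLim p L) (s : ℕ) {U V : S.Opens}
    (h : V ≤ A.image g U) (x : (P.level s).sheaf.1.obj (op U)) :
    (f.level s).map h ((P.level s).shift (wittLim.pr s m) x) =
      (P.level s).shift (wittLim.pr s (limAct σ hS hχ g m)) ((f.level s).map h x) :=
  (f.level s).map_shift _ h x

theorem WittTorsor.shift_shift (P : WittTorsor p L) (m n : wittLim p L) (s : ℕ) {U : S.Opens}
    (x : (P.level s).sheaf.1.obj (op U)) :
    (P.level s).shift (wittLim.pr s m) ((P.level s).shift (wittLim.pr s n) x) =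
      (P.level s).shift (wittLim.pr s (m + n)) x := (P.level s).shift_shift _ _ x

theorem WittTorsor.shift_zero (P : WittTorsor p L) (s : ℕ) {U : S.Opens}
    (x : (P.level s).sheaf.1.obj (op U)) :
    (P.level s).shift (wittLim.pr s (0 : wittLim p L)) x = x := (P.level s).shift_zero x

section Factor

variable {hχ : Continuous χ} {e : ∀ g, LimHom (σ.wittTwist p hS.char_eq hχ) P g}
  {c : G → G → wittLim p L}
  (hc : ∀ g h s {U V W : S.Opens} (h₁ : W ≤ A.image g V) (h₂ : V ≤ A.image h U)
    (h₃ : W ≤ A.image (g * h) U) (x : (P.level s).sheaf.1.obj (op U)),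
    ((e g).level s).map h₁ (((e h).level s).map h₂ x) =
      (P.level s).shift (wittLim.pr s (c g h)) (((e (g * h)).level s).map h₃ x))

include hc

-- Both sides compare `e g ∘ e h ∘ e k` with `e (g * h * k)`, for the two ways of bracketing.
set_option maxHeartbeats 1000000 in
theorem LimHom.factor_cocycle (g h k : G) :
    c g h + c (g * h) k = limAct σ hS hχ g (c h k) + c g (h * k) := by
  refine (e (g * h * k)).shift_ext fun s {U V} h' x => ?_
  have h₁ : V ≤ A.image (g * h) (A.image k U) := by rwa [← A.image_mul]
  have h₂ : V ≤ A.image g (A.image h (A.image k U)) := by rwa [← A.image_mul]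
  have h₄ : V ≤ A.image (g * (h * k)) U := by rwa [← mul_assoc]
  have h₅ : A.image h (A.image k U) ≤ A.image (h * k) U := (A.image_mul h k U).ge
  rw [← P.shift_shift, ← hc _ _ s h₁ le_rfl, ← hc _ _ s h₂ le_rfl, hc h k s le_rfl le_rfl h₅,
    LimHom.map_shift σ hS, hc g (h * k) s h₂ h₅ h₄, P.shift_shift, map_congr e (mul_assoc g h k)]

theorem LimHom.factor_mul (N : Subgroup G) (hN : N ≤ A.toAut.ker)
    (heN : ∀ g, ∀ n ∈ N, ∀ s {U V : S.Opens} (h : V ≤ A.image (g * n) U) (h' : V ≤ A.image g U)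
        (x : (P.level s).sheaf.1.obj (op U)),
        ((e (g * n)).level s).map h x = ((e g).level s).map h' x) (g h n : G) (hn : n ∈ N) :
    c g (h * n) = c g h := by
  refine (e (g * h)).shift_ext fun s {U V} h' x => ?_
  have h₁ : V ≤ A.image g (A.image h U) := by rwa [← A.image_mul]
  have h₂ : A.image h U ≤ A.image (h * n) U := (A.image_mul_of_mem_ker h (hN hn) U).ge
  have h₃ : V ≤ A.image (g * h * n) U := h'.trans (A.image_mul_of_mem_ker _ (hN hn) U).ge
  have h₄ : V ≤ A.image (g * (h * n)) U := by rwa [← mul_assoc]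
  rw [← hc g h s h₁ le_rfl, ← heN _ n hn s h₃, map_congr e (mul_assoc g h n) s h₃ h₄,
    ← hc g (h * n) s h₁ h₂, heN h n hn s h₂ le_rfl]

/-- By normality `n * k = k * n'` with `n' ∈ N`, so `e (n * k)` is `e k`; and `e n` is the identity.
-/
theorem LimHom.factor_eq_zero (N : Subgroup G) [hNn : N.Normal] (hN : N ≤ A.toAut.ker)
    (heN : ∀ g, ∀ n ∈ N, ∀ s {U V : S.Opens} (h : V ≤ A.image (g * n) U) (h' : V ≤ A.image g U)
        (x : (P.level s).sheaf.1.obj (op U)),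
        ((e (g * n)).level s).map h x = ((e g).level s).map h' x)
    (heN' : ∀ n ∈ N, ∀ s {U V : S.Opens} (h : V ≤ A.image n U) (h' : V ≤ U)
        (x : (P.level s).sheaf.1.obj (op U)), ((e n).level s).map h x = (P.level s).res h' x)
    (n : G) (hn : n ∈ N) (k : G) : c n k = 0 := by
  refine (e (n * k)).shift_ext fun s {U V} h' x => ?_
  have hn' : k⁻¹ * n * k ∈ N := by simpa using hNn.conj_mem n hn k⁻¹
  have hnk : n * k = k * (k⁻¹ * n * k) := by group
  have h₁ : V ≤ A.image k U := h'.trans (A.image_mul_of_mem_ker_left k (hN hn) U).le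
  have h₂ : V ≤ A.image (k * (k⁻¹ * n * k)) U := by rwa [← hnk]
  have h₃ : V ≤ A.image n V := (A.image_eq_of_mem_ker (hN hn) V).ge
  rw [P.shift_zero, ← hc n k s h₃ h₁, heN' n hn s h₃ le_rfl, Torsor.res_self,
    map_congr e hnk s h' h₂, heN _ _ hn' s h₂ h₁]

end Factor

/-- The semilinear automorphisms of a `W(L)(1)`-torsor with invariant class can be chosen in a
multiplicative and naive way, if the character `χ` has finite order. -/
theorem LimHom.exists_isSplitting_of_trivial [IsTopologicalGroup G] [CompactSpace G]
    [TotallyDisconnectedSpace G] (hχ : IsOneInftyCyclotomic p χ) (N : Subgroup G) [N.Normal]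
    (hNo : IsOpen (N : Set G)) (hN : N ≤ A.toAut.ker)
    (hact : ∀ n ∈ N, ∀ s {U V : S.Opens} (h : V ≤ A.image n U) (h' : V ≤ U)
      (m : (wittLine p L s).obj (op U)), (σ.wittTwist p hS.char_eq hχ.1 s).act n h m =
        (wittLine p L s).map (homOfLE h').op m)
    (hT : ∀ g, Nonempty (LimHom (σ.wittTwist p hS.char_eq hχ.1) P g)) :
    ∃ ρ : ∀ g, LimHom (σ.wittTwist p hS.char_eq hχ.1) P g, LimHom.IsSplitting ρ := by
  obtain ⟨e, heN, heN'⟩ := LimHom.exists_invariant_family N hN hact hT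
  choose c hc using fun g h => LimHom.exists_shift_eq hS (e (g * h)) ((e g).comp (e h))
  have hc' : ∀ g h s {U V W : S.Opens} (h₁ : W ≤ A.image g V) (h₂ : V ≤ A.image h U)
      (h₃ : W ≤ A.image (g * h) U) (x : (P.level s).sheaf.1.obj (op U)),
      ((e g).level s).map h₁ (((e h).level s).map h₂ x) =
        (P.level s).shift (wittLim.pr s (c g h)) (((e (g * h)).level s).map h₃ x) :=
    fun g h s {U V W} h₁ h₂ h₃ x => by rw [← hc g h s h₃, LimHom.comp_map]
  obtain ⟨ε, hε, hε'⟩ := exists_defect_eq σ hS hχ c (LimHom.factor_cocycle σ hS hc') N hNo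
    (fun g h n hn => LimHom.factor_mul σ hS hc' N hN heN g h n hn)
    (LimHom.factor_eq_zero σ hS hc' N hN heN heN')
  -- As `e g ∘ e h` is `c g h + e (g * h)` and `c` is the coboundary of `ε`, the translation by `-ε
  -- g` removes the defect.
  refine ⟨fun g => (e g).shift (-ε g), fun g h s {U V W} h₁ h₂ h₃ x => ?_, fun s => ?_⟩
  · rw [LimHom.shift_map, LimHom.shift_map, LimHom.shift_map, LimHom.map_shift σ hS, hc' g h s h₁ h₂ h₃,
      P.shift_shift, P.shift_shift]
    exact congrArg (fun m => (P.level s).shift (wittLim.pr s m) _) (neg_add_defect_eq hε g h)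
  · obtain ⟨N', hN'o, hN'⟩ := hε' s
    refine ⟨N ⊓ N', hNo.inter hN'o, inf_le_left.trans hN, fun g hg U V h h' x => ?_⟩
    rw [LimHom.shift_map, heN' g hg.1 s h h', wittLim.pr_neg, hN' g hg.2, neg_zero]
    exact (P.level s).shift_zero _

end Splitting

end

end SmoothProfinite

/-! ### Splitting the extension by an element that acts as a nontrivial scalar -/

namespace SmoothProfinite

noncomputable section

set_option linter.unusedSectionVars false

variable {p : ℕ} [Fact p.Prime] {S : Scheme.{u}} {L : S.Modules} {P : WittTorsor p L}

theorem wittLim.padicSmul_sub_self (hS : IsPerfectOfChar p S) (a : ℤ_[p]) (m : wittLim p L) :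
    padicSmul hS a m - m = padicSmul hS (a - 1) m := by
  refine sub_eq_iff_eq_add.2 (wittLim.ext fun s => ?_)
  have h := padicSmul_add (pow_nsmul_wittSections hS (pr s m)) (a - 1) 1
  rw [sub_add_cancel, SmoothProfinite.padicSmul_one (pow_nsmul_wittSections hS _)] at h
  exact h

variable {G : Type v} [Group G] [TopologicalSpace G] {A : GSchemeAction G S}
  (σ : A.Linearization L) {χ : G →* ℤ_[p]ˣ} (hS : IsPerfectOfChar p S)

/-- The action of `g` on `S` and on `L` is trivial. -/
structure GSchemeAction.Linearization.ActsTrivially (g : G) : Prop where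
  mem_ker : g ∈ A.toAut.ker
  act_inv : ∀ {U V : S.Opens} (h : V ≤ A.image g⁻¹ U) (h' : V ≤ U) (x : Γ(L, U)),
    σ.act g⁻¹ h x = L.presheaf.map (homOfLE h').op x

variable {σ} in
theorem GSchemeAction.Linearization.ActsTrivially.twist_act {hp : (p : Γ(S, ⊤)) = 0}
    {hχ : Continuous χ} {g : G} (hg : σ.ActsTrivially g) (s : ℕ) {U V : S.Opens}
    (h : V ≤ A.image g U) (h' : V ≤ U) (m : (wittLine p L s).obj (op U)) :
    (σ.wittTwist p hp hχ s).act g h m =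
      padicSmul s (χ g : ℤ_[p]) ((wittLine p L s).map (homOfLE h').op m) :=
  (wittTwist_apply σ hp hχ s g h m).trans
    (congrArg _ (σ.wittAct_of_trivial p s hg.mem_ker hg.act_inv h h' m))

variable {σ} in
theorem GSchemeAction.Linearization.ActsTrivially.twist_act_eq (hS : IsPerfectOfChar p S)
    {hχ : Continuous χ} {g : G} (hg : σ.ActsTrivially g) {s : ℕ}
    (hs : PadicInt.toZModPow s (χ g : ℤ_[p]) = 1) {U V : S.Opens}
    (h : V ≤ A.image g U) (h' : V ≤ U) (m : (wittLine p L s).obj (op U)) :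
    (σ.wittTwist p hS.char_eq hχ s).act g h m = (wittLine p L s).map (homOfLE h').op m := by
  rw [hg.twist_act s h h']
  refine (padicSmul_eq (n := 1) (pow_nsmul_wittSections hS _) ?_).trans (one_nsmul _)
  rw [hs, Nat.cast_one]

variable {σ} in
theorem GSchemeAction.Linearization.ActsTrivially.limAct_eq {hχ : Continuous χ} {g : G}
    (hg : σ.ActsTrivially g) (m : wittLim p L) :
    limAct σ hS hχ g m = wittLim.padicSmul hS (χ g : ℤ_[p]) m :=
  wittLim.ext fun s => by
    rw [pr_limAct_eq, wittTwistEnd_apply, wittEnd_of_trivial σ hg.mem_ker hg.act_inv]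
    rfl

theorem GSchemeAction.Linearization.exists_actsTrivially :
    ∃ N : Subgroup G, IsOpen (N : Set G) ∧ ∀ g ∈ N, σ.ActsTrivially g := by
  obtain ⟨N, hN, hN', hact⟩ := σ.exists_open
  exact ⟨N, hN, fun g hg => ⟨hN' hg, fun h h' x => hact g⁻¹ (inv_mem hg) h h' x⟩⟩

-- On `W(L)(1)` the element `n` acts as the scalar `χ n = 1 + v p ^ a` with `v` a unit. So `n - 1`
-- is `p ^ a` times an automorphism: its image is the kernel of the reduction to level `a`, and it
-- is injective with a loss of `a` levels.
variable {σ} in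
theorem exists_limAct_sub_self (hχ : Continuous χ) {n : G} (hn : σ.ActsTrivially n)
    (hχn : χ n ≠ 1) : ∃ a : ℕ, PadicInt.toZModPow a (χ n : ℤ_[p]) = 1 ∧
      (∀ D : wittLim p L, wittLim.pr a D = 0 → ∃ m, limAct σ hS hχ n m - m = D) ∧
      ∀ (s : ℕ) (m : wittLim p L), wittLim.pr (s + a) (limAct σ hS hχ n m - m) = 0 →
        wittLim.pr s m = 0 := by
  have hu : (χ n : ℤ_[p]) - 1 ≠ 0 := sub_ne_zero.2 fun h => hχn (Units.ext h)
  let v := PadicInt.unitCoeff hu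
  let a := ((χ n : ℤ_[p]) - 1).valuation
  have hv : (χ n : ℤ_[p]) - 1 = v * (p : ℤ_[p]) ^ a := PadicInt.unitCoeff_spec hu
  have hlim : ∀ m : wittLim p L, limAct σ hS hχ n m - m = p ^ a • wittLim.padicSmul hS v m :=
    fun m => by
      rw [hn.limAct_eq hS, wittLim.padicSmul_sub_self, hv, mul_comm, ← wittLim.padicSmul_padicSmul,
        ← Nat.cast_pow, wittLim.padicSmul_natCast]
  refine ⟨a, ?_, fun D hD => ?_, fun s m hm => ?_⟩
  · have h1 : (χ n : ℤ_[p]) - 1 ∈ RingHom.ker (PadicInt.toZModPow a : ℤ_[p] →+* ZMod (p ^ a)) := by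
      rw [PadicInt.ker_toZModPow, Ideal.mem_span_singleton, hv]
      exact dvd_mul_left _ _
    rw [RingHom.mem_ker, map_sub, map_one, sub_eq_zero] at h1
    exact h1
  · obtain ⟨y, rfl⟩ := wittLim.exists_pow_nsmul hS a hD
    refine ⟨wittLim.padicSmul hS (v⁻¹ : ℤ_[p]ˣ) y, ?_⟩
    rw [hlim, wittLim.padicSmul_padicSmul, Units.mul_inv, wittLim.padicSmul_one]
  · rw [hlim, wittLim.pr_pow_nsmul_eq_zero_iff hS, wittLim.pr_padicSmul] at hm
    have h2 : wittLim.pr s (wittLim.padicSmul hS (v⁻¹ : ℤ_[p]ˣ) (wittLim.padicSmul hS v m)) = 0 := by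
      rw [wittLim.pr_padicSmul, wittLim.pr_padicSmul, hm]
      exact nsmul_zero _
    rwa [wittLim.padicSmul_padicSmul, Units.inv_mul, wittLim.padicSmul_one] at h2

namespace LimHom

variable {T : ∀ s, A.GStructure (wittLine p L s)}

/-- A section of level `s` need not lift over its own domain. Therefore `f` is first shown to be
some translation at level `s`, and this translation is identified on reductions of local sections of
level `s + 1`. -/
theorem map_eq_shift_of_succ (hS : IsPerfectOfChar p S) {g : G} (f : LimHom T P g)
    (hg : g ∈ A.toAut.ker) {s : ℕ}
    (hact : ∀ {U V : S.Opens} (h : V ≤ A.image g U) (h' : V ≤ U) (m : (wittLine p L s).obj (op U)),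
      (T s).act g h m = (wittLine p L s).map (homOfLE h').op m) {m : wittLim p L}
    (hf : ∀ {U V : S.Opens} (h : V ≤ A.image g U) (h' : V ≤ U)
      (x : (P.level (s + 1)).sheaf.1.obj (op U)), (f.level (s + 1)).map h x =
        (P.level (s + 1)).shift (wittLim.pr (s + 1) m) ((P.level (s + 1)).res h' x))
    {U V : S.Opens} (h : V ≤ A.image g U) (h' : V ≤ U) (x : (P.level s).sheaf.1.obj (op U)) :
    (f.level s).map h x = (P.level s).shift (wittLim.pr s m) ((P.level s).res h' x) := by
  let r : SemiHom (T s) g (P.level s) (P.level s) :=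
    SemiHom.refl (A.image_eq_of_mem_ker hg) hact
  obtain ⟨n, hn⟩ := SemiHom.exists_shift_eq hS r (f.level s)
  have hnm : n = wittLim.pr s m := r.shift_ext_of_locally fun z => by
    obtain ⟨U, hU, ⟨y⟩⟩ := (P.level (s + 1)).exists_local z
    refine ⟨U, P.red s y, hU, fun {V} h => ?_⟩
    have hVU : V ≤ U := h.trans (A.image_eq_of_mem_ker hg U).le
    have h1 := congrArg (P.red s) (hf h hVU y)
    rw [f.trans, hn, P.red_shift, wittLim.wred_pr, P.red_res] at h1
    exact h1
  rw [hn, hnm]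
  rfl

/-- At level `s` the identity is also semilinear over `g`, so `f` differs from it by a translation
there, and this translation lifts to `W(L)`. The lower levels follow by descending induction. -/
theorem exists_level_eq_shift (hS : IsPerfectOfChar p S) {g : G} (f : LimHom T P g)
    (hg : g ∈ A.toAut.ker) {s : ℕ}
    (hact : ∀ t ≤ s, ∀ {U V : S.Opens} (h : V ≤ A.image g U) (h' : V ≤ U)
      (m : (wittLine p L t).obj (op U)), (T t).act g h m = (wittLine p L t).map (homOfLE h').op m) :
    ∃ m : wittLim p L, ∀ t ≤ s, ∀ {U V : S.Opens} (h : V ≤ A.image g U) (h' : V ≤ U)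
      (x : (P.level t).sheaf.1.obj (op U)), (f.level t).map h x =
        (P.level t).shift (wittLim.pr t m) ((P.level t).res h' x) := by
  let r : SemiHom (T s) g (P.level s) (P.level s) :=
    SemiHom.refl (A.image_eq_of_mem_ker hg) (hact s le_rfl)
  obtain ⟨n, hn⟩ := SemiHom.exists_shift_eq hS r (f.level s)
  obtain ⟨m, rfl⟩ := wittLim.pr_surjective hS s n
  refine ⟨m, fun t ht => ?_⟩
  induction ht using Nat.decreasingInduction with
  | self => exact fun h h' x => hn h x
  | of_succ t ht ih =>
    exact fun h h' x => f.map_eq_shift_of_succ hS hg (hact t (Nat.le_of_lt ht)) ih h h' x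

end LimHom

section Central

variable {σ} {hχ : Continuous χ} {n : G}

/-- Since `χ n = 1` modulo `p ^ a`, any lift of `n` is a translation at level `a`, and this
translation can be subtracted. -/
theorem LimHom.exists_level_eq_id (hn : σ.ActsTrivially n) {a : ℕ}
    (ha : PadicInt.toZModPow a (χ n : ℤ_[p]) = 1)
    (hT : Nonempty (LimHom (σ.wittTwist p hS.char_eq hχ) P n)) :
    ∃ f : LimHom (σ.wittTwist p hS.char_eq hχ) P n, ∀ {U V : S.Opens} (h : V ≤ A.image n U)
      (h' : V ≤ U) (x : (P.level a).sheaf.1.obj (op U)),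
      (f.level a).map h x = (P.level a).res h' x := by
  obtain ⟨f⟩ := hT
  have hle : ∀ t ≤ a, PadicInt.toZModPow t (χ n : ℤ_[p]) = 1 := fun t ht => by
    rw [← PadicInt.cast_toZModPow t a ht, ha, ZMod.cast_one (pow_dvd_pow p ht)]
  obtain ⟨m, hm⟩ := f.exists_level_eq_shift hS hn.mem_ker fun t ht {U V} h h' x =>
    hn.twist_act_eq hS (hle t ht) h h' x
  refine ⟨f.shift (-m), fun h h' x => ?_⟩
  rw [LimHom.shift_map, hm a le_rfl h h', P.shift_shift, neg_add_cancel, P.shift_zero]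

/-- The property of commuting with a given automorphism. -/
def LimHom.Commutes {T : ∀ s, A.GStructure (wittLine p L s)} (f : LimHom T P n) {g : G}
    (E : LimHom T P g) : Prop :=
  ∀ s {U U' V V' : S.Opens} (h : V ≤ A.image g U) (h₁ : V' ≤ A.image n V)
    (h₂ : U' ≤ A.image n U) (h₃ : V' ≤ A.image g U') (x : (P.level s).sheaf.1.obj (op U)),
    (f.level s).map h₁ ((E.level s).map h x) = (E.level s).map h₃ ((f.level s).map h₂ x)

variable (hn : σ.ActsTrivially n) {a : ℕ} {f : LimHom (σ.wittTwist p hS.char_eq hχ) P n}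

/-- The element `n` acts by a scalar, which commutes with every action map. So `n` behaves as a
central element, although it need not be central in `G`. -/
theorem twist_act_mul_comm (hn : σ.ActsTrivially n) (hp : (p : Γ(S, ⊤)) = 0) (g : G) (s : ℕ)
    {U V : S.Opens} (h : V ≤ A.image (n * g) U) (h' : V ≤ A.image (g * n) U)
    (m : (wittLine p L s).obj (op U)) :
    (σ.wittTwist p hp hχ s).act (n * g) h m = (σ.wittTwist p hp hχ s).act (g * n) h' m := by
  have h₁ : V ≤ A.image g U := h'.trans (A.image_mul_of_mem_ker g hn.mem_ker U).le
  have h₂ : V ≤ A.image n V := (A.image_eq_of_mem_ker hn.mem_ker V).ge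
  have h₃ : U ≤ A.image n U := (A.image_eq_of_mem_ker hn.mem_ker U).ge
  rw [← (σ.wittTwist p hp hχ s).act_mul n g h₂ h₁ h, ← (σ.wittTwist p hp hχ s).act_mul g n h₁ h₃ h',
    hn.twist_act s h₂ le_rfl, hn.twist_act s h₃ le_rfl]
  refine Eq.trans ?_ (map_nsmul ((σ.wittTwist p hp hχ s).act g h₁) _ _).symm
  refine congrArg (padicSmul s (χ n : ℤ_[p])) ?_
  rw [(σ.wittTwist p hp hχ s).res_act, (σ.wittTwist p hp hχ s).act_res g h₁ le_rfl h₁]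

include hn

/-- The actions of `n * g` and `g * n` coincide, so `f ∘ E` and `E ∘ f` are semilinear over the same
action and differ by a translation. -/
theorem LimHom.exists_commutator (g : G) (E : LimHom (σ.wittTwist p hS.char_eq hχ) P g) :
    ∃ D : wittLim p L, ∀ s {U U' V V' : S.Opens} (h : V ≤ A.image g U) (h₁ : V' ≤ A.image n V)
      (h₂ : U' ≤ A.image n U) (h₃ : V' ≤ A.image g U') (x : (P.level s).sheaf.1.obj (op U)),
      (f.level s).map h₁ ((E.level s).map h x) =
        (P.level s).shift (wittLim.pr s D) ((E.level s).map h₃ ((f.level s).map h₂ x)) := by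
  obtain ⟨D, hD⟩ := LimHom.exists_shift_eq hS
    ((E.comp f).congr (g' := n * g) (fun U => by
      rw [A.image_mul_of_mem_ker g hn.mem_ker, A.image_mul_of_mem_ker_left g hn.mem_ker])
      fun s {U V} h h' m => twist_act_mul_comm hn hS.char_eq g s h h' m) (f.comp E)
  refine ⟨D, fun s {U U' V V'} h h₁ h₂ h₃ x => ?_⟩
  have h₄ : V' ≤ A.image (n * g) U := by
    rw [A.image_mul]
    exact h₁.trans (A.image_mono n h)
  have h₅ : V' ≤ A.image (g * n) U := by
    rw [A.image_mul]
    exact h₃.trans (A.image_mono g h₂)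
  rw [← LimHom.comp_map f E s h₁ h h₄, hD s h₄, ← LimHom.comp_map E f s h₃ h₂ h₅]
  rfl

/-- Replacing `E` by `m + E` adds `n m - m` to the commutator `D`. At level `a` the map `f` is the
identity, so `D` vanishes there and is of the form that can be cancelled. -/
theorem LimHom.exists_commutes (ha : ∀ D : wittLim p L, wittLim.pr a D = 0 →
      ∃ m, limAct σ hS hχ n m - m = D)
    (hf : ∀ {U V : S.Opens} (h : V ≤ A.image n U)
      (h' : V ≤ U) (x : (P.level a).sheaf.1.obj (op U)),
      (f.level a).map h x = (P.level a).res h' x) {g : G}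
    (hT : Nonempty (LimHom (σ.wittTwist p hS.char_eq hχ) P g)) :
    ∃ E : LimHom (σ.wittTwist p hS.char_eq hχ) P g, f.Commutes E := by
  obtain ⟨E⟩ := hT
  obtain ⟨D, hD⟩ := LimHom.exists_commutator hS hn g E (f := f)
  have hD0 : wittLim.pr a D = 0 := (E.level a).shift_ext fun {U V} h x => by
    have h₁ : V ≤ A.image n V := (A.image_eq_of_mem_ker hn.mem_ker V).ge
    have h₂ : U ≤ A.image n U := (A.image_eq_of_mem_ker hn.mem_ker U).ge
    have h3 := hD a h h₁ h₂ h x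
    rw [hf h₁ le_rfl, hf h₂ le_rfl, Torsor.res_self, Torsor.res_self] at h3
    rw [← h3, Torsor.shift_zero]
  obtain ⟨m, hm⟩ := ha (-D) (by rw [wittLim.pr_neg, hD0, neg_zero])
  refine ⟨E.shift m, fun s {U U' V V'} h h₁ h₂ h₃ x => ?_⟩
  rw [LimHom.shift_map, LimHom.shift_map, LimHom.map_shift σ hS, hD s h h₁ h₂ h₃, P.shift_shift]
  exact congrArg (fun m => (P.level s).shift (wittLim.pr s m) _)
    (by rw [← sub_eq_zero, add_sub_right_comm, hm, neg_add_cancel])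

variable (ha : ∀ (s : ℕ) (m : wittLim p L), wittLim.pr (s + a) (limAct σ hS hχ n m - m) = 0 →
        wittLim.pr s m = 0)

include ha

/-- The translation by which two such lifts differ is fixed by `n`, hence zero. -/
theorem LimHom.eq_of_commutes {g : G} {E E' : LimHom (σ.wittTwist p hS.char_eq hχ) P g}
    (hE : f.Commutes E) (hE' : f.Commutes E') (s : ℕ) {U V : S.Opens} (h : V ≤ A.image g U)
    (x : (P.level s).sheaf.1.obj (op U)) : (E'.level s).map h x = (E.level s).map h x := by
  obtain ⟨D, hD⟩ := LimHom.exists_shift_eq hS E E'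
  have h1 : limAct σ hS hχ n D = D := (f.comp E).shift_ext fun s {U V} h x => by
    have h₁ : V ≤ A.image n V := (A.image_eq_of_mem_ker hn.mem_ker V).ge
    have h₂ : U ≤ A.image n U := (A.image_eq_of_mem_ker hn.mem_ker U).ge
    have h₃ : V ≤ A.image g U := h.trans (A.image_mul_of_mem_ker_left g hn.mem_ker U).le
    rw [LimHom.comp_map f E s h₁ h₃ h, ← LimHom.map_shift σ hS, ← hD, hE' s h₃ h₁ h₂ h₃, hD,
      hE s h₃ h₁ h₂ h₃]
  have h2 : D = 0 := wittLim.ext fun s => ha s D (by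
    rw [h1, sub_self, wittLim.pr_zero])
  rw [hD, h2, P.shift_zero]

/-- A composite of lifts commuting with `f` commutes with `f`, so uniqueness forces
multiplicativity. The same argument at a finite level gives naivety. -/
theorem LimHom.isSplitting_of_commutes [IsTopologicalGroup G]
    {ρ : ∀ g, LimHom (σ.wittTwist p hS.char_eq hχ) P g} (hρ : ∀ g, f.Commutes (ρ g)) :
    LimHom.IsSplitting ρ := by
  refine ⟨fun g g' s {U V W} h h' h'' x => ?_, fun s => ?_⟩
  · have hc : f.Commutes ((ρ g).comp (ρ g')) := fun s {U U' V V'} h h₁ h₂ h₃ x => by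
      have k₁ : V ≤ A.image g (A.image g' U) := by rwa [← A.image_mul]
      have k₂ : V' ≤ A.image g (A.image g' U') := by rwa [← A.image_mul]
      have k₃ : A.image g' U' ≤ A.image n (A.image g' U) := by
        rw [← A.image_mul, A.image_mul_of_mem_ker_left g' hn.mem_ker]
        exact A.image_mono g' (h₂.trans (A.image_eq_of_mem_ker hn.mem_ker U).le)
      rw [LimHom.comp_map _ _ s k₁ le_rfl h, LimHom.comp_map _ _ s k₂ le_rfl h₃,
        hρ g s k₁ h₁ k₃ k₂, hρ g' s le_rfl k₃ h₂ le_rfl]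
    rw [← LimHom.comp_map _ _ s h h' h'']
    exact LimHom.eq_of_commutes hS hn ha (hρ (g * g')) hc s h'' x
  · obtain ⟨N, hN, hN'⟩ := σ.exists_actsTrivially
    -- On this subgroup `ρ g` is a translation by some `D` at level `s + a`. Commutation with `f`
    -- gives `n D = D` at that level, hence `D = 0` at level `s` only, whence the shift by `a`.
    refine ⟨N ⊓ (GSchemeAction.Linearization.modChar p χ (s + a)).ker,
      hN.inter (GSchemeAction.Linearization.isOpen_ker_modChar p hχ _),
      fun g hg => (hN' g hg.1).mem_ker, fun g hg {U V} h h' x => ?_⟩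
    have hg1 : PadicInt.toZModPow (s + a) (χ g : ℤ_[p]) = 1 := by
      have := congrArg Units.val (MonoidHom.mem_ker.1 hg.2)
      exact this
    have hle : ∀ t ≤ s + a, PadicInt.toZModPow t (χ g : ℤ_[p]) = 1 := fun t ht => by
      rw [← PadicInt.cast_toZModPow t (s + a) ht, hg1, ZMod.cast_one (pow_dvd_pow p ht)]
    obtain ⟨D, hD⟩ := (ρ g).exists_level_eq_shift hS (hN' g hg.1).mem_ker fun t ht {U V} h h' x =>
      (hN' g hg.1).twist_act_eq hS (hle t ht) h h' x
    have h1 : wittLim.pr (s + a) (limAct σ hS hχ n D) = wittLim.pr (s + a) D :=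
      (f.level (s + a)).shift_ext fun {U V} h x => by
        have h₁ : U ≤ A.image g U := (A.image_eq_of_mem_ker (hN' g hg.1).mem_ker U).ge
        have h₂ : V ≤ A.image g V := (A.image_eq_of_mem_ker (hN' g hg.1).mem_ker V).ge
        have h3 := hρ g (s + a) h₁ h h h₂ x
        rw [hD _ le_rfl h₁ le_rfl, hD _ le_rfl h₂ le_rfl, Torsor.res_self, Torsor.res_self,
          LimHom.map_shift σ hS] at h3
        exact h3
    rw [hD s (Nat.le_add_right s a) h h', ha s D (by rw [wittLim.pr_sub, h1, sub_self])]
    exact (P.level s).shift_zero _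

end Central

/-- The semilinear automorphisms of a `W(L)(1)`-torsor with invariant class can be chosen in a
multiplicative and naive way. -/
theorem LimHom.exists_isSplitting [IsTopologicalGroup G] [CompactSpace G]
    [TotallyDisconnectedSpace G] (hχ : IsOneInftyCyclotomic p χ)
    (hT : ∀ g, Nonempty (LimHom (σ.wittTwist p hS.char_eq hχ.1) P g)) :
    ∃ ρ : ∀ g, LimHom (σ.wittTwist p hS.char_eq hχ.1) P g, LimHom.IsSplitting ρ := by
  obtain ⟨N₀, hN₀, hN₀'⟩ := σ.exists_actsTrivially
  -- Either an element acting as a nontrivial scalar is available, or `χ` is trivial on an open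
  -- subgroup that acts trivially on `S` and `L`, and the argument with a finite quotient applies.
  by_cases h : ∃ n ∈ N₀, χ n ≠ 1
  · obtain ⟨n, hn, hχn⟩ := h
    obtain ⟨a, ha, ha', ha''⟩ := exists_limAct_sub_self (L := L) hS hχ.1 (hN₀' n hn) hχn
    obtain ⟨f, hf⟩ := LimHom.exists_level_eq_id hS (hN₀' n hn) ha (hT n)
    choose ρ hρ using fun g => LimHom.exists_commutes hS (hN₀' n hn) ha' hf (hT g)
    exact ⟨ρ, LimHom.isSplitting_of_commutes hS (hN₀' n hn) ha'' hρ⟩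
  · push Not at h
    obtain ⟨N, hNn, hN, hN'⟩ := exists_open_normal_le hN₀ (one_mem N₀)
    refine LimHom.exists_isSplitting_of_trivial σ hS hχ N hN (fun n hn => (hN₀' n (hN' hn)).mem_ker)
      (fun n hn s {U V} h₁ h₂ m => (hN₀' n (hN' hn)).twist_act_eq hS ?_ h₁ h₂ m) hT
    rw [h n (hN' hn), Units.val_one, map_one]

end

end SmoothProfinite

/-! ### Adjusting a splitting to the given action at level `r` -/

namespace SmoothProfinite

noncomputable section

set_option linter.unusedSectionVars false

variable {p : ℕ} [Fact p.Prime] {S : Scheme.{u}} {L : S.Modules} {P : WittTorsor p L}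
variable {G : Type v} [Group G] [TopologicalSpace G] {A : GSchemeAction G S}
  (σ : A.Linearization L) {χ : G →* ℤ_[p]ˣ} (hS : IsPerfectOfChar p S)

theorem TorsorHom.map_shift {s : ℕ} {Q R : Torsor (wittLine p L s)}
    (f : TorsorHom (𝟙 (wittLine p L s)) Q R) (m : wittSections p L s ⊤) {U : S.Opens}
    (x : Q.sheaf.1.obj (op U)) :
    f.hom.app (op U) (Q.shift m x) = R.shift m (f.hom.app (op U) x) := f.map_vadd _ x

theorem TorsorHom.map_res {M M' : TopCat.Presheaf Ab.{u} S} {φ : M ⟶ M'} {Q : Torsor M}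
    {R : Torsor M'} (f : TorsorHom φ Q R) {U V : S.Opens} (h : V ≤ U) (x : Q.sheaf.1.obj (op U)) :
    f.hom.app (op V) (Q.res h x) = R.res h (f.hom.app (op U) x) :=
  congrArg (fun k => k x) (f.hom.naturality (homOfLE h).op)

set_option maxHeartbeats 1000000 in
/-- A splitting can be corrected such that it lifts a given action on a component. -/
theorem LimHom.exists_isSplitting_lift [IsTopologicalGroup G] [CompactSpace G]
    [TotallyDisconnectedSpace G] (hχ : IsOneInftyCyclotomic p χ)
    {ρ : ∀ g, LimHom (σ.wittTwist p hS.char_eq hχ.1) P g} (hρ : LimHom.IsSplitting ρ) {r : ℕ}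
    {Q : Torsor (wittLine p L r)} (τ : Q.GStructure (σ.wittTwist p hS.char_eq hχ.1 r))
    (ι : TorsorHom (𝟙 (wittLine p L r)) (P.level r) Q) :
    ∃ ρ' : ∀ g, LimHom (σ.wittTwist p hS.char_eq hχ.1) P g, LimHom.IsSplitting ρ' ∧
      ∀ (g : G) {U V : S.Opens} (h : V ≤ A.image g U) (x : (P.level r).sheaf.1.obj (op U)),
        ι.hom.app (op V) (((ρ' g).level r).map h x) = τ.act g h (ι.hom.app (op U) x) := by
  -- The section `m g` measures the failure of `ι` to be equivariant for `g`. Both actions being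
  -- multiplicative and naive, `m` is a naive cocycle in `W_r(L)(1)`; `z` is a cochain in `W(L)`
  -- above it.
  choose m hm using fun g => SemiHom.exists_shift_eq hS (SemiHom.homComp ι ((ρ g).level r))
    (SemiHom.compHom (SemiHom.ofGStructure τ g) ι)
  choose z hz using fun g => wittLim.pr_surjective hS r (m g)
  have hz' : ∀ g {U V : S.Opens} (h : V ≤ A.image g U) (x : (P.level r).sheaf.1.obj (op U)),
      τ.act g h (ι.hom.app (op U) x) =
        Q.shift (wittLim.pr r (z g)) (ι.hom.app (op V) (((ρ g).level r).map h x)) :=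
    fun g {U V} h x => by
      rw [hz]
      exact hm g h x
  obtain ⟨β, hβ, hβ', hβ''⟩ := exists_lim_lift σ hS hχ r (z := z)
    (fun g h => by
      rw [wittLim.pr_sub, sub_eq_zero]
      refine (SemiHom.homComp ι ((ρ (g * h)).level r)).shift_ext fun {U V} h' x => ?_
      have h₁ : V ≤ A.image g (A.image h U) := by rwa [← A.image_mul]
      refine (hz' (g * h) h' x).symm.trans ?_
      rw [← τ.act_mul g h h₁ le_rfl h', hz' h le_rfl x]
      refine ((SemiHom.ofGStructure τ g).map_shift _ h₁ _).trans ?_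
      refine (congrArg (Q.shift _) (hz' g h₁ _)).trans ?_
      refine (Q.shift_shift (wittTwistEnd σ hS hχ.1 r g (wittLim.pr r (z h)))
        (wittLim.pr r (z g)) _).trans ?_
      have h₂ : wittTwistEnd σ hS hχ.1 r g (wittLim.pr r (z h)) + wittLim.pr r (z g) =
          wittLim.pr r (z g + limAct σ hS hχ.1 g (z h)) := by
        rw [wittLim.pr_add, pr_limAct_eq, add_comm]
      exact congrArg₂ (fun a b => Q.shift a (ι.hom.app (op V) b)) h₂
        (hρ.map_map g h r h₁ le_rfl h' x))
    (by
      obtain ⟨N, hN, hN', hact⟩ := hρ.exists_open r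
      obtain ⟨N₁, hN₁, hN₁', hact₁⟩ := τ.exists_open
      refine ⟨N ⊓ N₁, hN.inter hN₁, fun g hg => ?_⟩
      refine (SemiHom.homComp ι ((ρ g).level r)).shift_ext fun {U V} h x => ?_
      have hVU : V ≤ U := h.trans (A.image_eq_of_mem_ker (hN' hg.1) U).le
      refine (hz' g h x).symm.trans ?_
      rw [hact₁ g hg.2 h hVU, Torsor.shift_zero]
      refine (TorsorHom.map_res ι hVU x).symm.trans ?_
      exact congrArg (ι.hom.app (op V)) (hact g hg.1 h hVU x).symm)
  -- The lift `β` of `m` is a cocycle, so translating by it preserves multiplicativity, and at level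
  -- `r` it removes the failure of equivariance.
  refine ⟨fun g => (ρ g).shift (β g), ⟨fun g h s {U V W} h₁ h₂ h₃ x => ?_, fun s => ?_⟩,
    fun g {U V} h x => ?_⟩
  · rw [LimHom.shift_map, LimHom.shift_map, LimHom.shift_map, LimHom.map_shift σ hS,
      P.shift_shift, hρ.map_map g h s h₁ h₂ h₃, hβ g h]
  · obtain ⟨N, hN, hN', hact⟩ := hρ.exists_open s
    obtain ⟨N₁, hN₁, hN₁'⟩ := hβ'' s
    refine ⟨N ⊓ N₁, hN.inter hN₁, inf_le_left.trans hN', fun g hg U V h h' x => ?_⟩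
    rw [LimHom.shift_map, hN₁' g hg.2, Torsor.shift_zero, hact g hg.1 h h']
  · have h1 : wittLim.pr r (β g) = wittLim.pr r (z g) := by
      have := hβ' g
      rw [wittLim.pr_sub, sub_eq_zero] at this
      exact this.symm
    rw [hz', LimHom.shift_map, h1, TorsorHom.map_shift]

/-- The structure of a `(G, W(L))`-torsor given by a splitting. -/
def LimHom.IsSplitting.gStructure {T : ∀ s, A.GStructure (wittLine p L s)}
    {ρ : ∀ g, LimHom T P g} (hρ : LimHom.IsSplitting ρ)
    (hP : ∀ s (z : S), ∃ U : S.Opens, z ∈ U ∧ (∀ g, A.image g U = U) ∧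
      Nonempty ((P.level s).sheaf.1.obj (op U))) : P.GStructure T where
  level s :=
    { act := fun g {_ _} h x => ((ρ g).level s).map h x
      act_one := fun {_ _} h h' x => by
        obtain ⟨N, -, -, hact⟩ := hρ.exists_open s
        exact hact 1 (one_mem N) h h' x
      act_mul := fun g g' {_ _ _} h h' h'' x => hρ.map_map g g' s h h' h'' x
      act_vadd := fun g {_ _} h m x => ((ρ g).level s).map_vadd h m x
      exists_open := hρ.exists_open s
      exists_local_invariant := hP s }
  trans_act s g {_ _} h x := (ρ g).trans s h x

end

end SmoothProfinite

namespace SmoothProfinite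

noncomputable section

set_option linter.unusedSectionVars false

variable {p : ℕ} [Fact p.Prime]

/-! ## Sections of powers of a line bundle, and their cohomology over affine schemes -/

theorem eq_truncate_iterate_verschiebung {R : Type*} [CommRing R] {s : ℕ}
    (x : TruncatedWittVector p (s + 1) R) (hx : ∀ i : Fin s, x.coeff i.castSucc = 0) :
    x = WittVector.truncate (s + 1)
      (WittVector.verschiebung^[s] (WittVector.mk p fun _ => x.coeff (Fin.last s))) := by
  refine TruncatedWittVector.ext fun i => ?_
  rw [WittVector.coeff_truncate]
  induction i using Fin.lastCases with
  | last =>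
    have := WittVector.iterate_verschiebung_coeff
      (WittVector.mk p fun _ => x.coeff (Fin.last s)) s 0
    rw [zero_add] at this
    rw [Fin.val_last, this]
    rfl
  | cast i => rw [hx, Fin.val_castSucc, WittVector.iterate_verschiebung_coeff_eq_zero _ i.2]

/-- Vectors with only a last coordinate are of the form `V^s y`; the operator `V^s` is additive, and
so is the coordinate of index zero. This identifies the kernel of `W_{s+1}(L) → W_s(L)`, as a group,
with the sections of the `p ^ s`-th power of `L`. -/
theorem coeff_add_of_last {R : Type*} [CommRing R] {s : ℕ} (x y : TruncatedWittVector p (s + 1) R)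
    (hx : ∀ i : Fin s, x.coeff i.castSucc = 0) (hy : ∀ i : Fin s, y.coeff i.castSucc = 0)
    (i : Fin (s + 1)) : (x + y).coeff i = x.coeff i + y.coeff i := by
  conv_lhs => rw [eq_truncate_iterate_verschiebung x hx, eq_truncate_iterate_verschiebung y hy,
    ← map_add, ← iterate_map_add, WittVector.coeff_truncate]
  induction i using Fin.lastCases with
  | last =>
    have := WittVector.iterate_verschiebung_coeff
      (WittVector.mk p (fun _ => x.coeff (Fin.last s)) +
        WittVector.mk p fun _ => y.coeff (Fin.last s)) s 0
    rw [zero_add] at this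
    rw [Fin.val_last, this, WittVector.add_coeff_zero]
    rfl
  | cast i => rw [hx, hy, Fin.val_castSucc, WittVector.iterate_verschiebung_coeff_eq_zero _ i.2,
      add_zero]

variable {S : Scheme.{u}} {L : S.Modules}

variable (L) in
/-- The sections of the `q`-th power of the line bundle `L`, given by their coordinates with respect
to the generators of `L`. -/
def powSections (q : ℕ) (U : S.Opens) :
    AddSubgroup (∀ V : {V : S.Opens // V ≤ U}, Gen L V.1 → Γ(S, V.1)) where
  carrier := {f |
    (∀ (V V' : {V : S.Opens // V ≤ U}) (h : V'.1 ≤ V.1) (e : Gen L V.1),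
      f V' (e.res h) = fres h (f V e)) ∧
    (∀ (V : {V : S.Opens // V ≤ U}) (e e' : Gen L V.1) (a : Γ(S, V.1)), e'.1 = a • e.1 →
      f V e = a ^ q * f V e')}
  zero_mem' := ⟨fun V V' h e => by simp only [Pi.zero_apply, map_zero],
    fun V e e' a h => by simp only [Pi.zero_apply, mul_zero]⟩
  add_mem' := by
    rintro f f' ⟨hf, hf₁⟩ ⟨hg, hg₁⟩
    refine ⟨fun V V' h e => ?_, fun V e e' a h => ?_⟩
    · simp only [Pi.add_apply, map_add, hf V V' h e, hg V V' h e]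
    · simp only [Pi.add_apply, mul_add, hf₁ V e e' a h, hg₁ V e e' a h]
  neg_mem' := by
    rintro f ⟨hf, hf₁⟩
    refine ⟨fun V V' h e => ?_, fun V e e' a h => ?_⟩
    · simp only [Pi.neg_apply, map_neg, hf V V' h e]
    · simp only [Pi.neg_apply, mul_neg, hf₁ V e e' a h]

namespace powSections

variable {q : ℕ}

theorem ext {U : S.Opens} {t t' : powSections L q U} (h : ∀ V e, t.1 V e = t'.1 V e) : t = t' :=
  Subtype.ext (funext fun V => funext fun e => h V e)

/-- Restriction. -/
def res {U V : S.Opens} (h : V ≤ U) : powSections L q U →+ powSections L q V where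
  toFun t := ⟨fun W e => t.1 ⟨W.1, W.2.trans h⟩ e,
    fun W W' h' e => t.2.1 ⟨W.1, W.2.trans h⟩ ⟨W'.1, W'.2.trans h⟩ h' e,
    fun W e e' a h' => t.2.2 ⟨W.1, W.2.trans h⟩ e e' a h'⟩
  map_zero' := rfl
  map_add' _ _ := rfl

theorem res_res {U V W : S.Opens} (h : V ≤ U) (h' : W ≤ V) (t : powSections L q U) :
    res h' (res h t) = res (h'.trans h) t := rfl

/-- Multiplication by functions. -/
def smul {U V : S.Opens} (h : V ≤ U) (f : Γ(S, U)) : powSections L q V →+ powSections L q V where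
  toFun t := ⟨fun W e => fres (W.2.trans h) f * t.1 W e,
    fun W W' h' e => by
      beta_reduce
      rw [t.2.1 W W' h' e, map_mul, fres_fres],
    fun W e e' a h' => by
      beta_reduce
      rw [t.2.2 W e e' a h', mul_left_comm]⟩
  map_zero' := ext fun W e => mul_zero _
  map_add' _ _ := ext fun W e => mul_add _ _ _

theorem smul_apply {U V : S.Opens} (h : V ≤ U) (f : Γ(S, U)) (t : powSections L q V)
    (W : {W : S.Opens // W ≤ V}) (e : Gen L W.1) :
    (smul h f t).1 W e = fres (W.2.trans h) f * t.1 W e := rfl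

theorem add_smul {U V : S.Opens} (h : V ≤ U) (f f' : Γ(S, U)) (t : powSections L q V) :
    smul h (f + f') t = smul h f t + smul h f' t := ext fun W e => by
  refine (smul_apply h _ t W e).trans ?_
  rw [map_add, add_mul]
  rfl

theorem mul_smul {U V : S.Opens} (h : V ≤ U) (f f' : Γ(S, U)) (t : powSections L q V) :
    smul h (f * f') t = smul h f (smul h f' t) := ext fun W e => by
  rw [smul_apply, smul_apply, smul_apply, map_mul, mul_assoc]

theorem zero_smul {U V : S.Opens} (h : V ≤ U) (t : powSections L q V) :
    smul h (0 : Γ(S, U)) t = 0 := ext fun W e => by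
  rw [smul_apply, map_zero, zero_mul]
  rfl

theorem one_smul {U V : S.Opens} (h : V ≤ U) (t : powSections L q V) :
    smul h (1 : Γ(S, U)) t = t := ext fun W e => by
  rw [smul_apply, map_one, one_mul]

theorem res_smul {U V W : S.Opens} (h : V ≤ U) (h' : W ≤ V) (f : Γ(S, U))
    (t : powSections L q V) : res h' (smul h f t) = smul (h'.trans h) f (res h' t) := rfl

/-- The coordinate with respect to a generator determines a section. -/
theorem ext_of_gen {V : S.Opens} (e : Gen L V) {t t' : powSections L q V}
    (h : t.1 ⟨V, le_rfl⟩ e = t'.1 ⟨V, le_rfl⟩ e) : t = t' := ext fun W e' => by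
  obtain ⟨a, ha⟩ := (e'.2 W.1 le_rfl).2 (e.res W.2).1
  have he : (e.res W.2).1 = a • e'.1 := by
    refine ha.symm.trans (congrArg (a • ·) ?_)
    exact congrArg (fun k : L.presheaf.obj (op W.1) ⟶ L.presheaf.obj (op W.1) => k e'.1)
        (L.presheaf.map_id _)
  rw [t.2.2 W e' _ a he, t'.2.2 W e' _ a he, t.2.1 ⟨V, le_rfl⟩ W W.2, t'.2.1 ⟨V, le_rfl⟩ W W.2, h]

/-- Every function is the coordinate of a section with respect to a given generator. -/
theorem exists_coord_eq {V : S.Opens} (e : Gen L V) (y : Γ(S, V)) :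
    ∃ t : powSections L q V, t.1 ⟨V, le_rfl⟩ e = y := by
  have hid : ∀ {W : S.Opens} (e : Gen L W), L.presheaf.map (homOfLE le_rfl).op e.1 = e.1 :=
    fun {W} e => congrArg (fun k : L.presheaf.obj (op W) ⟶ L.presheaf.obj (op W) => k e.1)
        (L.presheaf.map_id _)
  have hex : ∀ (W : {W : S.Opens // W ≤ V}) (e' : Gen L W.1), ∃ a : Γ(S, W.1),
      (e.res W.2).1 = a • e'.1 := fun W e' => by
    obtain ⟨a, ha⟩ := (e'.2 W.1 le_rfl).2 (e.res W.2).1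
    exact ⟨a, ha.symm.trans (congrArg (a • ·) (hid e'))⟩
  have huniq : ∀ {W : S.Opens} (e' : Gen L W) (a b : Γ(S, W)), a • e'.1 = b • e'.1 → a = b :=
    fun {W} e' a b hab => (e'.2 W le_rfl).1 (by
      refine (congrArg (a • ·) (hid e')).trans (hab.trans ?_)
      exact congrArg (b • ·) (hid e').symm)
  choose a ha using hex
  refine ⟨⟨fun W e' => a W e' ^ q * fres W.2 y, fun W W' h e' => ?_, fun W e' e'' b h => ?_⟩, ?_⟩
  · have h1 : a W' (e'.res h) = fres h (a W e') := by
      refine huniq (e'.res h) _ _ ((ha W' (e'.res h)).symm.trans ?_)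
      rw [← e.res_res W.2 h]
      refine (congrArg (L.presheaf.map (homOfLE h).op) (ha W e')).trans ?_
      exact L.map_smul _ _ _
    beta_reduce
    rw [map_mul, map_pow, fres_fres, h1]
  · have h1 : a W e' = b * a W e'' := by
      refine huniq e' _ _ ((ha W e').symm.trans ((ha W e'').trans ?_))
      rw [mul_comm]
      exact (congrArg (a W e'' • ·) h).trans (SemigroupAction.mul_smul _ _ _).symm
    beta_reduce
    rw [h1, mul_pow, mul_assoc]
  · have h1 : a ⟨V, le_rfl⟩ e = 1 := huniq e _ _ (by
      exact (ha ⟨V, le_rfl⟩ e).symm.trans ((hid e).trans (MulAction.one_smul e.1).symm))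
    change a ⟨V, le_rfl⟩ e ^ q * fres le_rfl y = y
    rw [h1, one_pow, one_mul]
    exact congrArg (fun k : Γ(S, V) ⟶ Γ(S, V) => k y) (S.presheaf.map_id _)

end powSections

end

end SmoothProfinite

/-! ### Čech cohomology of powers of `L` over affine opens, and kernels of reduction -/

namespace SmoothProfinite

noncomputable section

set_option linter.unusedSectionVars false

variable {S : Scheme.{u}} {L : S.Modules}

namespace powSections

variable {q : ℕ}

/-- A section over a basic open subset extends after multiplication by a power of the function. -/
theorem exists_res_eq_smul {U V W : S.Opens} (hV : IsAffineOpen V) (e : Gen L V) (h : V ≤ U)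
    (f : Γ(S, U)) (hW : W = V ⊓ S.basicOpen f) (hWV : W ≤ V) (t : powSections L q W) :
    ∃ (n : ℕ) (t' : powSections L q V), res hWV t' = smul (hWV.trans h) (f ^ n) t := by
  obtain rfl : W = S.basicOpen (fres h f) := hW.trans (S.basicOpen_res f (homOfLE h).op).symm
  obtain ⟨n, y, hy⟩ := exists_eq_pow_mul_of_isAffineOpen S V hV (fres h f)
    (t.1 ⟨_, le_rfl⟩ (e.res hWV))
  obtain ⟨t', ht'⟩ := exists_coord_eq (q := q) e y
  refine ⟨n, t', ext_of_gen (e.res hWV) ?_⟩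
  refine (t'.2.1 ⟨V, le_rfl⟩ ⟨_, hWV⟩ hWV e).trans ?_
  rw [ht', smul_apply, map_pow, ← fres_fres h hWV]
  exact hy

/-- A section vanishing on a basic open subset is killed by a power of the function. -/
theorem exists_smul_eq_zero {U V W : S.Opens} (hV : IsAffineOpen V) (e : Gen L V) (h : V ≤ U)
    (f : Γ(S, U)) (hW : W = V ⊓ S.basicOpen f) (hWV : W ≤ V) (t : powSections L q V)
    (ht : res hWV t = 0) : ∃ n : ℕ, smul h (f ^ n) t = 0 := by
  obtain rfl : W = S.basicOpen (fres h f) := hW.trans (S.basicOpen_res f (homOfLE h).op).symm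
  obtain ⟨n, hn⟩ := exists_pow_mul_eq_zero_of_res_basicOpen_eq_zero_of_isCompact S hV.isCompact
    (t.1 ⟨V, le_rfl⟩ e) (fres h f) (by
      refine (t.2.1 ⟨V, le_rfl⟩ ⟨_, hWV⟩ hWV e).symm.trans ?_
      exact congrArg (fun k : powSections L q _ => k.1 ⟨_, le_rfl⟩ (e.res hWV)) ht)
  refine ⟨n, ext_of_gen e ?_⟩
  rw [smul_apply, map_pow]
  exact hn

theorem smul_smul_pow_add {U V : S.Opens} (h : V ≤ U) (f : Γ(S, U)) (m n : ℕ)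
    (t : powSections L q V) : smul h (f ^ m) (smul h (f ^ n) t) = smul h (f ^ (m + n)) t := by
  rw [pow_add, mul_smul]

theorem exists_smul_eq_zero_of_finite {κ : Type*} [Finite κ] {U : S.Opens} (f : Γ(S, U))
    {V : κ → S.Opens} (h : ∀ i, V i ≤ U) (t : ∀ i, powSections L q (V i))
    (ht : ∀ i, ∃ n : ℕ, smul (h i) (f ^ n) (t i) = 0) :
    ∃ n : ℕ, ∀ i, smul (h i) (f ^ n) (t i) = 0 := by
  cases nonempty_fintype κ
  choose n hn using ht
  refine ⟨∑ i, n i, fun i => ?_⟩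
  obtain ⟨m, hm⟩ := Nat.exists_eq_add_of_le'
    (Finset.single_le_sum (f := n) (fun _ _ => Nat.zero_le _) (Finset.mem_univ i))
  rw [hm, ← smul_smul_pow_add, hn, map_zero]

theorem exists_res_eq_smul_of_finite {κ : Type*} [Finite κ] {U : S.Opens} (f : Γ(S, U))
    {V W : κ → S.Opens} (h : ∀ i, V i ≤ U) (hW : ∀ i, W i ≤ V i) (t : ∀ i, powSections L q (W i))
    (ht : ∀ i, ∃ (n : ℕ) (t' : powSections L q (V i)),
      res (hW i) t' = smul ((hW i).trans (h i)) (f ^ n) (t i)) :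
    ∃ (n : ℕ) (t' : ∀ i, powSections L q (V i)),
      ∀ i, res (hW i) (t' i) = smul ((hW i).trans (h i)) (f ^ n) (t i) := by
  cases nonempty_fintype κ
  choose n t' hn using ht
  have hm : ∀ i, ∃ m, ∑ i, n i = m + n i := fun i => Nat.exists_eq_add_of_le'
    (Finset.single_le_sum (f := n) (fun _ _ => Nat.zero_le _) (Finset.mem_univ i))
  choose m hm using hm
  refine ⟨∑ i, n i, fun i => smul (h i) (f ^ m i) (t' i), fun i => ?_⟩
  rw [res_smul, hn, smul_smul_pow_add, ← hm]

set_option maxHeartbeats 1000000 in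
/-- The first Čech cohomology of a power of a line bundle over an affine open subset vanishes. -/
theorem exists_cochain_eq {ι : Type*} [Finite ι] {U : S.Opens} (hU : IsAffineOpen U)
    (f : ι → Γ(S, U)) (hf : Ideal.span (Set.range f) = ⊤) (e : ∀ i, Gen L (S.basicOpen (f i)))
    (c : ∀ i j, powSections L q (S.basicOpen (f i) ⊓ S.basicOpen (f j)))
    (hc : ∀ (i j k : ι) (W : S.Opens) (hi : W ≤ S.basicOpen (f i)) (hj : W ≤ S.basicOpen (f j))
      (hk : W ≤ S.basicOpen (f k)), res (le_inf hi hk) (c i k) =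
        res (le_inf hi hj) (c i j) + res (le_inf hj hk) (c j k)) :
    ∃ a : ∀ i, powSections L q (S.basicOpen (f i)),
      ∀ i j, res inf_le_left (a i) - res inf_le_right (a j) = c i j := by
  have hD : ∀ i, S.basicOpen (f i) ≤ U := fun i => S.basicOpen_le (f i)
  have hDD : ∀ i j, S.basicOpen (f i) ⊓ S.basicOpen (f j) ≤ U := fun i j =>
    inf_le_left.trans (hD i)
  -- `J` consists of the functions `h` for which `h c` is a coboundary; the aim is to show `1 ∈ J`.
  let J : Ideal Γ(S, U) :=
    { carrier := {h | ∃ a : ∀ i, powSections L q (S.basicOpen (f i)),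
        ∀ i j, res inf_le_left (a i) - res inf_le_right (a j) = smul (hDD i j) h (c i j)}
      zero_mem' := ⟨0, fun i j => by
        rw [zero_smul, Pi.zero_apply, Pi.zero_apply, map_zero, map_zero, sub_zero]⟩
      add_mem' := by
        rintro h h' ⟨a, ha⟩ ⟨a', ha'⟩
        refine ⟨a + a', fun i j => ?_⟩
        rw [add_smul, ← ha, ← ha', Pi.add_apply, Pi.add_apply, map_add, map_add]
        abel
      smul_mem' := by
        rintro r h ⟨a, ha⟩
        refine ⟨fun i => smul (hD i) r (a i), fun i j => ?_⟩
        rw [smul_eq_mul, mul_smul, ← ha, map_sub, res_smul, res_smul] }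
  -- Over `D(f_k)` the sections `c_ik` bound `c`. A power of `f_k` makes them extend to `D(f_i)`,
  -- and a further power kills the difference of the resulting coboundary with the multiple of `c`,
  -- which vanishes on `D(f_k)`.
  have hrad : ∀ k, f k ∈ J.radical := fun k => by
    obtain ⟨n, a, ha⟩ := exists_res_eq_smul_of_finite (f k) hD
      (fun i => (inf_le_left : S.basicOpen (f i) ⊓ S.basicOpen (f k) ≤ _)) (fun i => c i k)
      fun i => exists_res_eq_smul (hU.basicOpen (f i)) (e i) (hD i) (f k) rfl inf_le_left (c i k)
    obtain ⟨m, hm⟩ := exists_smul_eq_zero_of_finite (f k) (fun x : ι × ι => hDD x.1 x.2)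
      (fun x => res inf_le_left (a x.1) - res inf_le_right (a x.2) -
        smul (hDD x.1 x.2) (f k ^ n) (c x.1 x.2)) fun x => by
      have haff : IsAffineOpen (S.basicOpen (f x.1) ⊓ S.basicOpen (f x.2)) := by
        rw [← S.basicOpen_mul]
        exact hU.basicOpen _
      refine exists_smul_eq_zero haff ((e x.1).res inf_le_left) (hDD x.1 x.2) (f k) rfl
        inf_le_left _ ?_
      have hi : (S.basicOpen (f x.1) ⊓ S.basicOpen (f x.2)) ⊓ S.basicOpen (f k) ≤
        S.basicOpen (f x.1) := inf_le_left.trans inf_le_left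
      have hj : (S.basicOpen (f x.1) ⊓ S.basicOpen (f x.2)) ⊓ S.basicOpen (f k) ≤
        S.basicOpen (f x.2) := inf_le_left.trans inf_le_right
      have h1 := congrArg (res (le_inf hi inf_le_right)) (ha x.1)
      have h2 := congrArg (res (le_inf hj inf_le_right)) (ha x.2)
      rw [res_res, res_smul] at h1 h2
      rw [map_sub, map_sub, res_res, res_res, res_smul, h1, h2,
        hc x.1 x.2 k _ hi hj inf_le_right, map_add]
      abel
    refine ⟨m + n, fun i => smul (hD i) (f k ^ m) (a i), fun i j => ?_⟩
    have := hm (i, j)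
    rw [map_sub, sub_eq_zero, map_sub, smul_smul_pow_add] at this
    rw [← this, res_smul, res_smul]
  have hJ : J = ⊤ := by
    rw [← Ideal.radical_eq_top, ← top_le_iff, ← hf, Ideal.span_le]
    rintro _ ⟨k, rfl⟩
    exact hrad k
  obtain ⟨a, ha⟩ : (1 : Γ(S, U)) ∈ J := hJ ▸ Submodule.mem_top
  exact ⟨a, fun i j => by rw [ha, one_smul]⟩

end powSections

/-! ## The kernel of the reduction -/

variable {p : ℕ} [Fact p.Prime] (hS : IsPerfectOfChar p S)

/-- The section of `W_{s+1}(L)` with trivial reduction and given last coordinate. -/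
def lastSection (s : ℕ) {U : S.Opens} (t : powSections L (p ^ s) U) :
    wittSections p L (s + 1) U :=
  wittOfCoeff hS (fun V e i => if i = s then t.1 V e else 0)
    (fun V V' h e i => by
      split_ifs
      · exact t.2.1 V V' h e
      · exact (map_zero _).symm)
    (fun V e e' a i h => by
      split_ifs with hi
      · rw [hi]
        exact t.2.2 V e e' a h
      · exact (mul_zero _).symm)

theorem coeff_lastSection (s : ℕ) {U : S.Opens} (t : powSections L (p ^ s) U)
    (V : {V : S.Opens // V ≤ U}) (e : Gen L V.1) (i : Fin (s + 1)) :
    ((lastSection hS s t).1 V e).coeff i = if (i : ℕ) = s then t.1 V e else 0 :=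
  coeff_wittOfCoeff hS _ _ _ V e i

theorem coeff_castSucc_lastSection (s : ℕ) {U : S.Opens} (t : powSections L (p ^ s) U)
    (V : {V : S.Opens // V ≤ U}) (e : Gen L V.1) (i : Fin s) :
    ((lastSection hS s t).1 V e).coeff i.castSucc = 0 := by
  rw [coeff_lastSection]
  exact if_neg i.2.ne

theorem lastSection_add (s : ℕ) {U : S.Opens} (t t' : powSections L (p ^ s) U) :
    lastSection hS s (t + t') = lastSection hS s t + lastSection hS s t' :=
  wittSections_ext fun V e i => by
    refine Eq.trans ?_ (coeff_add_of_last _ _ (coeff_castSucc_lastSection hS s t V e)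
      (coeff_castSucc_lastSection hS s t' V e) i).symm
    rw [coeff_lastSection, coeff_lastSection, coeff_lastSection]
    split_ifs
    · rfl
    · exact (add_zero _).symm

theorem wres_lastSection (s : ℕ) {U V : S.Opens} (h : V ≤ U) (t : powSections L (p ^ s) U) :
    wres L (s + 1) h (lastSection hS s t) = lastSection hS s (powSections.res h t) :=
  wittSections_ext fun W e i => by
    rw [wres_apply, coeff_lastSection, coeff_lastSection]
    rfl

theorem lastSection_injective (s : ℕ) (U : S.Opens) :
    Function.Injective (lastSection (L := L) hS s (U := U)) := fun t t' h =>
  powSections.ext fun V e => by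
    have := congrArg (fun k : wittSections p L (s + 1) U => (k.1 V e).coeff (Fin.last s)) h
    simpa only [coeff_lastSection, Fin.val_last, if_true] using this

theorem exists_eq_lastSection (s : ℕ) {U : S.Opens} (f : wittSections p L (s + 1) U)
    (hf : wred L s U f = 0) : ∃ t, f = lastSection hS s t := by
  refine ⟨⟨fun V e => (f.1 V e).coeff (Fin.last s),
    fun V V' h e => coeff_res_section f V V' h e _,
    fun V e e' a h => coeff_smul_section hS f V e e' a h _⟩, wittSections_ext fun V e i => ?_⟩
  rw [coeff_lastSection]
  induction i using Fin.lastCases with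
  | last => rw [Fin.val_last, if_pos rfl]
  | cast i =>
    rw [Fin.val_castSucc, if_neg i.2.ne, ← coeff_wred, hf]
    exact TruncatedWittVector.coeff_zero p s _ i

end

end SmoothProfinite

namespace SmoothProfinite

noncomputable section

set_option linter.unusedSectionVars false

variable {p : ℕ} [Fact p.Prime] {S : Scheme.{u}} {L : S.Modules}

/-! ## Sections of `W(L)`-torsors over affine open subsets -/

namespace Torsor

/-- Compatible local sections of a torsor glue. -/
theorem exists_glue {M : TopCat.Presheaf Ab.{u} S} (P : Torsor M) {ι : Type*} {U : S.Opens}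
    (V : ι → S.Opens) (hV : ∀ i, V i ≤ U) (hU : U ≤ iSup V) (x : ∀ i, P.sheaf.1.obj (op (V i)))
    (hx : ∀ i j, P.res inf_le_left (x i) = P.res (inf_le_right : V i ⊓ V j ≤ V j) (x j)) :
    ∃ y : P.sheaf.1.obj (op U), ∀ i, P.res (hV i) y = x i := by
  obtain ⟨y, hy, -⟩ := TopCat.Sheaf.existsUnique_gluing' P.sheaf V U (fun i => homOfLE (hV i)) hU
    (show ∀ i, ToType (P.sheaf.1.obj (op (V i))) from x) (fun i j => hx i j)
  exact ⟨y, hy⟩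

end Torsor

namespace WittTorsor

variable (P : WittTorsor p L) (hS : IsPerfectOfChar p S)

include hS

/-- Sections of the components of a `W(L)`-torsor lift locally. -/
theorem exists_red_eq_res (s : ℕ) {U : S.Opens} (x : (P.level s).sheaf.1.obj (op U)) {z : S}
    (hz : z ∈ U) : ∃ (V : S.Opens) (hV : V ≤ U), z ∈ V ∧
      ∃ y : (P.level (s + 1)).sheaf.1.obj (op V), P.red s y = (P.level s).res hV x := by
  obtain ⟨V, hzV, ⟨y⟩⟩ := (P.level (s + 1)).exists_local z
  refine ⟨U ⊓ V, inf_le_left, ⟨hz, hzV⟩, ?_⟩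
  obtain ⟨m, hm⟩ := (P.level s).exists_vadd
    (P.red s ((P.level (s + 1)).res (inf_le_right : U ⊓ V ≤ V) y))
    ((P.level s).res (inf_le_left : U ⊓ V ≤ U) x)
  obtain ⟨n, hn⟩ := wred_surjective hS s (U ⊓ V) m
  refine ⟨(P.level (s + 1)).vadd n ((P.level (s + 1)).res inf_le_right y), ?_⟩
  refine (P.red_vadd s n _).trans (Eq.trans ?_ hm)
  exact congrArg (fun k => (P.level s).vadd k _) hn

/-- Two sections with the same reduction differ by a section of the kernel of the reduction. -/
theorem exists_lastSection_vadd (s : ℕ) {U : S.Opens}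
    (x y : (P.level (s + 1)).sheaf.1.obj (op U)) (h : P.red s x = P.red s y) :
    ∃ t, (P.level (s + 1)).vadd (lastSection hS s t) x = y := by
  obtain ⟨m, rfl⟩ := (P.level (s + 1)).exists_vadd x y
  have hm : wred L s U m = 0 := by
    refine (P.level s).vadd_right_cancel (x := P.red s x) ?_
    refine (P.red_vadd s m x).symm.trans (h.symm.trans ((P.level s).zero_vadd _).symm)
  obtain ⟨t, ht⟩ := exists_eq_lastSection hS s m hm
  exact ⟨t, congrArg (fun k => (P.level (s + 1)).vadd k x) ht.symm⟩

theorem lastSection_vadd_vadd (s : ℕ) {U : S.Opens} (t t' : powSections L (p ^ s) U)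
    (x : (P.level (s + 1)).sheaf.1.obj (op U)) :
    (P.level (s + 1)).vadd (lastSection hS s t) ((P.level (s + 1)).vadd (lastSection hS s t') x) =
      (P.level (s + 1)).vadd (lastSection hS s (t + t')) x := by
  refine ((P.level (s + 1)).add_vadd _ _ x).symm.trans ?_
  exact congrArg (fun k => (P.level (s + 1)).vadd k x) (lastSection_add hS s t t').symm

theorem res_lastSection_vadd (s : ℕ) {U V : S.Opens} (h : V ≤ U) (t : powSections L (p ^ s) U)
    (x : (P.level (s + 1)).sheaf.1.obj (op U)) :
    (P.level (s + 1)).res h ((P.level (s + 1)).vadd (lastSection hS s t) x) =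
      (P.level (s + 1)).vadd (lastSection hS s (powSections.res h t))
        ((P.level (s + 1)).res h x) := by
  refine ((P.level (s + 1)).res_vadd h _ x).trans ?_
  exact congrArg (fun k => (P.level (s + 1)).vadd k ((P.level (s + 1)).res h x))
    (wres_lastSection hS s h t)

theorem lastSection_vadd_cancel (s : ℕ) {U : S.Opens} {t t' : powSections L (p ^ s) U}
    {x : (P.level (s + 1)).sheaf.1.obj (op U)}
    (h : (P.level (s + 1)).vadd (lastSection hS s t) x =
      (P.level (s + 1)).vadd (lastSection hS s t') x) : t = t' :=
  lastSection_injective hS s U ((P.level (s + 1)).vadd_right_cancel h)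

set_option maxHeartbeats 1000000 in
/-- Over an affine open subset, sections lift along the reduction. -/
theorem nonempty_succ_of_isAffineOpen (hL : IsLineBundle L) {U : S.Opens} (hU : IsAffineOpen U)
    (s : ℕ) (x : (P.level s).sheaf.1.obj (op U)) :
    Nonempty ((P.level (s + 1)).sheaf.1.obj (op U)) := by
  -- Local lifts of `x` are taken over basic opens on which `L` has a generator, as the Čech
  -- computation requires.
  have hloc : ∀ z : U, ∃ f : Γ(S, U), (z : S) ∈ S.basicOpen f ∧ Nonempty (Gen L (S.basicOpen f)) ∧
      ∃ y : (P.level (s + 1)).sheaf.1.obj (op (S.basicOpen f)),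
        P.red s y = (P.level s).res (S.basicOpen_le f) x := fun z => by
    obtain ⟨V, hV, hzV, y, hy⟩ := P.exists_red_eq_res hS s x z.2
    obtain ⟨W, hzW, ⟨e⟩⟩ := hL z
    obtain ⟨f, hf, hzf⟩ := hU.exists_basicOpen_le (V := V ⊓ W) ⟨z, hzV, hzW⟩ z.2
    refine ⟨f, hzf, ⟨e.res (hf.trans inf_le_right)⟩,
      (P.level (s + 1)).res (hf.trans inf_le_left) y, ?_⟩
    rw [P.red_res, hy, Torsor.res_res]
  choose f hzf hgen hy using hloc
  have hspan : Ideal.span (Set.range f) = ⊤ := by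
    rw [← hU.self_le_iSup_basicOpen_iff]
    exact fun z hz => Opens.mem_iSup.2 ⟨⟨f ⟨z, hz⟩, ⟨z, hz⟩, rfl⟩, hzf _⟩
  obtain ⟨T, hT, hT'⟩ := (Ideal.span_eq_top_iff_finite _).1 hspan
  choose w hw using fun i : T => hT i.2
  have hwspan : Ideal.span (Set.range fun i : T => f (w i)) = ⊤ := by
    rw [← hT']
    congr 1
    ext a
    simp [hw]
  let e : ∀ i : T, Gen L (S.basicOpen (f (w i))) := fun i => (hgen (w i)).some
  choose y hy using fun i : T => hy (w i)
  let D : T → S.Opens := fun i => S.basicOpen (f (w i))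
  have hcov : U ≤ iSup D := by
    intro z hz
    obtain ⟨⟨_, i, rfl⟩, hi⟩ := Opens.mem_iSup.1 (hU.self_le_iSup_basicOpen_iff.2 hwspan hz)
    exact Opens.mem_iSup.2 ⟨i, hi⟩
  have hres : ∀ (i j : T) (W : S.Opens) (hi : W ≤ D i) (hj : W ≤ D j),
      P.red s ((P.level (s + 1)).res hj (y j)) = P.red s ((P.level (s + 1)).res hi (y i)) :=
    fun i j W hi hj => by
      rw [P.red_res, P.red_res, hy, hy, Torsor.res_res, Torsor.res_res]
  -- All local lifts reduce to `x`, so they differ by sections of the `p ^ s`-th power of `L`. These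
  -- form a Čech cocycle, and the cochain bounding it corrects the lifts so that they glue.
  choose c hc using fun i j : T => P.exists_lastSection_vadd hS s _ _
    (hres i j (D i ⊓ D j) inf_le_left inf_le_right)
  have hc' : ∀ (i j : T) (W : S.Opens) (hi : W ≤ D i) (hj : W ≤ D j),
      (P.level (s + 1)).vadd (lastSection hS s (powSections.res (le_inf hi hj) (c i j)))
        ((P.level (s + 1)).res hj (y j)) = (P.level (s + 1)).res hi (y i) := fun i j W hi hj => by
    have := congrArg ((P.level (s + 1)).res (le_inf hi hj)) (hc i j)
    rw [P.res_lastSection_vadd, Torsor.res_res, Torsor.res_res] at this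
    exact this
  obtain ⟨a, ha⟩ := powSections.exists_cochain_eq hU (fun i => f (w i)) hwspan e c
    fun i j k W hi hj hk => P.lastSection_vadd_cancel hS s
      (x := (P.level (s + 1)).res hk (y k)) (by
        rw [hc' i k W hi hk, ← P.lastSection_vadd_vadd, hc' j k W hj hk, hc' i j W hi hj])
  obtain ⟨v, -⟩ := (P.level (s + 1)).exists_glue D (fun i => S.basicOpen_le _) hcov
    (fun i => (P.level (s + 1)).vadd (lastSection hS s (-a i)) (y i)) fun i j => by
      rw [P.res_lastSection_vadd, P.res_lastSection_vadd, ← hc i j, P.lastSection_vadd_vadd,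
        ← ha i j, map_neg, map_neg]
      congr 2
      abel
  exact ⟨v⟩

/-- The components of a `W(L)`-torsor have sections over affine open subsets. -/
theorem nonempty_of_isAffineOpen (hL : IsLineBundle L) {U : S.Opens} (hU : IsAffineOpen U)
    (s : ℕ) : Nonempty ((P.level s).sheaf.1.obj (op U)) := by
  induction s with
  | zero =>
    -- Since `W_0(L) = 0`, any two sections over the same open are equal, and local sections glue.
    choose V hzV hV using (P.level 0).exists_local
    have heq : ∀ {W : S.Opens} (x y : (P.level 0).sheaf.1.obj (op W)), x = y := fun x y => by
      obtain ⟨m, rfl⟩ := (P.level 0).exists_vadd x y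
      refine ((P.level 0).zero_vadd x).symm.trans ?_
      exact congrArg (fun k => (P.level 0).vadd k x) (eq_zero_of_wittSections_zero m).symm
    obtain ⟨v, -⟩ := (P.level 0).exists_glue (fun z : U => U ⊓ V z) (fun z => inf_le_left)
      (fun z hz => Opens.mem_iSup.2 ⟨⟨z, hz⟩, hz, hzV z⟩)
      (fun z => (P.level 0).res inf_le_right (hV z).some) fun i j => heq _ _
    exact ⟨v⟩
  | succ s ih =>
    obtain ⟨x⟩ := ih
    exact P.nonempty_succ_of_isAffineOpen hS hL hU s x

end WittTorsor

end

end SmoothProfinite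

/-! ### Conclusion -/

theorem mainTheorem5 {G : Type v} [Group G] [TopologicalSpace G] [IsTopologicalGroup G]
    [CompactSpace G] [TotallyDisconnectedSpace G] (p : ℕ) [Fact p.Prime]
    (χ : G →* ℤ_[p]ˣ) (hχ : IsOneInftyCyclotomic p χ)
    (S : Scheme.{u}) [CompactSpace S] (A : GSchemeAction G S) (hS : IsPerfectOfChar p S)
    (L : S.Modules) (hL : IsLineBundle L) (σ : A.Linearization L)
    (r : ℕ) (hr : 1 ≤ r)
    (Pr : Torsor (wittLine p L r)) (τ : Pr.GStructure (σ.wittTwist p hS.char_eq hχ.1 r))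
    (P : WittTorsor p L) (ι : TorsorHom (𝟙 (wittLine p L r)) (P.level r) Pr)
    (hP : P.IsGInvariant (σ.wittTwist p hS.char_eq hχ.1)) :
    ∃ ρ : P.GStructure (σ.wittTwist p hS.char_eq hχ.1),
      ∀ (g : G) {U V : S.Opens} (h : V ≤ A.image g U) (x : (P.level r).sheaf.1.obj (op U)),
        ι.hom.app (op V) ((ρ.level r).act g h x) = τ.act g h (ι.hom.app (op U) x) := by
  obtain ⟨ρ₀, hρ₀⟩ := LimHom.exists_isSplitting σ hS hχ
    fun g => LimHom.nonempty_of_isGInvariant hP g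
  obtain ⟨ρ, hρ, hρτ⟩ := LimHom.exists_isSplitting_lift σ hS hχ hρ₀ τ ι
  -- A splitting is already an action; what remains is to find sections over invariant opens, and
  -- the invariant affine opens covering `S` provide them.
  refine ⟨hρ.gStructure fun s z => ?_, fun g _ _ h x => hρτ g h x⟩
  obtain ⟨U, hz, hU, hinv⟩ := A.exists_affine z
  refine ⟨U, hz, fun g => ?_, P.nonempty_of_isAffineOpen hS hL hU s⟩
  -- The translate `A.image g U` is a preimage under the action of `g⁻¹`, hence the inverse.
  have h := hinv g⁻¹
  rw [map_inv] at h
  exact h
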